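/- **Setting.** Let $\Phi$ be a reduced simply-laced (crystallographic, finite) root system with simple roots $\alpha_1,\dots,\alpha_r$, positive roots $\Phi^+$, root lattice $\Lambda$, fundamental weights $\varpi_1,\dots,\varpi_r$, Weyl group $W$ with simple reflections $\sigma_1,\dots,\sigma_r$, and invariant scalar product $\langle\cdot,\cdot\rangle$ normalised by $\langle\alpha,\alpha\rangle=2$ for all roots. For $\lambda=\sum k_i\alpha_i$ put $d(\lambda)=\sum k_i$ and $\mathbf x^\lambda=\prod x_i^{k_i}$; write $j\sim i$ if $i,j$ are adjacent in the Dynkin diagram. Fix $\ell=(l_1,\dots,l_r)\in\mathbb Z_{\ge0}^r$ and let $\rho=\sum\varpi_i$, $\theta=\rho+\sum l_i\varpi_i$, $d_\theta(\lambda)=\langle\theta,\lambda\rangle$. For $w\in W$ let $\Phi(w)$ be the set of positive roots made negative by $w$. Let $O$ be an integral domain with fraction field $K$, $p\in O$ a prime element whose residue ring $O/pO$ is finite of odd order $q$, and $\psi:K\to\mathbb C^\times$ an additive character that is trivial on $O$ but not on $p^{-1}O$. Put $G(p^m,p^n)=\sum_{c \bmod p^n}\left(\frac cp\right)^n\psi(p^mc/p^n)$,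 with $\left(\frac{\cdot}{p}\right)$ the quadratic residue symbol. The normalised quadratic Gauss sum is $g_1(p^m,p^n)=\varepsilon^{-1}G(p^m,p^n)$ for $n$ odd, where $\varepsilon=G(1,p)/|G(1,p)|$ (so that $g_1(1,p)>0$), and $g_1(p^m,p^n)=G(p^m,p^n)$ for $n$ even. Let $F=\mathbb C(x_1,\dots,x_r)$. Define $\sigma_i\mathbf x=\mathbf x'$ by $x_j'=x_ix_j\sqrt q$ if $j\sim i$, $x_i'=1/(qx_i)$, and $x_j'=x_j$ otherwise; let $\epsilon_i\mathbf x$ be obtained from $\mathbf x$ by replacing $x_j$ by $-x_j$ for all $j\sim i$. For $f\in F$ put $f^{\pm}_{i,\ell}(\mathbf x)=\tfrac12\bigl(f(\mathbf x)\pm(-1)^{l_i}f(\epsilon_i\mathbf x)\bigr)$ and $$(f|_\ell\sigma_i)(\mathbf x)=-\frac{1-qx_i}{qx_i(1-x_i)}(x_i\sqrt q)^{l_i}f^+_{i,\ell}(\sigma_i\mathbf x)+\frac1{x_i\sqrt q}(x_i\sqrt q)^{l_i}f^-_{i,\ell}(\sigma_i\mathbf x),$$ extended to the right action $f|_\ell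 w$ of $W$ on $F$ by $f|_\ell(\sigma_{i_1}\cdots\sigma_{i_n})=(\cdots(f|_\ell\sigma_{i_1})\cdots)|_\ell\sigma_{i_n}$. Put $$\Delta(\mathbf x)=\prod_{\alpha\in\Phi^+}(1-q^{d(\alpha)}\mathbf x^{2\alpha}),\quad D(\mathbf x)=\prod_{\alpha\in\Phi^+}(1-q^{d(\alpha)-1}\mathbf x^{2\alpha}),\quad j(w,\mathbf x)=\frac{\Delta(\mathbf x)}{\Delta(w\mathbf x)},$$ $$f(\mathbf x;\ell)=\Delta(\mathbf x)^{-1}\sum_{w\in W}j(w,\mathbf x)(1|_\ell w)(\mathbf x),\qquad N(\mathbf x;\ell)=f(\mathbf x;\ell)D(\mathbf x).$$ **Theorem.** (i) $N(\mathbf x;\ell)=\sum_\lambda a_\lambda\mathbf x^\lambda$ is a polynomial with $a_0=1$, and for every $w\in W$ the vertex $\lambda=\theta-w^{-1}\theta$ lies in $\sum_i\mathbb Z_{\ge0}\alpha_i$ and $$a_\lambda=A_\lambda:=\prod_{\alpha\in\Phi(w^{-1})}\frac{g_1\bigl(p^{d_\theta(\alpha)-1},p^{d_\theta(\alpha)}\bigr)}{q^{d_\theta(\alpha)/2}},$$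 the stable coefficient of Brubaker–Bump–Friedberg. (ii) More generally, if $Q=\sum_\lambda a_\lambda\mathbf x^\lambda$ is any polynomial with $a_0=1$ such that $(Q/D)|_\ell\sigma_i=Q/D$ for $i=1,\dots,r$, then $a_\lambda=A_\lambda$ for $\lambda=\theta-w^{-1}\theta$ and every $w\in W$. -/

import Mathlib

noncomputable section

namespace TwistedWMDS

section RootData

variable {ι M N : Type*} [Fintype ι] [AddCommGroup M] [Module ℝ M] [AddCommGroup N] [Module ℝ N]
variable {P : RootPairing ι ℝ M N}

/-- The fundamental weight `ϖ_k`, i.e. the element of `M` with `⟨ϖ_k, α_j^∨⟩ = δ_{jk}` for all simple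
coroots `α_j^∨`. In the simply-laced case, with the invariant scalar product for which all roots have
squared length `2`, roots and coroots are identified, and these form the basis dual to the simple
roots. -/
def fundamentalWeight [P.IsRootSystem] (b : P.Base) (k : b.support) : M :=
  P.toPerfPair.symm (b.toCoweightBasis.coord k)

/-- `ρ`, the sum of the fundamental weights. -/
def rho [P.IsRootSystem] (b : P.Base) : M := ∑ k, fundamentalWeight b k

/-- `θ = ρ + ∑ l_k ϖ_k`. -/
def theta [P.IsRootSystem] (b : P.Base) (l : b.support → ℕ) : M :=
  rho b + ∑ k, l k • fundamentalWeight b k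

/-- `d_θ(α) = ⟨θ, α⟩` for the root `α` of index `i`. For a simply-laced root system `⟨θ, α⟩` is the
pairing of `θ` with the coroot of `α`; it is a positive integer when `α` is a positive root, so the
floor does nothing there. -/
def dTheta [P.IsRootSystem] (b : P.Base) (l : b.support → ℕ) (i : ι) : ℕ :=
  ⌊P.toLinearMap (theta b l) (P.coroot i)⌋₊

/-- The exponent vector `(k_j)` of a positive root `α = ∑ k_j α_j`, of index `i`. -/
def rootExponent [P.IsRootSystem] (b : P.Base) (i : ι) : b.support →₀ ℕ :=
  (b.toWeightBasis.repr (P.root i)).mapRange Nat.floor Nat.floor_zero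

open Classical in
/-- `Φ(w)`: the (indices of the) positive roots that are made negative by `w`. -/
def inversionSet (b : P.Base) (w : P.weylGroup) : Finset ι :=
  {i : ι | b.IsPos i ∧ ¬ b.IsPos (w • i)}

/-- The product `σ_{i₁} σ_{i₂} ⋯` of the simple reflections along a word `i₁, i₂, …`. -/
def wordProd (b : P.Base) (L : List b.support) : P.weylGroup :=
  (L.map fun i => RootPairing.weylGroup.ofIdx P (i : ι)).prod

end RootData

section Gauss

variable {O K : Type*} [CommRing O] [Field K] [Algebra O K]

/-- The norm `q = |O / pO|` of `p`. -/
def normOf (p : O) : ℕ := Nat.card (O ⧸ Ideal.span {p})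

open Classical in
/-- The quadratic residue symbol `(d / p)`, for `p` a prime element with residue field of odd order. -/
def residueSymbol (p d : O) : ℤ :=
  if p ∣ d then 0 else if ∃ y : O, p ∣ d - y ^ 2 then 1 else -1

/-- The Gauss sum of modulus `p^n` formed with the quadratic residue symbol `(c / p^n) = (c / p)^n`
and with the additive character `c ↦ ψ(p^m c / p^n)`. When `ψ` is trivial on `O` the summand depends
only on the class of `c` modulo `p^n`, so the choice of representatives is immaterial. -/
def rawGaussSum (p : O) (ψ : AddChar K ℂ) (m n : ℕ) : ℂ :=
  ∑ᶠ c : O ⧸ Ideal.span {p ^ n},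
    let d : O := Function.surjInv Ideal.Quotient.mk_surjective c
    ((residueSymbol p d : ℤ) : ℂ) ^ n * ψ (algebraMap O K (p ^ m * d) / algebraMap O K (p ^ n))

/-- The quadratic Gauss sum `g₁(p^m, p^n)`, with the phase of the Gauss sums formed with the nontrivial
quadratic symbol (`n` odd) normalised so that `g₁(1, p)` is positive. (For `O = ℤ` and `ψ` the standard
character this is the classical factor `1` or `-i`, according as `p ≡ 1` or `3` modulo `4`.) -/
def gaussSum₁ (p : O) (ψ : AddChar K ℂ) (m n : ℕ) : ℂ :=
  (if Odd n then (‖rawGaussSum p ψ 0 1‖ : ℂ) / rawGaussSum p ψ 0 1 else 1) * rawGaussSum p ψ m n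

end Gauss

section Stable

variable {ι M N : Type*} [Fintype ι] [AddCommGroup M] [Module ℝ M] [AddCommGroup N] [Module ℝ N]
variable {P : RootPairing ι ℝ M N}
variable {O K : Type*} [CommRing O] [Field K] [Algebra O K]

/-- The stable coefficient
`∏_{α ∈ Φ(w⁻¹)} g₁(p^{d_θ(α) - 1}, p^{d_θ(α)}) / q^{d_θ(α)/2}` attached to `w`. -/
def stableCoeff [P.IsRootSystem] (b : P.Base) (l : b.support → ℕ) (p : O) (ψ : AddChar K ℂ)
    (w : P.weylGroup) : ℂ :=
  ∏ i ∈ inversionSet b w⁻¹,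
    gaussSum₁ p ψ (dTheta b l i - 1) (dTheta b l i) /
      ((√(normOf p : ℝ) : ℝ) : ℂ) ^ dTheta b l i

end Stable

section Action

variable {ι M N : Type*} [Fintype ι] [AddCommGroup M] [Module ℝ M] [AddCommGroup N] [Module ℝ N]
variable {P : RootPairing ι ℝ M N}

/-- The polynomial ring `ℂ[x_1, …, x_r]`, with one variable for each simple root. -/
abbrev Poly (b : P.Base) : Type _ := MvPolynomial b.support ℂ

/-- The field `F = ℂ(x_1, …, x_r)`. -/
abbrev RatFun (b : P.Base) : Type _ := FractionRing (Poly b)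

/-- The variable `x_i` as a rational function. -/
def var (b : P.Base) (i : b.support) : RatFun b := algebraMap (Poly b) (RatFun b) (MvPolynomial.X i)

/-- The substitution `f(y)` of a tuple `y` of rational functions for `x` in a rational function `f`.
(It is only used for algebraically independent tuples `y`, where the denominator does not vanish.) -/
def subst (b : P.Base) (y : b.support → RatFun b) (f : RatFun b) : RatFun b :=
  MvPolynomial.aeval y (IsFractionRing.num (Poly b) f) /
    MvPolynomial.aeval y (IsFractionRing.den (Poly b) f : Poly b)

/-- `√q`, as an element of `F`. -/
def sqrtQ (b : P.Base) (q : ℕ) : RatFun b := algebraMap ℂ (RatFun b) ((√(q : ℝ) : ℝ) : ℂ)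

/-- Adjacency of `i` and `j` in the Dynkin diagram. -/
def Adjacent [P.IsCrystallographic] (b : P.Base) (i j : b.support) : Prop :=
  i ≠ j ∧ b.cartanMatrix i j ≠ 0

open Classical in
/-- The tuple `σ_i x`. -/
def sigmaX [P.IsCrystallographic] (b : P.Base) (q : ℕ) (i j : b.support) : RatFun b :=
  if j = i then 1 / ((q : RatFun b) * var b i)
  else if Adjacent b i j then var b i * var b j * sqrtQ b q
  else var b j

open Classical in
/-- The tuple `ε_i x`. -/
def epsX [P.IsCrystallographic] (b : P.Base) (i j : b.support) : RatFun b :=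
  if Adjacent b i j then -var b j else var b j

/-- `f⁺_{i,ℓ}`. -/
def plusPart [P.IsCrystallographic] (b : P.Base) (l : b.support → ℕ) (i : b.support) (f : RatFun b) :
    RatFun b :=
  (f + (-1) ^ l i * subst b (epsX b i) f) / 2

/-- `f⁻_{i,ℓ}`. -/
def minusPart [P.IsCrystallographic] (b : P.Base) (l : b.support → ℕ) (i : b.support) (f : RatFun b) :
    RatFun b :=
  (f - (-1) ^ l i * subst b (epsX b i) f) / 2

/-- The `ℓ`-twisted action `f |_ℓ σ_i` of a simple reflection. -/
def slashSimple [P.IsCrystallographic] (b : P.Base) (q : ℕ) (l : b.support → ℕ) (f : RatFun b)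
    (i : b.support) : RatFun b :=
  -((1 - q * var b i) / (q * var b i * (1 - var b i))) * (var b i * sqrtQ b q) ^ l i *
      subst b (sigmaX b q i) (plusPart b l i f) +
    1 / (var b i * sqrtQ b q) * (var b i * sqrtQ b q) ^ l i *
      subst b (sigmaX b q i) (minusPart b l i f)

/-- The Weyl group is generated by the simple reflections. -/
theorem exists_wordProd_eq [P.IsRootSystem] [P.IsCrystallographic] [P.IsReduced] (b : P.Base)
    (w : P.weylGroup) : ∃ L : List b.support, wordProd b L = w := by
  have hmul : ∀ L L' : List b.support, wordProd b (L ++ L') = wordProd b L * wordProd b L' := by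
    intro L L'; simp [wordProd]
  have hrefl : ∀ i : ι, ∃ L : List b.support,
      wordProd b L = RootPairing.weylGroup.ofIdx P i := by
    intro i
    refine RootPairing.Base.induction_reflect (b := b)
      (p := fun i => ∃ L : List b.support, wordProd b L = RootPairing.weylGroup.ofIdx P i)
      i ?_ ?_ ?_
    · rintro i ⟨L, hL⟩
      refine ⟨L, hL.trans (Subtype.ext ?_)⟩
      apply RootPairing.Equiv.weightHom_injective P
      ext x
      simp [RootPairing.weylGroup.ofIdx, RootPairing.reflection_reflectionPerm]
    · intro i hi
      exact ⟨[⟨i, hi⟩], by simp [wordProd]⟩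
    · rintro i j ⟨L, hL⟩ hj
      refine ⟨[⟨j, hj⟩] ++ (L ++ [⟨j, hj⟩]), ?_⟩
      rw [hmul, hmul, hL]
      apply Subtype.ext
      apply RootPairing.Equiv.weightHom_injective P
      ext x
      simp [wordProd, RootPairing.weylGroup.ofIdx, RootPairing.reflection_reflectionPerm]
  obtain ⟨g, hg⟩ := w
  induction hg using RootPairing.weylGroup.induction with
  | mem i => exact hrefl i
  | one => exact ⟨[], rfl⟩
  | mul x y hx hy ihx ihy =>
    obtain ⟨L, hL⟩ := ihx
    obtain ⟨L', hL'⟩ := ihy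
    exact ⟨L ++ L', by rw [hmul, hL, hL']; rfl⟩

/-- A word in the simple reflections with product `w`. -/
def word [P.IsRootSystem] [P.IsCrystallographic] [P.IsReduced] (b : P.Base) (w : P.weylGroup) :
    List b.support :=
  (exists_wordProd_eq b w).choose

/-- The `ℓ`-twisted right action `f |_ℓ w` of the Weyl group on `F`: if `w = σ_{i₁} ⋯ σ_{iₙ}`, it is
`(⋯ (f |_ℓ σ_{i₁}) ⋯ ) |_ℓ σ_{iₙ}`. -/
def slash [P.IsRootSystem] [P.IsCrystallographic] [P.IsReduced] (b : P.Base) (q : ℕ)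
    (l : b.support → ℕ) (f : RatFun b) (w : P.weylGroup) : RatFun b :=
  (word b w).foldl (slashSimple b q l) f

/-- The rational function `x ↦ f(wx)`: if `w = σ_{i₁} ⋯ σ_{iₙ}`, then `wx = σ_{i₁}(⋯ (σ_{iₙ} x))`. -/
def compW [P.IsRootSystem] [P.IsCrystallographic] [P.IsReduced] (b : P.Base) (q : ℕ)
    (f : RatFun b) (w : P.weylGroup) : RatFun b :=
  (word b w).foldl (fun g i => subst b (sigmaX b q i) g) f

open Classical in
/-- `Δ(x) = ∏_{α > 0} (1 - q^{d(α)} x^{2α})`, where `d` is the height. -/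
def Delta [P.IsRootSystem] (b : P.Base) (q : ℕ) : Poly b :=
  ∏ i : ι with b.IsPos i,
    (1 - MvPolynomial.monomial (2 • rootExponent b i) ((q : ℂ) ^ (b.height i).toNat))

open Classical in
/-- `D(x) = ∏_{α > 0} (1 - q^{d(α) - 1} x^{2α})`. -/
def Denom [P.IsRootSystem] (b : P.Base) (q : ℕ) : Poly b :=
  ∏ i : ι with b.IsPos i,
    (1 - MvPolynomial.monomial (2 • rootExponent b i) ((q : ℂ) ^ ((b.height i).toNat - 1)))

/-- `j(w, x) = Δ(x) / Δ(wx)`. -/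
def jFactor [P.IsRootSystem] [P.IsCrystallographic] [P.IsReduced] (b : P.Base) (q : ℕ)
    (w : P.weylGroup) : RatFun b :=
  algebraMap (Poly b) (RatFun b) (Delta b q) / compW b q (algebraMap (Poly b) (RatFun b) (Delta b q)) w

/-- `f(x; ℓ) = Δ(x)⁻¹ ∑_w j(w, x) (1 |_ℓ w)(x)`. -/
def pPart [P.IsRootSystem] [P.IsCrystallographic] [P.IsReduced] (b : P.Base) (q : ℕ)
    (l : b.support → ℕ) : RatFun b :=
  (algebraMap (Poly b) (RatFun b) (Delta b q))⁻¹ *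
    ∑ᶠ w : P.weylGroup, jFactor b q w * slash b q l 1 w

/-- The numerator `N(x; ℓ) = f(x; ℓ) D(x)`. -/
def numerator [P.IsRootSystem] [P.IsCrystallographic] [P.IsReduced] (b : P.Base) (q : ℕ)
    (l : b.support → ℕ) : RatFun b :=
  pPart b q l * algebraMap (Poly b) (RatFun b) (Denom b q)

end Action

end TwistedWMDS

end

/-!
The variables `y_j = √q x_j` turn the substitutions `σ_i` into the action of the simple reflections on
Laurent monomials `y^λ` (`reflHom_mono`), and the `ε_i` into the signs `(-1)^⟨λ, α_i^∨⟩`. In these terms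
`f |_ℓ σ_i = y_i^{l_i - 1} (A(y_i) f(σ_i y) + (-1)^{l_i} B(y_i) f(ε_i σ_i y))` for two explicit rational
functions `A` and `B` (`slashSimple_eq`). The operators are involutions and satisfy the braid relations
(`slashSimple_slashSimple`, `slashSimple_comm`, `slashSimple_braid`), so by Matsumoto's theorem
(`foldl_eq_of_wordProd_eq`) they define an action of the Weyl group. The function `f(x; ℓ)` is the sum of
`Δ⁻¹ |_ℓ w` over `w ∈ W` (`pPart_eq_finsum`), hence invariant (`slashSimple_pPart`).

*Polynomiality.* An induction along `w` controls the denominator and the lowest monomial of each term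
(`exists_slash_inv_eq`), so `Δ D f` is a polynomial with constant term `1` (`exists_pPart_mul_eq`). The
factors `1 - y^{2α}` of `Δ` cancel: for simple `α`, restricting the functional equation to `y_i = ±1`
forces the residue of `f` to vanish (`mem_localAlg_of_slashSimple_eq`), and invariance carries this to all
roots (`pPart_mem_localAlg`). The binomials attached to distinct positive roots, and to the same root in
`Δ` and in `D`, are coprime (`isRelPrime_rootPoly`), so that `Δ` divides the polynomial `Δ D f`
(`exists_numerator_eq`).

*Coefficients.* Write a numerator whose quotient by `D` is invariant as `∑ c_λ y^λ`. The functional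
equation under `σ_i` is a recursion along each `i`-string `λ + ℤ α_i` (`coeff_functional_equation`). It
shows that the support in a string lies between its lowest element `λ` and the shifted reflection
`θ - s_i(θ - λ)`, and that the coefficients at these two ends differ by a factor that depends only on the
parity of `⟨θ - λ, α_i^∨⟩`: it is `-1/q` for even and `1/√q` for odd values (`string_ends`). Consequently
all shifted Weyl group elements map the support into the cone spanned by the simple roots
(`repr_nonneg_of_coeff_ne_zero`). If `w α_i > 0`, then the vertex `θ - w⁻¹θ` is therefore the lower end of
its `i`-string (`coeff_below_vertex`), while the vertex of `w s_i` is its shifted reflection. Starting from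
`c_0 = 1`, this determines the coefficients at all vertices as products of such factors over the roots
inverted by `w⁻¹` (`coeff_vertex`), for every invariant numerator alike.

*Gauss sums.* The sum `g₁(p^{m-1}, p^m)` equals `-q^{m-1}` for even `m`, where the quadratic character
drops out, and `q^{m-1} √q` for odd `m` (`gaussSum₁_eq`). These are the factors along strings of length
`m = d_θ(α)`.
-/

noncomputable section

set_option linter.unusedSectionVars false
set_option linter.style.haveILetI false

namespace TwistedWMDS


/-! ### The Weyl group: words, exchange and the braid relations -/

section WeylGroup

open RootPairing

variable {ι M N : Type*} [Fintype ι] [AddCommGroup M] [Module ℝ M] [AddCommGroup N] [Module ℝ N]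
variable {P : RootPairing ι ℝ M N}

/-- The simple reflection `σ_i` as an element of the Weyl group. -/
abbrev simpleRefl (b : P.Base) (i : b.support) : P.weylGroup := weylGroup.ofIdx P (i : ι)

lemma root_smul (w : P.weylGroup) (k : ι) : P.root (w • k) = w • P.root k :=
  (P.weylGroup_apply_root w k).symm

lemma weylGroup_smul_smul (w : P.weylGroup) (c : ℝ) (x : M) : w • (c • x) = c • (w • x) :=
  smul_comm (w : P.Aut) c x

lemma weylGroup_ext {w w' : P.weylGroup} (h : ∀ x : M, w • x = w' • x) : w = w' := by
  apply Subtype.ext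
  apply RootPairing.Equiv.weightHom_injective P
  ext x
  exact h x

lemma pairing_smul_smul (w : P.weylGroup) (x : M) (k : ι) :
    P.toLinearMap (w • x) (P.coroot (w • k)) = P.toLinearMap x (P.coroot k) := by
  revert x k
  obtain ⟨g, hg⟩ := w
  induction hg using weylGroup.induction with
  | mem i =>
    intro x k
    have h := P.coroot'_reflection (i := i) (j := P.reflectionPerm i k) x
    rw [reflectionPerm_self] at h
    exact h
  | one => intro x k; rfl
  | mul g₁ g₂ hg₁ hg₂ h₁ h₂ =>
    intro x k
    rw [← Submonoid.mk_mul_mk _ _ _ hg₁ hg₂, mul_smul, mul_smul, h₁, h₂]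

lemma reflection_apply_coroot (i : ι) (x : M) :
    weylGroup.ofIdx P i • x = x - P.toLinearMap x (P.coroot i) • P.root i := by
  simp [reflection_apply]

lemma ofIdx_smul_conj (w : P.weylGroup) (i : ι) :
    weylGroup.ofIdx P (w • i) = w * weylGroup.ofIdx P i * w⁻¹ := by
  apply weylGroup_ext
  intro x
  have h := pairing_smul_smul w (w⁻¹ • x) i
  rw [smul_inv_smul] at h
  rw [mul_smul, mul_smul, reflection_apply_coroot, reflection_apply_coroot, smul_sub,
    smul_inv_smul, weylGroup_smul_smul, root_smul, h]

lemma simpleRefl_mul_self (b : P.Base) (i : b.support) : simpleRefl b i * simpleRefl b i = 1 := by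
  apply weylGroup_ext
  intro x
  simp [mul_smul]

lemma simpleRefl_inv (b : P.Base) (i : b.support) : (simpleRefl b i)⁻¹ = simpleRefl b i :=
  inv_eq_of_mul_eq_one_left (simpleRefl_mul_self b i)

lemma wordProd_concat (b : P.Base) (L : List b.support) (i : b.support) :
    wordProd b (L ++ [i]) = wordProd b L * simpleRefl b i := by
  simp [wordProd]

lemma wordProd_cons (b : P.Base) (i : b.support) (L : List b.support) :
    wordProd b (i :: L) = simpleRefl b i * wordProd b L := by
  simp [wordProd]

instance finite_weylGroup [P.IsRootSystem] : Finite P.weylGroup := by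
  refine Finite.of_injective (fun w : P.weylGroup => (fun k : ι => w • k)) ?_
  intro w w' h
  apply weylGroup_ext
  intro x
  have hx : x ∈ Submodule.span ℝ (Set.range P.root) := by
    rw [RootPairing.IsRootSystem.span_root_eq_top]; trivial
  induction hx using Submodule.span_induction with
  | mem x hx =>
    obtain ⟨k, rfl⟩ := hx
    rw [← root_smul, ← root_smul]
    exact congrArg P.root (congrFun h k)
  | zero => simp
  | add x y _ _ hx hy => rw [smul_add, smul_add, hx, hy]
  | smul c x _ hx => rw [weylGroup_smul_smul, weylGroup_smul_smul, hx]

lemma isPos_of_root_eq_neg {b : P.Base} {k k' : ι} (h : P.root k' = -P.root k)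
    (hk : ¬ b.IsPos k) : b.IsPos k' := by
  let := P.indexNeg
  have : k' = -k := by
    apply P.root.injective
    rw [h]; simp
  rw [this]
  exact (RootPairing.Base.IsPos.neg_iff_not b k).2 hk

lemma not_isPos_of_root_eq_neg {b : P.Base} {k k' : ι} (h : P.root k' = -P.root k)
    (hk : b.IsPos k) : ¬ b.IsPos k' := by
  let := P.indexNeg
  have : k' = -k := by
    apply P.root.injective
    rw [h]; simp
  rw [this, RootPairing.Base.IsPos.neg_iff_not b k]
  exact not_not.2 hk

lemma simple_isPos (b : P.Base) (i : b.support) : b.IsPos (i : ι) :=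
  RootPairing.Base.isPos_of_mem_support i.2

lemma root_mul_simpleRefl_smul_self (b : P.Base) (w : P.weylGroup) (i : b.support) :
    P.root ((w * simpleRefl b i) • (i : ι)) = -P.root (w • (i : ι)) := by
  rw [mul_smul, root_smul, root_smul, root_smul, ← smul_neg]
  simp

lemma isPos_mul_simpleRefl_iff (b : P.Base) (w : P.weylGroup) (i : b.support) :
    b.IsPos ((w * simpleRefl b i) • (i : ι)) ↔ ¬ b.IsPos (w • (i : ι)) := by
  refine ⟨fun h h' => not_isPos_of_root_eq_neg (root_mul_simpleRefl_smul_self b w i) h' h,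
    fun h => isPos_of_root_eq_neg (root_mul_simpleRefl_smul_self b w i) h⟩

section Crystallographic

variable [P.IsRootSystem] [P.IsCrystallographic] [P.IsReduced]

lemma eq_of_isPos_of_not_isPos {b : P.Base} {k : ι} {i : b.support} (hk : b.IsPos k)
    (h : ¬ b.IsPos (simpleRefl b i • k)) : k = i := by
  by_contra hne
  exact h (hk.reflectionPerm i.2 hne)

/-- The exchange property: a word whose product sends `α_i` to a negative root can be shortened by one
letter to represent the product with `σ_i`. -/
lemma exists_shorter_word (b : P.Base) (i : b.support) (L : List b.support)
    (h : ¬ b.IsPos (wordProd b L • (i : ι))) :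
    ∃ L' : List b.support, L'.length + 1 = L.length ∧
      wordProd b L' = wordProd b L * simpleRefl b i := by
  induction L with
  | nil => exact absurd (simple_isPos b i) (by simpa [wordProd] using h)
  | cons a L ih =>
    rw [wordProd_cons] at h ⊢
    by_cases hL : b.IsPos (wordProd b L • (i : ι))
    · have hk := eq_of_isPos_of_not_isPos hL (by rwa [← mul_smul])
      refine ⟨L, rfl, ?_⟩
      have hc := ofIdx_smul_conj (P := P) (wordProd b L) (i : ι)
      rw [hk] at hc
      have ha : simpleRefl b a = wordProd b L * simpleRefl b i * (wordProd b L)⁻¹ := hc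
      rw [ha, inv_mul_cancel_right, mul_assoc, simpleRefl_mul_self, mul_one]
    · obtain ⟨L', hl, hp⟩ := ih hL
      exact ⟨a :: L', by simp [hl], by rw [wordProd_cons, hp, mul_assoc]⟩

/-- The length of a Weyl group element: the least length of a word representing it. -/
def len (b : P.Base) (w : P.weylGroup) : ℕ :=
  sInf {n | ∃ L : List b.support, L.length = n ∧ wordProd b L = w}

lemma exists_reducedWord (b : P.Base) (w : P.weylGroup) :
    ∃ L : List b.support, L.length = len b w ∧ wordProd b L = w := by
  have h : {n | ∃ L : List b.support, L.length = n ∧ wordProd b L = w}.Nonempty := by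
    obtain ⟨L, hL⟩ := exists_wordProd_eq b w
    exact ⟨_, L, rfl, hL⟩
  exact Nat.sInf_mem h

lemma len_le (b : P.Base) (L : List b.support) : len b (wordProd b L) ≤ L.length :=
  Nat.sInf_le ⟨L, rfl, rfl⟩

lemma len_mul_simpleRefl_le (b : P.Base) (w : P.weylGroup) (i : b.support) :
    len b (w * simpleRefl b i) ≤ len b w + 1 := by
  obtain ⟨L, hl, hp⟩ := exists_reducedWord b w
  have := len_le b (L ++ [i])
  rw [wordProd_concat, hp] at this
  simpa [hl] using this

lemma len_of_not_isPos (b : P.Base) {w : P.weylGroup} {i : b.support}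
    (h : ¬ b.IsPos (w • (i : ι))) : len b (w * simpleRefl b i) + 1 = len b w := by
  obtain ⟨L, hl, hp⟩ := exists_reducedWord b w
  obtain ⟨L', hl', hp'⟩ := exists_shorter_word b i L (by rwa [hp])
  have h1 := len_le b L'
  rw [hp', hp] at h1
  have h2 := len_mul_simpleRefl_le b (w * simpleRefl b i) i
  rw [mul_assoc, simpleRefl_mul_self, mul_one] at h2
  omega

lemma len_of_isPos (b : P.Base) {w : P.weylGroup} {i : b.support}
    (h : b.IsPos (w • (i : ι))) : len b (w * simpleRefl b i) = len b w + 1 := by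
  have h' : ¬ b.IsPos ((w * simpleRefl b i) • (i : ι)) := by
    rw [isPos_mul_simpleRefl_iff]; exact not_not.2 h
  have := len_of_not_isPos b h'
  rw [mul_assoc, simpleRefl_mul_self, mul_one] at this
  exact this.symm

/-- Every Weyl group element is reached from `1` by multiplying on the right by simple reflections
that increase the length. -/
lemma weylGroup_induction_of_isPos (b : P.Base) {p : P.weylGroup → Prop} (one : p 1)
    (mul : ∀ w (i : b.support), b.IsPos (w • (i : ι)) → p w → p (w * simpleRefl b i)) (w : P.weylGroup) :
    p w := by
  induction hn : len b w using Nat.strong_induction_on generalizing w with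
  | _ n ih =>
    obtain ⟨L, hl, hp⟩ := exists_reducedWord b w
    rcases L.eq_nil_or_concat' with rfl | ⟨L', i, rfl⟩
    · rw [← hp]; simpa [wordProd] using one
    · rw [wordProd_concat] at hp
      have h1 := len_le b L'
      have h2 : wordProd b L' = w * simpleRefl b i := by
        rw [← hp, mul_assoc, simpleRefl_mul_self, mul_one]
      rw [List.length_append, List.length_singleton] at hl
      have hpos : b.IsPos (wordProd b L' • (i : ι)) := by
        by_contra hneg
        have := len_of_not_isPos b hneg
        rw [hp] at this
        omega
      rw [← hp]
      exact mul _ _ hpos (ih _ (by omega) _ rfl)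

lemma pairing_eq_cartanMatrix (b : P.Base) (i j : b.support) :
    P.toLinearMap (P.root (i : ι)) (P.coroot (j : ι)) = (b.cartanMatrix i j : ℝ) := by
  rw [root_coroot_eq_pairing, ← b.algebraMap_cartanMatrixIn_apply ℤ]
  rfl

lemma simpleRefl_smul_root (b : P.Base) (i j : b.support) :
    simpleRefl b i • P.root (j : ι) =
      P.root (j : ι) - (b.cartanMatrix j i : ℝ) • P.root (i : ι) := by
  rw [reflection_apply_coroot, pairing_eq_cartanMatrix]

lemma simpleRefl_smul_idx_of_eq_zero {b : P.Base} {i j : b.support}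
    (h : b.cartanMatrix j i = 0) : simpleRefl b i • (j : ι) = j := by
  apply P.root.injective
  rw [root_smul, simpleRefl_smul_root, h]
  simp

lemma simpleRefl_comm_of_eq_zero {b : P.Base} {i j : b.support} (h : b.cartanMatrix j i = 0) :
    simpleRefl b i * simpleRefl b j = simpleRefl b j * simpleRefl b i := by
  have hc := ofIdx_smul_conj (P := P) (simpleRefl b i) (j : ι)
  rw [simpleRefl_smul_idx_of_eq_zero h, simpleRefl_inv] at hc
  have : simpleRefl b j = simpleRefl b i * simpleRefl b j * simpleRefl b i := hc
  nth_rw 2 [this]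
  rw [mul_assoc, simpleRefl_mul_self, mul_one]

lemma root_simpleRefl_smul_of_eq_neg_one {b : P.Base} {i j : b.support}
    (h : b.cartanMatrix j i = -1) :
    P.root (simpleRefl b i • (j : ι)) = P.root (j : ι) + P.root (i : ι) := by
  rw [root_smul, simpleRefl_smul_root, h]
  simp

lemma simpleRefl_smul_smul_of_eq_neg_one {b : P.Base} {i j : b.support}
    (h : b.cartanMatrix i j = -1) (h' : b.cartanMatrix j i = -1) :
    simpleRefl b i • simpleRefl b j • (i : ι) = j := by
  have : simpleRefl b j • (i : ι) = simpleRefl b i • (j : ι) := by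
    apply P.root.injective
    rw [root_simpleRefl_smul_of_eq_neg_one h, root_simpleRefl_smul_of_eq_neg_one h', add_comm]
  rw [this, ← mul_smul, simpleRefl_mul_self, one_smul]

lemma simpleRefl_braid_of_eq_neg_one {b : P.Base} {i j : b.support}
    (h : b.cartanMatrix i j = -1) (h' : b.cartanMatrix j i = -1) :
    simpleRefl b i * simpleRefl b j * simpleRefl b i =
      simpleRefl b j * simpleRefl b i * simpleRefl b j := by
  have hc := ofIdx_smul_conj (P := P) (simpleRefl b i * simpleRefl b j) (i : ι)
  rw [mul_smul, simpleRefl_smul_smul_of_eq_neg_one h h', mul_inv_rev, simpleRefl_inv,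
    simpleRefl_inv] at hc
  have hj : simpleRefl b j = simpleRefl b i * simpleRefl b j * simpleRefl b i *
      (simpleRefl b j * simpleRefl b i) := hc
  have h1 : simpleRefl b j * simpleRefl b i * (simpleRefl b i * simpleRefl b j) = 1 := by
    rw [mul_assoc, ← mul_assoc (simpleRefl b i) (simpleRefl b i), simpleRefl_mul_self, one_mul,
      simpleRefl_mul_self]
  calc _ = simpleRefl b i * simpleRefl b j * simpleRefl b i *
        (simpleRefl b j * simpleRefl b i) * (simpleRefl b i * simpleRefl b j) := by
        rw [mul_assoc _ (simpleRefl b j * simpleRefl b i), h1, mul_one]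
    _ = _ := by rw [← hj, mul_assoc]

/-- Matsumoto's theorem for reduced words in a simply-laced Weyl group: operators satisfying the braid
relations have the same composite along two reduced words of the same element. The induction is on the
length: both words are compared with reduced words that end in the two sides of a braid relation. -/
lemma foldl_eq_of_reduced (b : P.Base) (hsl : b.cartanMatrix.IsSimplyLaced) {X : Type*}
    (T : X → b.support → X)
    (hcomm : ∀ i j, b.cartanMatrix i j = 0 → ∀ x, T (T x i) j = T (T x j) i)
    (hbraid : ∀ i j, b.cartanMatrix i j = -1 → ∀ x, T (T (T x i) j) i = T (T (T x j) i) j)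
    (x : X) (n : ℕ) : ∀ L L' : List b.support, wordProd b L = wordProd b L' → L.length = n →
      L'.length = n → len b (wordProd b L) = n → L.foldl T x = L'.foldl T x := by
  induction n with
  | zero =>
    intro L L' _ hL hL' _
    rw [List.length_eq_zero_iff.1 hL, List.length_eq_zero_iff.1 hL']
  | succ n ih =>
    intro L L' hLL' hL hL' hlen
    rcases L.eq_nil_or_concat' with rfl | ⟨A, i, rfl⟩
    · simp at hL
    rcases L'.eq_nil_or_concat' with rfl | ⟨A', j, rfl⟩
    · simp at hL'
    set w := wordProd b (A ++ [i]) with hw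
    have hA : wordProd b A = w * simpleRefl b i := by
      rw [hw, wordProd_concat, mul_assoc, simpleRefl_mul_self, mul_one]
    have hA' : wordProd b A' = w * simpleRefl b j := by
      rw [hLL', wordProd_concat, mul_assoc, simpleRefl_mul_self, mul_one]
    have hAl : A.length = n := by simpa using hL
    have hAl' : A'.length = n := by simpa using hL'
    have desc : ∀ (B : List b.support) (k : b.support), B.length = n →
        wordProd b B = w * simpleRefl b k → ¬ b.IsPos (w • (k : ι)) := by
      intro B k hB hBk hpos
      have h1 := len_of_isPos b hpos
      have h2 := len_le b B
      rw [hBk] at h2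
      omega
    have hi := desc A i hAl hA
    have hj := desc A' j hAl' hA'
    have hli := len_of_not_isPos b hi
    have hlj := len_of_not_isPos b hj
    rw [List.foldl_append, List.foldl_append]
    simp only [List.foldl_cons, List.foldl_nil]
    by_cases hij : i = j
    · subst hij
      rw [ih A A' (hA.trans hA'.symm) hAl hAl' (by rw [hA]; omega)]
    -- `s_i` and `s_j` generate a dihedral group whose longest element ends some reduced word of `w`
    rcases hsl (Ne.symm hij) with h0 | h1
    · have h0' : b.cartanMatrix i j = 0 := b.cartanMatrix_apply_eq_zero_iff_symm.1 h0
      obtain ⟨U, hU, hUp⟩ := exists_reducedWord b (w * simpleRefl b i * simpleRefl b j)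
      have hd : ¬ b.IsPos ((w * simpleRefl b i) • (j : ι)) := by
        rwa [mul_smul, simpleRefl_smul_idx_of_eq_zero h0]
      have hlu := len_of_not_isPos b hd
      have e1 : A.foldl T x = T (U.foldl T x) j := by
        rw [ih A (U ++ [j]) _ hAl (by simp; omega) (by rw [hA]; omega), List.foldl_append]
        · rfl
        · rw [hA, wordProd_concat, hUp, mul_assoc, simpleRefl_mul_self, mul_one]
      have e2 : A'.foldl T x = T (U.foldl T x) i := by
        rw [ih A' (U ++ [i]) _ hAl' (by simp; omega) (by rw [hA']; omega), List.foldl_append]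
        · rfl
        · rw [hA', wordProd_concat, hUp, mul_assoc w, simpleRefl_comm_of_eq_zero h0, mul_assoc,
            mul_assoc, simpleRefl_mul_self, mul_one]
      rw [e1, e2]
      exact (hcomm i j h0' _).symm
    · have h1' : b.cartanMatrix i j = -1 := by
        rcases hsl hij with h | h
        · rw [b.cartanMatrix_apply_eq_zero_iff_symm] at h
          omega
        · exact h
      set u := w * simpleRefl b i * simpleRefl b j * simpleRefl b i with hu
      obtain ⟨U, hU, hUp⟩ := exists_reducedWord b u
      have hd : ¬ b.IsPos ((w * simpleRefl b i) • (j : ι)) := by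
        intro hpos
        let := P.indexNeg
        have r1 : P.root ((w * simpleRefl b i) • (j : ι)) =
            P.root (w • (j : ι)) + P.root (w • (i : ι)) := by
          rw [mul_smul, root_smul, root_simpleRefl_smul_of_eq_neg_one h1, smul_add, root_smul,
            root_smul]
        have h2 := b.height_add r1
        rw [RootPairing.Base.isPos_iff] at hpos hi hj
        omega
      have hd' : ¬ b.IsPos ((w * simpleRefl b i * simpleRefl b j) • (i : ι)) := by
        rwa [mul_assoc, mul_smul, mul_smul, simpleRefl_smul_smul_of_eq_neg_one h1' h1]
      have hl1 := len_of_not_isPos b hd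
      have hl2 := len_of_not_isPos b hd'
      rw [← hu] at hl2
      have e1 : A.foldl T x = T (T (U.foldl T x) i) j := by
        rw [ih A (U ++ [i] ++ [j]) _ hAl (by simp; omega) (by rw [hA]; omega), List.foldl_append,
          List.foldl_append]
        · rfl
        · rw [hA, wordProd_concat, wordProd_concat, hUp, hu]
          rw [mul_assoc _ (simpleRefl b i) (simpleRefl b i), simpleRefl_mul_self, mul_one,
            mul_assoc _ (simpleRefl b j) (simpleRefl b j), simpleRefl_mul_self, mul_one]
      have e2 : A'.foldl T x = T (T (U.foldl T x) j) i := by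
        rw [ih A' (U ++ [j] ++ [i]) _ hAl' (by simp; omega) (by rw [hA']; omega),
          List.foldl_append, List.foldl_append]
        · rfl
        · have hu' : u = w * (simpleRefl b j * simpleRefl b i * simpleRefl b j) := by
            rw [hu, ← simpleRefl_braid_of_eq_neg_one h1' h1]
            simp only [mul_assoc]
          rw [hA', wordProd_concat, wordProd_concat, hUp, hu']
          simp only [mul_assoc]
          rw [← mul_assoc (simpleRefl b j) (simpleRefl b j) (simpleRefl b i),
            simpleRefl_mul_self, one_mul, simpleRefl_mul_self, mul_one]
      rw [e1, e2]
      exact hbraid i j h1' _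

/-- Involutions satisfying the braid relations define an action of the Weyl group: their composite along
a word depends only on the product of the word. -/
theorem foldl_eq_of_wordProd_eq (b : P.Base) (hsl : b.cartanMatrix.IsSimplyLaced) {X : Type*}
    (T : X → b.support → X) (hinv : ∀ i x, T (T x i) i = x)
    (hcomm : ∀ i j, b.cartanMatrix i j = 0 → ∀ x, T (T x i) j = T (T x j) i)
    (hbraid : ∀ i j, b.cartanMatrix i j = -1 → ∀ x, T (T (T x i) j) i = T (T (T x j) i) j)
    (x : X) (L L' : List b.support) (h : wordProd b L = wordProd b L') :
    L.foldl T x = L'.foldl T x := by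
  have key : ∀ L R : List b.support, wordProd b R = wordProd b L →
      R.length = len b (wordProd b L) → L.foldl T x = R.foldl T x := by
    intro L
    induction L using List.reverseRecOn with
    | nil =>
      intro R _ hR
      have h0 := len_le b ([] : List b.support)
      rw [← hR, List.length_nil, Nat.le_zero, List.length_eq_zero_iff] at h0
      rw [h0]
    | append_singleton A i ih =>
      intro R hRA hR
      obtain ⟨B, hB, hBp⟩ := exists_reducedWord b (wordProd b A)
      rw [List.foldl_append, ih B hBp hB]
      rw [wordProd_concat] at hRA hR
      by_cases hpos : b.IsPos (wordProd b A • (i : ι))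
      · have hl := len_of_isPos b hpos
        rw [foldl_eq_of_reduced b hsl T hcomm hbraid x R.length R (B ++ [i]) _ rfl _
          (by rw [hRA, hR]), List.foldl_append]
        · rw [hRA, wordProd_concat, hBp]
        · simp; omega
      · have hl := len_of_not_isPos b hpos
        rw [foldl_eq_of_reduced b hsl T hcomm hbraid x B.length B (R ++ [i]) _ rfl _
          (by rw [hBp, hB]), List.foldl_append]
        · simp only [List.foldl_cons, List.foldl_nil]
          rw [hinv]
        · rw [wordProd_concat, hRA, hBp, mul_assoc, simpleRefl_mul_self, mul_one]
        · simp; omega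
  obtain ⟨R, hR, hRp⟩ := exists_reducedWord b (wordProd b L)
  rw [key L R hRp hR, key L' R (hRp.trans h) (by rw [hR, h])]

end Crystallographic

end WeylGroup


/-! ### The root lattice and the orbit of `θ` -/

section Lattice

open RootPairing
open scoped Classical

variable {ι M N : Type*} [Fintype ι] [AddCommGroup M] [Module ℝ M] [AddCommGroup N] [Module ℝ N]
variable {P : RootPairing ι ℝ M N} [P.IsRootSystem] [P.IsCrystallographic] [P.IsReduced]

/-- The element `∑ λ_j α_j` of the root lattice with coordinates `λ`. -/
def ofCoords (b : P.Base) : (b.support → ℤ) →+ M where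
  toFun v := ∑ j, v j • P.root (j : ι)
  map_zero' := by simp
  map_add' v w := by simp [add_smul, Finset.sum_add_distrib]

lemma ofCoords_apply (b : P.Base) (v : b.support → ℤ) :
    ofCoords b v = ∑ j, v j • P.root (j : ι) := rfl

lemma ofCoords_single (b : P.Base) (i : b.support) (n : ℤ) :
    ofCoords b (Pi.single i n) = n • P.root (i : ι) := by
  rw [ofCoords_apply, Finset.sum_eq_single i]
  · simp
  · intro j _ hj; simp [hj]
  · simp

lemma repr_ofCoords (b : P.Base) (v : b.support → ℤ) (j : b.support) :
    b.toWeightBasis.repr (ofCoords b v) j = v j := by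
  rw [ofCoords_apply, map_sum, Finsupp.finsetSum_apply, Finset.sum_eq_single j]
  · simp
  · intro k _ hk; simp [hk]
  · simp

lemma ofCoords_injective (b : P.Base) : Function.Injective (ofCoords b) := by
  intro v w h
  funext j
  have := repr_ofCoords b v j
  rw [h, repr_ofCoords] at this
  exact_mod_cast this.symm

/-- The pairing `⟨λ, α_i^∨⟩` of a lattice vector with a simple coroot. -/
def simplePairing (b : P.Base) (i : b.support) : (b.support → ℤ) →+ ℤ where
  toFun v := ∑ j, v j * b.cartanMatrix j i
  map_zero' := by simp
  map_add' v w := by simp [add_mul, Finset.sum_add_distrib]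

lemma simplePairing_apply (b : P.Base) (i : b.support) (v : b.support → ℤ) :
    simplePairing b i v = ∑ j, v j * b.cartanMatrix j i := rfl

lemma simplePairing_single (b : P.Base) (i j : b.support) (n : ℤ) :
    simplePairing b i (Pi.single j n) = n * b.cartanMatrix j i := by
  rw [simplePairing_apply, Finset.sum_eq_single j]
  · simp
  · intro k _ hk; simp [hk]
  · simp

lemma toLinearMap_ofCoords (b : P.Base) (i : b.support) (v : b.support → ℤ) :
    P.toLinearMap (ofCoords b v) (P.coroot (i : ι)) = simplePairing b i v := by
  rw [ofCoords_apply, map_sum, LinearMap.sum_apply, simplePairing_apply, Int.cast_sum]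
  refine Finset.sum_congr rfl fun j _ => ?_
  rw [map_zsmul, LinearMap.smul_apply, pairing_eq_cartanMatrix, zsmul_eq_mul, Int.cast_mul]

/-- The simple reflection `s_i` in coordinates. -/
def coordRefl (b : P.Base) (i : b.support) : (b.support → ℤ) →+ (b.support → ℤ) where
  toFun v := v - Pi.single i (simplePairing b i v)
  map_zero' := by simp
  map_add' v w := by rw [map_add, Pi.single_add]; abel

lemma coordRefl_apply (b : P.Base) (i : b.support) (v : b.support → ℤ) :
    coordRefl b i v = v - Pi.single i (simplePairing b i v) := rfl

lemma ofCoords_coordRefl (b : P.Base) (i : b.support) (v : b.support → ℤ) :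
    ofCoords b (coordRefl b i v) = simpleRefl b i • ofCoords b v := by
  rw [coordRefl_apply, map_sub, ofCoords_single, reflection_apply_coroot, toLinearMap_ofCoords,
    Int.cast_smul_eq_zsmul]

lemma coordRefl_coordRefl (b : P.Base) (i : b.support) (v : b.support → ℤ) :
    coordRefl b i (coordRefl b i v) = v := by
  apply ofCoords_injective b
  rw [ofCoords_coordRefl, ofCoords_coordRefl, ← mul_smul, simpleRefl_mul_self, one_smul]

lemma simplePairing_coordRefl (b : P.Base) (i j : b.support) (v : b.support → ℤ) :
    simplePairing b i (coordRefl b j v) =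
      simplePairing b i v - simplePairing b j v * b.cartanMatrix j i := by
  rw [coordRefl_apply, map_sub, simplePairing_single]

lemma coordRefl_single (b : P.Base) (i j : b.support) (n : ℤ) :
    coordRefl b i (Pi.single j n) = Pi.single j n - Pi.single i (n * b.cartanMatrix j i) := by
  rw [coordRefl_apply, simplePairing_single]

lemma coordRefl_single_self (b : P.Base) (i : b.support) (n : ℤ) :
    coordRefl b i (Pi.single i n) = Pi.single i (-n) := by
  rw [coordRefl_single, b.cartanMatrix_apply_same, ← Pi.single_sub]
  congr 1; ring

lemma exists_ofCoords_eq_root (b : P.Base) (k : ι) : ∃ v, ofCoords b v = P.root k := by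
  obtain ⟨f, -, -, hf⟩ := b.exists_root_eq_sum_int k
  refine ⟨fun j => f j, ?_⟩
  rw [ofCoords_apply, hf]
  exact Finset.sum_coe_sort b.support (fun j => f j • P.root j)

/-- The coordinates of a root with respect to the simple roots. -/
def rootCoords (b : P.Base) (k : ι) : b.support → ℤ := (exists_ofCoords_eq_root b k).choose

lemma ofCoords_rootCoords (b : P.Base) (k : ι) : ofCoords b (rootCoords b k) = P.root k :=
  (exists_ofCoords_eq_root b k).choose_spec

lemma rootCoords_simple (b : P.Base) (i : b.support) :
    rootCoords b (i : ι) = Pi.single i 1 := by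
  apply ofCoords_injective b
  rw [ofCoords_rootCoords, ofCoords_single, one_smul]

lemma rootCoords_simpleRefl_smul (b : P.Base) (i : b.support) (k : ι) :
    rootCoords b (simpleRefl b i • k) = coordRefl b i (rootCoords b k) := by
  apply ofCoords_injective b
  rw [ofCoords_rootCoords, ofCoords_coordRefl, ofCoords_rootCoords, root_smul]

lemma rootCoords_of_root_eq_neg {b : P.Base} {k k' : ι} (h : P.root k' = -P.root k) :
    rootCoords b k' = -rootCoords b k := by
  apply ofCoords_injective b
  rw [ofCoords_rootCoords, map_neg, ofCoords_rootCoords, h]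

lemma height_eq_sum_rootCoords (b : P.Base) (k : ι) : b.height k = ∑ j, rootCoords b k j := by
  have h := ofCoords_rootCoords b k
  rw [ofCoords_apply] at h
  have h' : P.root k = ∑ j ∈ b.support,
      (fun j : ι => if hj : j ∈ b.support then rootCoords b k ⟨j, hj⟩ else 0) j • P.root j := by
    rw [← h, ← Finset.sum_coe_sort b.support]
    refine Finset.sum_congr rfl fun j _ => ?_
    simp
  rw [RootPairing.Base.height_eq_sum h', ← Finset.sum_coe_sort b.support]
  refine Finset.sum_congr rfl fun j _ => ?_
  simp

lemma rootCoords_nonneg {b : P.Base} {k : ι} (hk : b.IsPos k) : 0 ≤ rootCoords b k := by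
  obtain ⟨f, hf, h⟩ := b.exists_root_eq_sum_nat_or_neg k
  have key : ofCoords b (fun j : b.support => (f j : ℤ)) = ∑ j ∈ b.support, f j • P.root j := by
    rw [ofCoords_apply, ← Finset.sum_coe_sort b.support]
    refine Finset.sum_congr rfl fun j _ => ?_
    simp
  rcases h with h | h
  · have : rootCoords b k = fun j : b.support => (f j : ℤ) :=
      ofCoords_injective b (by rw [ofCoords_rootCoords, key, h])
    rw [this]
    intro j
    simp
  · have : rootCoords b k = -fun j : b.support => (f j : ℤ) :=
      ofCoords_injective b (by rw [ofCoords_rootCoords, map_neg, key, h])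
    rw [RootPairing.Base.isPos_iff, height_eq_sum_rootCoords, this] at hk
    have : ∑ j : b.support, (-fun j : b.support => (f j : ℤ)) j ≤ 0 :=
      Finset.sum_nonpos fun j _ => by simp
    omega

lemma rootCoords_ne_zero (b : P.Base) (k : ι) : rootCoords b k ≠ 0 := by
  intro h
  have := ofCoords_rootCoords b k
  rw [h, map_zero] at this
  exact P.ne_zero k this.symm

lemma rootExponent_eq {b : P.Base} {k : ι} (hk : b.IsPos k) (j : b.support) :
    (rootExponent b k j : ℤ) = rootCoords b k j := by
  have h := repr_ofCoords b (rootCoords b k) j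
  rw [ofCoords_rootCoords] at h
  have h0 := rootCoords_nonneg hk j
  rw [rootExponent, Finsupp.mapRange_apply, h]
  rw [Pi.zero_apply] at h0
  lift rootCoords b k j to ℕ using h0 with n
  simp

lemma eq_of_smul_rootCoords_eq {b : P.Base} {k k' : ι} (hk : b.IsPos k) (hk' : b.IsPos k')
    {m n : ℤ} (hm : m ≠ 0) (h : m • rootCoords b k = n • rootCoords b k') : k = k' := by
  by_contra hne
  have hneg : P.root k ≠ -P.root k' := fun h => not_isPos_of_root_eq_neg h hk' hk
  have hli := IsReduced.linearIndependent P hne hneg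
  rw [LinearIndependent.pair_iff] at hli
  have h2 := congrArg (ofCoords b) h
  rw [map_zsmul, map_zsmul, ofCoords_rootCoords, ofCoords_rootCoords] at h2
  have := (hli (m : ℝ) (-n : ℝ) (by
    rw [neg_smul, Int.cast_smul_eq_zsmul, Int.cast_smul_eq_zsmul, h2, add_neg_cancel])).1
  exact hm (by exact_mod_cast this)

lemma cartanMatrix_symm {b : P.Base} (hsl : b.cartanMatrix.IsSimplyLaced) (i j : b.support) :
    b.cartanMatrix i j = b.cartanMatrix j i := by
  rcases eq_or_ne i j with rfl | hij
  · rfl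
  have h0 := b.cartanMatrix_apply_eq_zero_iff_symm (i := i) (j := j)
  rcases hsl hij with h | h <;> rcases hsl hij.symm with h' | h' <;> simp_all

/-- In a simply-laced root system a coroot has the same coordinates as its root. -/
lemma coroot_eq_sum {b : P.Base} (hsl : b.cartanMatrix.IsSimplyLaced) (k : ι) :
    P.coroot k = ∑ j, rootCoords b k j • P.coroot (j : ι) := by
  refine b.induction_reflect k (p := fun k => P.coroot k = ∑ j, rootCoords b k j • P.coroot (j : ι))
    ?_ ?_ ?_
  · intro i hi
    have h : P.root (P.reflectionPerm i i) = -P.root i := by simp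
    rw [rootCoords_of_root_eq_neg h, coroot_reflectionPerm, coreflection_apply_self]
    simp only [Pi.neg_apply, neg_smul, Finset.sum_neg_distrib]
    rw [← hi]
  · intro i hi
    rw [show i = ((⟨i, hi⟩ : b.support) : ι) from rfl, rootCoords_simple,
      Finset.sum_eq_single ⟨i, hi⟩]
    · simp
    · intro j _ hj; simp [hj]
    · simp
  · intro k j hk hj
    set i : b.support := ⟨j, hj⟩ with hi
    have h1 : P.reflectionPerm j k = simpleRefl b i • k := rfl
    have h2 : P.toLinearMap (P.root (i : ι)) (P.coroot k) = simplePairing b i (rootCoords b k) := by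
      conv_lhs => rw [hk]
      rw [map_sum, simplePairing_apply, Int.cast_sum]
      refine Finset.sum_congr rfl fun m _ => ?_
      rw [map_zsmul, pairing_eq_cartanMatrix, cartanMatrix_symm hsl, zsmul_eq_mul, Int.cast_mul]
    rw [coroot_reflectionPerm, h1, rootCoords_simpleRefl_smul, coordRefl_apply]
    simp only [Pi.sub_apply, sub_smul, Finset.sum_sub_distrib]
    rw [← hk, coreflection_apply, Finset.sum_eq_single i]
    · rw [Pi.single_eq_same, ← Int.cast_smul_eq_zsmul ℝ, ← h2]
    · intro m _ hm; simp [hm]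
    · simp

section Positivity

variable (b : P.Base)

lemma isPos_simpleRefl_smul {b : P.Base} {i : b.support} {k : ι} (hk : b.IsPos k) (h : k ≠ i) :
    b.IsPos (simpleRefl b i • k) := hk.reflectionPerm i.2 h

lemma mem_inversionSet {b : P.Base} {w : P.weylGroup} {k : ι} :
    k ∈ inversionSet b w ↔ b.IsPos k ∧ ¬ b.IsPos (w • k) := by
  simp [inversionSet]

lemma inversionSet_mul_simpleRefl {b : P.Base} {w : P.weylGroup} {i : b.support}
    (h : b.IsPos (w • (i : ι))) : inversionSet b (w * simpleRefl b i) =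
      insert (i : ι) ((inversionSet b w).image (fun k => simpleRefl b i • k)) := by
  ext k
  rw [Finset.mem_insert, Finset.mem_image, mem_inversionSet]
  constructor
  · rintro ⟨hk, hk'⟩
    by_cases hki : k = i
    · exact Or.inl hki
    · refine Or.inr ⟨simpleRefl b i • k, mem_inversionSet.2 ⟨isPos_simpleRefl_smul hk hki, ?_⟩, ?_⟩
      · rwa [← mul_smul]
      · rw [← mul_smul, simpleRefl_mul_self, one_smul]
  · rintro (rfl | ⟨k', hk', rfl⟩)
    · refine ⟨simple_isPos b i, ?_⟩
      rw [isPos_mul_simpleRefl_iff]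
      exact not_not.2 h
    · rw [mem_inversionSet] at hk'
      refine ⟨isPos_simpleRefl_smul hk'.1 ?_, ?_⟩
      · rintro rfl
        exact hk'.2 h
      · rw [← mul_smul, mul_assoc, simpleRefl_mul_self, mul_one]
        exact hk'.2

lemma simple_notMem_image_inversionSet {b : P.Base} {w : P.weylGroup} {i : b.support} :
    ∀ k ∈ inversionSet b w, simpleRefl b i • k ≠ (i : ι) := by
  intro k hk h
  rw [mem_inversionSet] at hk
  have h1 : k = simpleRefl b i • (i : ι) := by
    rw [← h, ← mul_smul, simpleRefl_mul_self, one_smul]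
  refine not_isPos_of_root_eq_neg (k := (i : ι)) (k' := k) ?_ (simple_isPos b i) hk.1
  rw [h1, root_smul]
  simp

lemma inversionSet_inv_mul_simpleRefl {b : P.Base} {w : P.weylGroup} {i : b.support}
    (h : b.IsPos (w • (i : ι))) : inversionSet b (w * simpleRefl b i)⁻¹ =
      insert (w • (i : ι)) (inversionSet b w⁻¹) := by
  ext k
  rw [Finset.mem_insert, mem_inversionSet, mem_inversionSet, mul_inv_rev, simpleRefl_inv, mul_smul]
  constructor
  · rintro ⟨hk, hk'⟩
    by_cases hp : b.IsPos (w⁻¹ • k)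
    · left
      rw [← eq_of_isPos_of_not_isPos hp hk', smul_inv_smul]
    · exact Or.inr ⟨hk, hp⟩
  · rintro (rfl | ⟨hk, hk'⟩)
    · refine ⟨h, ?_⟩
      rw [inv_smul_smul]
      refine not_isPos_of_root_eq_neg (k := (i : ι)) ?_ (simple_isPos b i)
      rw [root_smul]
      simp
    · refine ⟨hk, fun hp => ?_⟩
      have h1 := eq_of_isPos_of_not_isPos (i := i) hp (by
        rwa [← mul_smul, simpleRefl_mul_self, one_smul])
      have h2 : k = (w * simpleRefl b i) • (i : ι) := by
        rw [← h1, ← mul_smul, ← mul_smul, mul_assoc, mul_assoc, ← mul_assoc (simpleRefl b i),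
          simpleRefl_mul_self, one_mul, mul_inv_cancel, one_smul]
      rw [h2, isPos_mul_simpleRefl_iff] at hk
      exact hk h

lemma smul_notMem_inversionSet_inv {b : P.Base} {w : P.weylGroup} {i : b.support} :
    w • (i : ι) ∉ inversionSet b w⁻¹ := by
  rw [mem_inversionSet, inv_smul_smul]
  exact fun h => h.2 (simple_isPos b i)

lemma inversionSet_one : inversionSet b (1 : P.weylGroup) = ∅ := by
  ext k
  rw [mem_inversionSet, one_smul]
  simp

end Positivity

section Theta

variable (b : P.Base) (l : b.support → ℕ)

lemma toLinearMap_fundamentalWeight (k i : b.support) :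
    P.toLinearMap (fundamentalWeight b k) (P.coroot (i : ι)) = if k = i then 1 else 0 := by
  have h : P.toLinearMap (fundamentalWeight b k) = b.toCoweightBasis.coord k :=
    P.toPerfPair.apply_symm_apply _
  rw [h, Module.Basis.coord_apply, b.toCoweightBasis_repr_coroot, Finsupp.single_apply]
  simp only [eq_comm]

lemma toLinearMap_theta_simple (i : b.support) :
    P.toLinearMap (theta b l) (P.coroot (i : ι)) = l i + 1 := by
  rw [theta, rho, map_add, map_sum, map_sum, LinearMap.add_apply, LinearMap.sum_apply,
    LinearMap.sum_apply]
  simp only [map_nsmul, LinearMap.smul_apply, toLinearMap_fundamentalWeight]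
  simp [add_comm]

lemma exists_vertex (w : P.weylGroup) :
    ∃ v, ofCoords b v = theta b l - w⁻¹ • theta b l := by
  refine weylGroup_induction_of_isPos b (p := fun w => ∃ v, ofCoords b v = theta b l -
    w⁻¹ • theta b l) ⟨0, by simp⟩ ?_ w
  rintro w i - ⟨v, hv⟩
  refine ⟨coordRefl b i v + Pi.single i (l i + 1 : ℤ), ?_⟩
  rw [map_add, ofCoords_coordRefl, hv, ofCoords_single, mul_inv_rev, simpleRefl_inv, mul_smul,
    smul_sub, reflection_apply_coroot (i : ι) (theta b l), toLinearMap_theta_simple]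
  have : ((l i : ℤ) + 1) • P.root (i : ι) = ((l i : ℝ) + 1) • P.root (i : ι) := by
    rw [← Int.cast_smul_eq_zsmul ℝ]; push_cast; rfl
  rw [this]
  abel

/-- The coordinates of the vertex `θ - w⁻¹ θ`. -/
def vertex (w : P.weylGroup) : b.support → ℤ := (exists_vertex b l w).choose

lemma ofCoords_vertex (w : P.weylGroup) :
    ofCoords b (vertex b l w) = theta b l - w⁻¹ • theta b l := (exists_vertex b l w).choose_spec

/-- The shifted reflection `λ ↦ θ - s_i(θ - λ)` in coordinates. -/
def dotRefl (i : b.support) (v : b.support → ℤ) : b.support → ℤ :=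
  coordRefl b i v + Pi.single i (l i + 1 : ℤ)

lemma ofCoords_dotRefl (i : b.support) (v : b.support → ℤ) :
    theta b l - ofCoords b (dotRefl b l i v) =
      simpleRefl b i • (theta b l - ofCoords b v) := by
  have : ((l i : ℤ) + 1) • P.root (i : ι) = ((l i : ℝ) + 1) • P.root (i : ι) := by
    rw [← Int.cast_smul_eq_zsmul ℝ]; push_cast; rfl
  rw [dotRefl, map_add, ofCoords_coordRefl, ofCoords_single, smul_sub,
    reflection_apply_coroot (i : ι) (theta b l), toLinearMap_theta_simple, this]
  abel

lemma vertex_one : vertex b l 1 = 0 := by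
  apply ofCoords_injective b
  rw [ofCoords_vertex]
  simp

lemma vertex_mul_simpleRefl (w : P.weylGroup) (i : b.support) :
    vertex b l (w * simpleRefl b i) = dotRefl b l i (vertex b l w) := by
  apply ofCoords_injective b
  rw [← sub_right_inj (a := theta b l), ofCoords_dotRefl, ofCoords_vertex, ofCoords_vertex,
    sub_sub_cancel, sub_sub_cancel, mul_inv_rev, simpleRefl_inv, mul_smul]

/-- The integer `⟨θ - λ, α_i^∨⟩`: the length of the `i`-string from `λ` to its shifted reflection. -/
def stringLength (i : b.support) (v : b.support → ℤ) : ℤ := l i + 1 - simplePairing b i v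

lemma dotRefl_eq (i : b.support) (v : b.support → ℤ) :
    dotRefl b l i v = v + Pi.single i (stringLength b l i v) := by
  rw [dotRefl, coordRefl_apply, stringLength, Pi.single_sub]
  abel

lemma stringLength_add_single (i : b.support) (v : b.support → ℤ) (t : ℤ) :
    stringLength b l i (v + Pi.single i t) = stringLength b l i v - 2 * t := by
  rw [stringLength, stringLength, map_add, simplePairing_single, b.cartanMatrix_apply_same]
  ring

lemma dotRefl_dotRefl (i : b.support) (v : b.support → ℤ) :
    dotRefl b l i (dotRefl b l i v) = v := by
  rw [dotRefl_eq, dotRefl_eq, stringLength_add_single, add_assoc, ← Pi.single_add]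
  rw [show stringLength b l i v + (stringLength b l i v - 2 * stringLength b l i v) = 0 by ring]
  simp

variable {b}

lemma toLinearMap_theta_coroot (hsl : b.cartanMatrix.IsSimplyLaced) (k : ι) :
    P.toLinearMap (theta b l) (P.coroot k) = ((∑ j, rootCoords b k j * (l j + 1) : ℤ) : ℝ) := by
  rw [coroot_eq_sum hsl k, map_sum, Int.cast_sum]
  refine Finset.sum_congr rfl fun j _ => ?_
  rw [map_zsmul, toLinearMap_theta_simple, zsmul_eq_mul]
  push_cast
  rfl

lemma theta_pairing_pos {k : ι} (hk : b.IsPos k) :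
    0 < ∑ j, rootCoords b k j * ((l j : ℤ) + 1) := by
  have h0 := rootCoords_nonneg hk
  refine Finset.sum_pos' (fun j _ => mul_nonneg (h0 j) (by positivity)) ?_
  by_contra! hcon
  apply rootCoords_ne_zero b k
  funext j
  have h1 := hcon j (Finset.mem_univ j)
  have h2 := h0 j
  simp only [Pi.zero_apply] at h2 ⊢
  by_contra h3
  have : 0 < rootCoords b k j * ((l j : ℤ) + 1) :=
    mul_pos (lt_of_le_of_ne h2 (Ne.symm h3)) (by positivity)
  omega

lemma dTheta_eq (hsl : b.cartanMatrix.IsSimplyLaced) {k : ι} (hk : b.IsPos k) :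
    (dTheta b l k : ℤ) = ∑ j, rootCoords b k j * ((l j : ℤ) + 1) := by
  rw [dTheta, toLinearMap_theta_coroot l hsl]
  have := theta_pairing_pos l hk
  lift ∑ j, rootCoords b k j * ((l j : ℤ) + 1) to ℕ using this.le with n
  simp

lemma dTheta_pos (hsl : b.cartanMatrix.IsSimplyLaced) {k : ι} (hk : b.IsPos k) :
    0 < dTheta b l k := by
  have := dTheta_eq l hsl hk
  have := theta_pairing_pos l hk
  omega

/-- The string through the vertex of `w` in a direction `α_i` with `w α_i > 0` has length
`d_θ(w α_i)`. -/
lemma stringLength_vertex (hsl : b.cartanMatrix.IsSimplyLaced) {w : P.weylGroup} {i : b.support}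
    (h : b.IsPos (w • (i : ι))) :
    stringLength b l i (vertex b l w) = dTheta b l (w • (i : ι)) := by
  rw [dTheta_eq l hsl h]
  have h1 := pairing_smul_smul w (w⁻¹ • theta b l) (i : ι)
  rw [smul_inv_smul, toLinearMap_theta_coroot l hsl] at h1
  have h2 : w⁻¹ • theta b l = theta b l - ofCoords b (vertex b l w) := by
    rw [ofCoords_vertex, sub_sub_cancel]
  rw [h2, map_sub, LinearMap.sub_apply, toLinearMap_theta_simple, toLinearMap_ofCoords] at h1
  rw [stringLength]
  have h3 : ((∑ j, rootCoords b (w • (i : ι)) j * ((l j : ℤ) + 1) : ℤ) : ℝ) =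
    (((l i : ℤ) + 1 - simplePairing b i (vertex b l w) : ℤ) : ℝ) := by
    rw [h1]; push_cast; ring
  exact (Int.cast_injective h3).symm

lemma vertex_nonneg (hsl : b.cartanMatrix.IsSimplyLaced) (w : P.weylGroup) :
    0 ≤ vertex b l w := by
  refine weylGroup_induction_of_isPos b (p := fun w => 0 ≤ vertex b l w) ?_ ?_ w
  · rw [vertex_one]
  · intro w i h hw
    rw [vertex_mul_simpleRefl, dotRefl_eq, stringLength_vertex l hsl h]
    exact add_nonneg hw (by rw [Pi.single_nonneg]; positivity)

lemma vertex_ne_zero (hsl : b.cartanMatrix.IsSimplyLaced) {w : P.weylGroup} (hw : w ≠ 1) :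
    vertex b l w ≠ 0 := by
  revert hw
  refine weylGroup_induction_of_isPos b (p := fun w => w ≠ 1 → vertex b l w ≠ 0) ?_ ?_ w
  · intro h; exact absurd rfl h
  · intro w i h _ _ h0
    rw [vertex_mul_simpleRefl, dotRefl_eq, stringLength_vertex l hsl h] at h0
    have h1 := congrFun h0 i
    have h2 := vertex_nonneg l hsl w i
    have h3 := dTheta_pos l hsl h
    simp only [Pi.add_apply, Pi.single_eq_same, Pi.zero_apply] at h1 h2
    omega

end Theta

end Lattice


/-! ### Monomials and substitutions in the field of rational functions -/

section Field

open RootPairing MvPolynomial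
open scoped Classical

variable {ι M N : Type*} [Fintype ι] [AddCommGroup M] [Module ℝ M] [AddCommGroup N] [Module ℝ N]
variable {P : RootPairing ι ℝ M N} [P.IsRootSystem] [P.IsCrystallographic] [P.IsReduced]

lemma sqrtQ_mul_self (b : P.Base) (q : ℕ) : sqrtQ b q * sqrtQ b q = (q : RatFun b) := by
  rw [sqrtQ, ← map_mul, ← Complex.ofReal_mul, Real.mul_self_sqrt (Nat.cast_nonneg q)]
  simp

lemma sqrtQ_ne_zero (b : P.Base) {q : ℕ} (hq : 1 < q) : sqrtQ b q ≠ 0 := by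
  intro h
  have h2 := sqrtQ_mul_self b q
  rw [h, mul_zero] at h2
  have : q = 0 := by exact_mod_cast h2.symm
  omega

lemma var_ne_zero (b : P.Base) (j : b.support) : var b j ≠ 0 := by
  rw [var, ne_eq, FaithfulSMul.algebraMap_eq_zero_iff]
  exact MvPolynomial.X_ne_zero j

/-- The normalised variable `y_j = √q x_j`, in which the substitutions `σ_i` become monomial. -/
def yVar (b : P.Base) (q : ℕ) (j : b.support) : RatFun b := sqrtQ b q * var b j

lemma yVar_ne_zero (b : P.Base) {q : ℕ} (hq : 1 < q) (j : b.support) : yVar b q j ≠ 0 :=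
  mul_ne_zero (sqrtQ_ne_zero b hq) (var_ne_zero b j)

/-- The Laurent monomial `y^λ` for a root lattice vector with coordinates `λ`. -/
def mono (b : P.Base) (q : ℕ) (v : b.support → ℤ) : RatFun b := ∏ j, yVar b q j ^ v j

variable {b : P.Base} {q : ℕ}

lemma mono_zero : mono b q 0 = 1 := by simp [mono]

lemma mono_ne_zero (hq : 1 < q) (v : b.support → ℤ) : mono b q v ≠ 0 :=
  Finset.prod_ne_zero_iff.2 fun j _ => zpow_ne_zero _ (yVar_ne_zero b hq j)

lemma mono_add (hq : 1 < q) (v w : b.support → ℤ) :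
    mono b q (v + w) = mono b q v * mono b q w := by
  rw [mono, mono, mono, ← Finset.prod_mul_distrib]
  exact Finset.prod_congr rfl fun j _ => zpow_add₀ (yVar_ne_zero b hq j) _ _

lemma mono_single (i : b.support) (n : ℤ) :
    mono b q (Pi.single i n) = yVar b q i ^ n := by
  rw [mono, Finset.prod_eq_single i]
  · simp
  · intro j _ hj; simp [hj]
  · simp

lemma mono_neg (hq : 1 < q) (v : b.support → ℤ) : mono b q (-v) = (mono b q v)⁻¹ := by
  apply eq_inv_of_mul_eq_one_left
  rw [← mono_add hq, neg_add_cancel, mono_zero]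

lemma mono_sub (hq : 1 < q) (v w : b.support → ℤ) :
    mono b q (v - w) = mono b q v * (mono b q w)⁻¹ := by
  rw [sub_eq_add_neg, mono_add hq, mono_neg hq]

lemma mono_zsmul (n : ℤ) (v : b.support → ℤ) : mono b q (n • v) = mono b q v ^ n := by
  rw [mono, mono, ← Finset.prod_zpow]
  refine Finset.prod_congr rfl fun j _ => ?_
  rw [Pi.smul_apply, smul_eq_mul, mul_comm, zpow_mul]

lemma mono_sum (hq : 1 < q) {α : Type*} (s : Finset α) (v : α → b.support → ℤ) :
    mono b q (∑ a ∈ s, v a) = ∏ a ∈ s, mono b q (v a) := by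
  induction s using Finset.induction_on with
  | empty => simp [mono_zero]
  | insert a s ha ih => rw [Finset.sum_insert ha, Finset.prod_insert ha, mono_add hq, ih]

/-- A nonnegative Laurent monomial is the image of a polynomial monomial. -/
lemma mono_natCast (k : b.support →₀ ℕ) :
    mono b q (fun j => (k j : ℤ)) =
      algebraMap (Poly b) (RatFun b)
        (monomial k (((√(q : ℝ) : ℝ) : ℂ) ^ ∑ j, k j)) := by
  have h : (monomial k (((√(q : ℝ) : ℝ) : ℂ) ^ ∑ j, k j) : Poly b) =
      ∏ j, (C ((√(q : ℝ) : ℝ) : ℂ) * X j) ^ k j := by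
    simp only [mul_pow]
    rw [Finset.prod_mul_distrib, ← Finset.prod_pow_eq_pow_sum, monomial_eq, map_prod,
      Finsupp.prod_fintype _ _ (by simp)]
    simp only [map_pow]
  rw [h, map_prod, mono]
  refine Finset.prod_congr rfl fun j _ => ?_
  rw [map_pow, map_mul, zpow_natCast]
  rfl

lemma sqrt_ne_zero (hq : 1 < q) : (((√(q : ℝ) : ℝ) : ℂ)) ≠ 0 := by
  rw [Complex.ofReal_ne_zero]
  exact (Real.sqrt_pos.2 (by positivity)).ne'

lemma exists_nat_of_nonneg {v : b.support → ℤ} (hv : 0 ≤ v) :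
    ∃ k : b.support →₀ ℕ, v = fun j => (k j : ℤ) :=
  ⟨Finsupp.equivFunOnFinite.symm fun j => (v j).toNat, by
    funext j; simp [Int.toNat_of_nonneg (hv j)]⟩

/-- The Laurent monomials are linearly independent over `ℂ`. -/
lemma mono_linearIndependent (hq : 1 < q) : LinearIndependent ℂ (mono b q) := by
  rw [linearIndependent_iff']
  intro s g hg v hv
  -- a translate of the finitely many exponents is nonnegative
  obtain ⟨N, hN⟩ : ∃ N : b.support → ℤ, ∀ w ∈ s, 0 ≤ w + N := by
    refine ⟨fun j => ∑ w ∈ s, |w j|, fun w hw j => ?_⟩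
    have h1 : |w j| ≤ ∑ w ∈ s, |w j| :=
      Finset.single_le_sum (f := fun w : b.support → ℤ => |w j|) (fun w _ => abs_nonneg _) hw
    have h2 := neg_abs_le (w j)
    simp only [Pi.zero_apply, Pi.add_apply]
    omega
  have hk : ∀ w : b.support → ℤ, ∃ k : b.support →₀ ℕ, w ∈ s → w + N = fun j => (k j : ℤ) := by
    intro w
    by_cases hw : w ∈ s
    · obtain ⟨k, hk⟩ := exists_nat_of_nonneg (hN w hw)
      exact ⟨k, fun _ => hk⟩
    · exact ⟨0, fun h => absurd h hw⟩
  choose k hk using hk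
  have h2 : algebraMap (Poly b) (RatFun b)
      (∑ w ∈ s, monomial (k w) (g w * ((√(q : ℝ) : ℝ) : ℂ) ^ ∑ j, k w j)) = 0 := by
    rw [map_sum, ← zero_mul (mono b q N), ← hg, Finset.sum_mul]
    refine Finset.sum_congr rfl fun w hw => ?_
    rw [smul_mul_assoc, ← mono_add hq, hk w hw, mono_natCast, ← smul_eq_mul (g w),
      ← smul_monomial, Algebra.smul_def, Algebra.smul_def, map_mul]
    rfl
  rw [FaithfulSMul.algebraMap_eq_zero_iff] at h2
  have h3 := congrArg (coeff (k v)) h2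
  rw [coeff_sum, coeff_zero, Finset.sum_eq_single v] at h3
  · rw [coeff_monomial, if_pos rfl] at h3
    exact (mul_eq_zero.1 h3).resolve_right (pow_ne_zero _ (sqrt_ne_zero hq))
  · intro w hw hwv
    rw [coeff_monomial, if_neg]
    intro h
    apply hwv
    have h4 := hk w hw
    rw [h, ← hk v hv] at h4
    exact add_right_cancel h4
  · exact fun h => absurd hv h

lemma mono_ne_algebraMap (hq : 1 < q) {v : b.support → ℤ} (hv : v ≠ 0) (c : ℂ) :
    mono b q v ≠ algebraMap ℂ (RatFun b) c := by
  intro h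
  have hli := mono_linearIndependent (b := b) hq
  rw [linearIndependent_iff'] at hli
  have := hli {v, 0} (fun w => if w = v then 1 else -c) (by
    rw [Finset.sum_pair hv, if_pos rfl, if_neg hv.symm, h, mono_zero, one_smul, neg_smul,
      Algebra.algebraMap_eq_smul_one, add_neg_cancel]) v (by simp)
  simp at this

lemma var_eq (hq : 1 < q) (j : b.support) :
    var b j = (((√(q : ℝ) : ℝ) : ℂ))⁻¹ • mono b q (Pi.single j 1) := by
  rw [mono_single, zpow_one, yVar, sqrtQ, Algebra.smul_def, ← mul_assoc, ← map_mul,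
    inv_mul_cancel₀ (sqrt_ne_zero hq), map_one, one_mul]

lemma mono_map (hq : 1 < q) (g : (b.support → ℤ) →+ (b.support → ℤ)) (v : b.support → ℤ) :
    mono b q (g v) = ∏ j, mono b q (g (Pi.single j 1)) ^ v j := by
  have h : v = ∑ j, v j • Pi.single j (1 : ℤ) := by
    conv_lhs => rw [← Finset.univ_sum_single v]
    refine Finset.sum_congr rfl fun j _ => ?_
    rw [← Pi.single_smul, smul_eq_mul, mul_one]
  conv_lhs => rw [h, map_sum, mono_sum hq]
  refine Finset.prod_congr rfl fun j _ => ?_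
  rw [map_zsmul, mono_zsmul]

/-- A substitution of independent Laurent monomials for the variables is injective on polynomials. -/
lemma aeval_injective (hq : 1 < q) (g : (b.support → ℤ) →+ (b.support → ℤ))
    (hg : Function.Injective g) (a : b.support → ℂ) (ha : ∀ j, a j ≠ 0)
    (y : b.support → RatFun b) (hy : ∀ j, y j = a j • mono b q (g (Pi.single j 1))) :
    Function.Injective (aeval y : Poly b →ₐ[ℂ] RatFun b) := by
  have hmon : ∀ (k : b.support →₀ ℕ) (c : ℂ), aeval y (monomial k c) =
      (c * ∏ j, a j ^ k j) • mono b q (g fun j => (k j : ℤ)) := by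
    intro k c
    rw [aeval_monomial, Finsupp.prod_fintype _ _ (by simp), mono_map hq, Algebra.smul_def, map_mul,
      mul_assoc]
    congr 1
    rw [map_prod, ← Finset.prod_mul_distrib]
    refine Finset.prod_congr rfl fun j _ => ?_
    rw [hy, Algebra.smul_def, mul_pow, map_pow, zpow_natCast]
  rw [injective_iff_map_eq_zero]
  intro p hp
  have hinj : Function.Injective fun k : b.support →₀ ℕ => g fun j => (k j : ℤ) := by
    intro k k' h
    ext j
    exact_mod_cast congrFun (hg h) j
  have hli := (mono_linearIndependent (b := b) hq).comp _ hinj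
  rw [linearIndependent_iff'] at hli
  rw [p.as_sum, map_sum] at hp
  simp only [hmon] at hp
  ext k
  rw [coeff_zero]
  by_cases hk : k ∈ p.support
  · have := hli _ _ hp k hk
    exact (mul_eq_zero.1 this).resolve_right
      (Finset.prod_ne_zero_iff.2 fun j _ => pow_ne_zero _ (ha j))
  · exact notMem_support_iff.1 hk

lemma liftAlgHom_algebraMap {y : b.support → RatFun b}
    (hy : Function.Injective (aeval y : Poly b →ₐ[ℂ] RatFun b)) (p : Poly b) :
    IsFractionRing.liftAlgHom (K := RatFun b) hy (algebraMap (Poly b) (RatFun b) p) =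
      aeval y p := by
  rw [IsFractionRing.liftAlgHom_apply]
  exact IsFractionRing.lift_algebraMap (g := (aeval y : Poly b →ₐ[ℂ] RatFun b).toRingHom) hy p

lemma subst_eq_liftAlgHom {y : b.support → RatFun b}
    (hy : Function.Injective (aeval y : Poly b →ₐ[ℂ] RatFun b)) (f : RatFun b) :
    subst b y f = IsFractionRing.liftAlgHom (K := RatFun b) hy f := by
  rw [subst, ← liftAlgHom_algebraMap hy, ← liftAlgHom_algebraMap hy, ← map_div₀,
    ← IsFractionRing.mk'_eq_div, IsFractionRing.mk'_num_den]

lemma cartanMatrix_of_adjacent (hsl : b.cartanMatrix.IsSimplyLaced) {i j : b.support}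
    (h : Adjacent b i j) : b.cartanMatrix j i = -1 := by
  rw [cartanMatrix_symm hsl]
  exact (hsl h.1).resolve_left h.2

lemma cartanMatrix_of_not_adjacent (hsl : b.cartanMatrix.IsSimplyLaced) {i j : b.support}
    (hij : j ≠ i) (h : ¬ Adjacent b i j) : b.cartanMatrix j i = 0 := by
  rw [cartanMatrix_symm hsl]
  by_contra h0
  exact h ⟨hij.symm, h0⟩

lemma sigmaX_eq (hsl : b.cartanMatrix.IsSimplyLaced) (hq : 1 < q) (i j : b.support) :
    sigmaX b q i j = (((√(q : ℝ) : ℝ) : ℂ))⁻¹ • mono b q (coordRefl b i (Pi.single j 1)) := by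
  have hs := sqrtQ_ne_zero b hq
  have hss := sqrtQ_mul_self b q
  have hv := var_ne_zero b
  have hsm : ∀ f : RatFun b, (((√(q : ℝ) : ℝ) : ℂ))⁻¹ • f = (sqrtQ b q)⁻¹ * f := by
    intro f
    rw [Algebra.smul_def, map_inv₀]
    rfl
  rw [hsm, sigmaX, coordRefl_single, one_mul]
  split_ifs with h1 h2
  · subst h1
    rw [b.cartanMatrix_apply_same, ← Pi.single_sub, mono_single, ← hss, yVar]
    norm_num
    ring
  · rw [cartanMatrix_of_adjacent hsl h2, Pi.single_neg, sub_neg_eq_add, mono_add hq, mono_single,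
      mono_single, zpow_one, zpow_one, yVar, yVar]
    field_simp
  · rw [cartanMatrix_of_not_adjacent hsl h1 h2, Pi.single_zero, sub_zero, mono_single, zpow_one,
      yVar, inv_mul_cancel_left₀ hs]

lemma epsX_eq (hsl : b.cartanMatrix.IsSimplyLaced) (hq : 1 < q) (i j : b.support) :
    epsX b i j = ((-1) ^ (b.cartanMatrix j i) * (((√(q : ℝ) : ℝ) : ℂ))⁻¹) •
      mono b q (AddMonoidHom.id _ (Pi.single j 1)) := by
  rw [mul_smul, AddMonoidHom.id_apply, ← var_eq hq, epsX]
  split_ifs with h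
  · rw [cartanMatrix_of_adjacent hsl h]; simp
  · by_cases hij : j = i
    · subst hij
      rw [b.cartanMatrix_apply_same, show ((-1 : ℂ) ^ (2 : ℤ)) = 1 by norm_num, one_smul]
    · rw [cartanMatrix_of_not_adjacent hsl hij h]; simp

lemma aeval_sigmaX_injective (hsl : b.cartanMatrix.IsSimplyLaced) (hq : 1 < q) (i : b.support) :
    Function.Injective (aeval (sigmaX b q i) : Poly b →ₐ[ℂ] RatFun b) :=
  aeval_injective hq (coordRefl b i)
    (Function.LeftInverse.injective (g := coordRefl b i) (coordRefl_coordRefl b i))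
    (fun _ => (((√(q : ℝ) : ℝ) : ℂ))⁻¹) (fun _ => inv_ne_zero (sqrt_ne_zero hq)) _
    (sigmaX_eq hsl hq i)

lemma aeval_epsX_injective (hsl : b.cartanMatrix.IsSimplyLaced) (i : b.support) :
    Function.Injective (aeval (epsX b i) : Poly b →ₐ[ℂ] RatFun b) :=
  aeval_injective (q := 2) one_lt_two (AddMonoidHom.id _) Function.injective_id
    (fun j => (-1) ^ (b.cartanMatrix j i) * (((√((2 : ℕ) : ℝ) : ℝ) : ℂ))⁻¹)
    (fun _ => mul_ne_zero (zpow_ne_zero _ (by norm_num)) (inv_ne_zero (sqrt_ne_zero one_lt_two))) _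
    (epsX_eq hsl one_lt_two i)

/-- The substitution `f(x) ↦ f(σ_i x)` as an endomorphism of the field `ℂ(x)`. -/
def reflHom (hsl : b.cartanMatrix.IsSimplyLaced) (hq : 1 < q) (i : b.support) :
    RatFun b →ₐ[ℂ] RatFun b :=
  IsFractionRing.liftAlgHom (aeval_sigmaX_injective hsl hq i)

/-- The substitution `f(x) ↦ f(ε_i x)` as an endomorphism of the field `ℂ(x)`. -/
def signHom (hsl : b.cartanMatrix.IsSimplyLaced) (i : b.support) : RatFun b →ₐ[ℂ] RatFun b :=
  IsFractionRing.liftAlgHom (aeval_epsX_injective hsl i)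

variable (hsl : b.cartanMatrix.IsSimplyLaced) (hq : 1 < q)

lemma subst_sigmaX (i : b.support) (f : RatFun b) :
    subst b (sigmaX b q i) f = reflHom hsl hq i f := subst_eq_liftAlgHom _ f

lemma subst_epsX (i : b.support) (f : RatFun b) :
    subst b (epsX b i) f = signHom hsl i f := subst_eq_liftAlgHom _ f

lemma algHom_yVar (φ : RatFun b →ₐ[ℂ] RatFun b) (j : b.support) :
    φ (yVar b q j) = sqrtQ b q * φ (var b j) := by
  rw [yVar, map_mul, sqrtQ, AlgHom.commutes]

lemma algHom_mono (φ : RatFun b →ₐ[ℂ] RatFun b) (v : b.support → ℤ) :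
    φ (mono b q v) = ∏ j, φ (yVar b q j) ^ v j := by
  simp only [mono, map_prod, map_zpow₀]

lemma reflHom_mono (i : b.support) (v : b.support → ℤ) :
    reflHom hsl hq i (mono b q v) = mono b q (coordRefl b i v) := by
  rw [algHom_mono, mono_map hq]
  refine Finset.prod_congr rfl fun j _ => ?_
  congr 1
  have h : reflHom hsl hq i (var b j) = sigmaX b q i j := by
    rw [reflHom, var, liftAlgHom_algebraMap, aeval_X]
  rw [algHom_yVar, h, sigmaX_eq hsl hq, Algebra.smul_def, sqrtQ, ← mul_assoc, ← map_mul,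
    mul_inv_cancel₀ (sqrt_ne_zero hq), map_one, one_mul]

lemma signHom_mono (hq : 1 < q) (i : b.support) (v : b.support → ℤ) :
    signHom hsl i (mono b q v) = (-1) ^ simplePairing b i v * mono b q v := by
  have h : ∀ j, signHom hsl i (yVar b q j) = (-1) ^ (b.cartanMatrix j i) * yVar b q j := by
    intro j
    have h : signHom hsl i (var b j) = epsX b i j := by
      rw [signHom, var, liftAlgHom_algebraMap, aeval_X]
    rw [algHom_yVar, h, epsX_eq hsl hq, AddMonoidHom.id_apply, mul_smul, ← var_eq hq, yVar,
      Algebra.smul_def, map_zpow₀, map_neg, map_one]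
    ring
  rw [algHom_mono, simplePairing_apply]
  simp only [h, mul_zpow]
  rw [Finset.prod_mul_distrib, mono]
  congr 1
  have : ∀ (s : Finset b.support) (n : b.support → ℤ),
      (-1 : RatFun b) ^ (∑ j ∈ s, n j) = ∏ j ∈ s, (-1) ^ n j := by
    intro s n
    induction s using Finset.induction_on with
    | empty => simp
    | insert a s ha ih =>
      rw [Finset.sum_insert ha, Finset.prod_insert ha, zpow_add₀ (by norm_num), ih]
  rw [this]
  refine Finset.prod_congr rfl fun j _ => ?_
  rw [← zpow_mul, mul_comm]

/-- An endomorphism of `ℂ(x)` over `ℂ` is determined by its values on Laurent monomials. -/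
lemma algHom_ext_mono (hq : 1 < q) {φ ψ : RatFun b →ₐ[ℂ] RatFun b}
    (h : ∀ v, φ (mono b q v) = ψ (mono b q v)) (f : RatFun b) : φ f = ψ f := by
  have : φ = ψ := by
    apply IsLocalization.algHom_ext (nonZeroDivisors (Poly b))
    apply MvPolynomial.algHom_ext
    intro j
    change φ (var b j) = ψ (var b j)
    rw [var_eq hq, Algebra.smul_def, map_mul, map_mul, AlgHom.commutes, AlgHom.commutes, h]
  rw [this]

lemma reflHom_reflHom (i : b.support) (f : RatFun b) :
    reflHom hsl hq i (reflHom hsl hq i f) = f := by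
  refine algHom_ext_mono hq (φ := (reflHom hsl hq i).comp (reflHom hsl hq i))
    (ψ := AlgHom.id ℂ _) (fun v => ?_) f
  simp [reflHom_mono, coordRefl_coordRefl]

lemma reflHom_comm {i j : b.support} (h : b.cartanMatrix i j = 0) (f : RatFun b) :
    reflHom hsl hq i (reflHom hsl hq j f) = reflHom hsl hq j (reflHom hsl hq i f) := by
  refine algHom_ext_mono hq (φ := (reflHom hsl hq i).comp (reflHom hsl hq j))
    (ψ := (reflHom hsl hq j).comp (reflHom hsl hq i)) (fun v => ?_) f
  simp only [AlgHom.comp_apply, reflHom_mono]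
  congr 1
  apply ofCoords_injective b
  simp only [ofCoords_coordRefl]
  rw [← mul_smul, ← mul_smul, simpleRefl_comm_of_eq_zero h]

lemma reflHom_braid {i j : b.support} (h : b.cartanMatrix i j = -1) (f : RatFun b) :
    reflHom hsl hq i (reflHom hsl hq j (reflHom hsl hq i f)) =
      reflHom hsl hq j (reflHom hsl hq i (reflHom hsl hq j f)) := by
  refine algHom_ext_mono hq
    (φ := (reflHom hsl hq i).comp ((reflHom hsl hq j).comp (reflHom hsl hq i)))
    (ψ := (reflHom hsl hq j).comp ((reflHom hsl hq i).comp (reflHom hsl hq j))) (fun v => ?_) f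
  simp only [AlgHom.comp_apply, reflHom_mono]
  congr 1
  apply ofCoords_injective b
  simp only [ofCoords_coordRefl]
  rw [← mul_smul, ← mul_smul, ← mul_smul, ← mul_smul,
    simpleRefl_braid_of_eq_neg_one h (by rwa [cartanMatrix_symm hsl])]

lemma signHom_comm (i j : b.support) (f : RatFun b) :
    signHom hsl i (signHom hsl j f) = signHom hsl j (signHom hsl i f) := by
  refine algHom_ext_mono one_lt_two (φ := (signHom hsl i).comp (signHom hsl j))
    (ψ := (signHom hsl j).comp (signHom hsl i)) (fun v => ?_) f
  simp only [AlgHom.comp_apply, signHom_mono hsl one_lt_two, map_mul, map_zpow₀, map_neg, map_one]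
  ring

lemma signHom_signHom (i : b.support) (f : RatFun b) :
    signHom hsl i (signHom hsl i f) = f := by
  refine algHom_ext_mono one_lt_two (φ := (signHom hsl i).comp (signHom hsl i))
    (ψ := AlgHom.id ℂ _) (fun v => ?_) f
  simp only [AlgHom.comp_apply, signHom_mono hsl one_lt_two, map_mul, map_zpow₀, map_neg, map_one,
    AlgHom.id_apply]
  rw [← mul_assoc, ← mul_zpow]
  simp

/-- A sign change `ε_i` commutes past `σ_j` when `α_i` and `α_j` are equal or orthogonal. -/
lemma signHom_reflHom_of_even {i j : b.support} (h : Even (b.cartanMatrix j i)) (f : RatFun b) :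
    signHom hsl i (reflHom hsl hq j f) = reflHom hsl hq j (signHom hsl i f) := by
  refine algHom_ext_mono hq (φ := (signHom hsl i).comp (reflHom hsl hq j))
    (ψ := (reflHom hsl hq j).comp (signHom hsl i)) (fun v => ?_) f
  simp only [AlgHom.comp_apply, signHom_mono hsl hq, reflHom_mono, map_mul, map_zpow₀, map_neg,
    map_one, simplePairing_coordRefl]
  rw [zpow_sub₀ (by norm_num), (h.mul_left _).neg_one_zpow, div_one]

/-- Past an adjacent reflection `σ_j`, the sign change `ε_i` turns into `ε_i ε_j`. -/
lemma signHom_reflHom_of_eq_neg_one {i j : b.support} (h : b.cartanMatrix j i = -1)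
    (f : RatFun b) :
    signHom hsl i (reflHom hsl hq j f) = reflHom hsl hq j (signHom hsl i (signHom hsl j f)) := by
  refine algHom_ext_mono hq (φ := (signHom hsl i).comp (reflHom hsl hq j))
    (ψ := (reflHom hsl hq j).comp ((signHom hsl i).comp (signHom hsl j))) (fun v => ?_) f
  simp only [AlgHom.comp_apply, signHom_mono hsl hq, reflHom_mono, map_mul, map_zpow₀, map_neg,
    map_one, simplePairing_coordRefl, h]
  rw [show simplePairing b i v - simplePairing b j v * -1 =
    simplePairing b i v + simplePairing b j v by ring, zpow_add₀ (by norm_num)]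
  ring

lemma reflHom_yVar_self (i : b.support) :
    reflHom hsl hq i (yVar b q i) = (yVar b q i)⁻¹ := by
  have := reflHom_mono hsl hq i (Pi.single i 1)
  rwa [coordRefl_single_self, mono_single, mono_single, zpow_one, zpow_neg, zpow_one] at this

lemma reflHom_yVar (i j : b.support) :
    reflHom hsl hq i (yVar b q j) = yVar b q j * (yVar b q i) ^ (-b.cartanMatrix j i) := by
  have := reflHom_mono hsl hq i (Pi.single j 1)
  rwa [coordRefl_single, mono_sub hq, mono_single, mono_single, zpow_one, one_mul,
    ← zpow_neg] at this

lemma signHom_yVar (hq : 1 < q) (i j : b.support) :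
    signHom hsl i (yVar b q j) = (-1) ^ (b.cartanMatrix j i) * yVar b q j := by
  have := signHom_mono hsl hq i (Pi.single j 1)
  rwa [simplePairing_single, mono_single, zpow_one, one_mul] at this

lemma signHom_yVar_self (hq : 1 < q) (i : b.support) :
    signHom hsl i (yVar b q i) = yVar b q i := by
  rw [signHom_yVar hsl hq, b.cartanMatrix_apply_same]
  norm_num

end Field


/-! ### The twisted operators satisfy the braid relations -/

section Braid

open RootPairing MvPolynomial
open scoped Classical

/-- The coefficient of `f(σ_i x)` in `f |_ℓ σ_i`, up to a monomial; `s` stands for `√q` and `u` for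
`y_i`. -/
def coeffA {F : Type*} [Field F] (s u : F) : F := (s - 1) * (1 + u) / (2 * (s - u))

/-- The coefficient of `f(ε_i σ_i x)` in `f |_ℓ σ_i`, up to a sign and a monomial. -/
def coeffB {F : Type*} [Field F] (s u : F) : F := (s + 1) * (u - 1) / (2 * (s - u))

variable {ι M N : Type*} [Fintype ι] [AddCommGroup M] [Module ℝ M] [AddCommGroup N] [Module ℝ N]
variable {P : RootPairing ι ℝ M N} [P.IsRootSystem] [P.IsCrystallographic] [P.IsReduced]
variable {b : P.Base} {q : ℕ}

lemma sqrtQ_sub_ne_zero (hq : 1 < q) {v : b.support → ℤ} (hv : v ≠ 0) :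
    sqrtQ b q - mono b q v ≠ 0 :=
  sub_ne_zero.2 (mono_ne_algebraMap hq hv _).symm

lemma sqrtQ_add_ne_zero (hq : 1 < q) {v : b.support → ℤ} (hv : v ≠ 0) :
    sqrtQ b q + mono b q v ≠ 0 := by
  rw [← sub_neg_eq_add, sub_ne_zero]
  intro h
  apply mono_ne_algebraMap hq hv (-((√(q : ℝ) : ℝ) : ℂ))
  rw [map_neg, ← neg_eq_iff_eq_neg, ← h]
  rfl

lemma single_one_ne_zero (i : b.support) : (Pi.single i 1 : b.support → ℤ) ≠ 0 := by simp

lemma algHom_sqrtQ (φ : RatFun b →ₐ[ℂ] RatFun b) : φ (sqrtQ b q) = sqrtQ b q :=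
  AlgHom.commutes _ _

lemma algHom_coeffA (φ : RatFun b →ₐ[ℂ] RatFun b) (u : RatFun b) :
    φ (coeffA (sqrtQ b q) u) = coeffA (sqrtQ b q) (φ u) := by
  simp only [coeffA, map_div₀, map_mul, map_sub, map_add, map_one, algHom_sqrtQ, map_ofNat]

lemma algHom_coeffB (φ : RatFun b →ₐ[ℂ] RatFun b) (u : RatFun b) :
    φ (coeffB (sqrtQ b q) u) = coeffB (sqrtQ b q) (φ u) := by
  simp only [coeffB, map_div₀, map_mul, map_sub, map_add, map_one, algHom_sqrtQ, map_ofNat]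

/-- The twisted operator in terms of `y_i = √q x_i`. -/
lemma slashSimple_eq (hsl : b.cartanMatrix.IsSimplyLaced) (hq : 1 < q)
    (l : b.support → ℕ) (f : RatFun b) (i : b.support) :
    slashSimple b q l f i = yVar b q i ^ ((l i : ℤ) - 1) *
      (coeffA (sqrtQ b q) (yVar b q i) * reflHom hsl hq i f +
        (-1) ^ l i * (coeffB (sqrtQ b q) (yVar b q i) * reflHom hsl hq i (signHom hsl i f))) := by
  have hs := sqrtQ_ne_zero b hq
  have hx := var_ne_zero b i
  have hy := yVar_ne_zero b hq i
  have hss := sqrtQ_mul_self b q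
  have h1 : sqrtQ b q - sqrtQ b q * var b i ≠ 0 := by
    have := sqrtQ_sub_ne_zero (b := b) hq (single_one_ne_zero i)
    rwa [mono_single, zpow_one, yVar] at this
  have h2 : (1 : RatFun b) - var b i ≠ 0 := by
    intro h
    apply h1
    rw [show sqrtQ b q - sqrtQ b q * var b i = sqrtQ b q * (1 - var b i) by ring, h, mul_zero]
  have h3 : sqrtQ b q * sqrtQ b q - sqrtQ b q * sqrtQ b q * var b i ≠ 0 := by
    rw [show sqrtQ b q * sqrtQ b q - sqrtQ b q * sqrtQ b q * var b i =
      sqrtQ b q * (sqrtQ b q - sqrtQ b q * var b i) by ring]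
    exact mul_ne_zero hs h1
  rw [slashSimple, subst_sigmaX hsl hq, subst_sigmaX hsl hq, plusPart, minusPart, subst_epsX hsl]
  simp only [map_div₀, map_add, map_sub, map_mul, map_pow, map_neg, map_one, map_ofNat]
  rw [zpow_sub_one₀ hy, zpow_natCast, yVar, coeffA, coeffB, ← hss]
  rw [mul_comm (var b i) (sqrtQ b q)]
  generalize reflHom hsl hq i f = F
  generalize reflHom hsl hq i (signHom hsl i f) = G
  generalize (-1 : RatFun b) ^ l i = n
  generalize (sqrtQ b q * var b i) ^ l i = m
  field_simp
  ring

lemma slashSimple_add (hsl : b.cartanMatrix.IsSimplyLaced) (hq : 1 < q)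
    (l : b.support → ℕ) (f g : RatFun b) (i : b.support) :
    slashSimple b q l (f + g) i = slashSimple b q l f i + slashSimple b q l g i := by
  simp only [slashSimple_eq hsl hq l, map_add]
  ring

lemma slashSimple_sum (hsl : b.cartanMatrix.IsSimplyLaced) (hq : 1 < q)
    (l : b.support → ℕ) {α : Type*} (s : Finset α) (f : α → RatFun b) (i : b.support) :
    slashSimple b q l (∑ a ∈ s, f a) i = ∑ a ∈ s, slashSimple b q l (f a) i := by
  induction s using Finset.induction_on with
  | empty => simp [slashSimple_eq hsl hq l]
  | insert a s ha ih => rw [Finset.sum_insert ha, Finset.sum_insert ha, slashSimple_add hsl hq l, ih]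

lemma neg_one_pow_mul_self {R : Type*} [Ring R] (n : ℕ) : (-1 : R) ^ n * (-1) ^ n = 1 := by
  rw [← pow_add, (Even.add_self n).neg_one_pow]

/-- The operators `|_ℓ σ_i` are involutions. -/
lemma slashSimple_slashSimple (hsl : b.cartanMatrix.IsSimplyLaced) (hq : 1 < q)
    (l : b.support → ℕ) (i : b.support) (f : RatFun b) :
    slashSimple b q l (slashSimple b q l f i) i = f := by
  have h1 := sqrtQ_sub_ne_zero (b := b) hq (single_one_ne_zero i)
  have h2 := sqrtQ_sub_ne_zero (b := b) hq (neg_ne_zero.2 (single_one_ne_zero i))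
  rw [mono_single, zpow_one] at h1
  rw [mono_neg hq, mono_single, zpow_one] at h2
  have hy := yVar_ne_zero b hq i
  have hE : signHom hsl i (yVar b q i) = yVar b q i := signHom_yVar_self hsl hq i
  have hEe : Even (b.cartanMatrix i i) := by
    rw [b.cartanMatrix_apply_same]
    exact even_two
  have hn := neg_one_pow_mul_self (R := RatFun b) (l i)
  simp only [slashSimple_eq hsl hq l, map_add, map_mul, map_pow, map_neg, map_one, map_zpow₀,
    algHom_coeffA, algHom_coeffB, reflHom_yVar_self, hE, signHom_reflHom_of_even hsl hq hEe,
    reflHom_reflHom, signHom_signHom]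
  have h3 : sqrtQ b q * yVar b q i - 1 ≠ 0 := by
    intro h
    apply h2
    field_simp
    rw [h]
    simp
  have e1 : coeffA (sqrtQ b q) (yVar b q i) * coeffA (sqrtQ b q) (yVar b q i)⁻¹ +
      coeffB (sqrtQ b q) (yVar b q i) * coeffB (sqrtQ b q) (yVar b q i)⁻¹ = 1 := by
    rw [coeffA, coeffA, coeffB, coeffB]
    field_simp
    ring
  have e2 : coeffA (sqrtQ b q) (yVar b q i) * coeffB (sqrtQ b q) (yVar b q i)⁻¹ +
      coeffB (sqrtQ b q) (yVar b q i) * coeffA (sqrtQ b q) (yVar b q i)⁻¹ = 0 := by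
    rw [coeffA, coeffA, coeffB, coeffB]
    field_simp
    ring
  have e3 : yVar b q i ^ ((l i : ℤ) - 1) * (yVar b q i)⁻¹ ^ ((l i : ℤ) - 1) = 1 := by
    rw [← mul_zpow, mul_inv_cancel₀ hy, one_zpow]
  linear_combination (exp := 1)
    (f * (coeffA (sqrtQ b q) (yVar b q i) * coeffA (sqrtQ b q) (yVar b q i)⁻¹ +
      (-1) ^ l i * (-1) ^ l i *
        (coeffB (sqrtQ b q) (yVar b q i) * coeffB (sqrtQ b q) (yVar b q i)⁻¹)) +
      (-1) ^ l i * signHom hsl i f *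
        (coeffA (sqrtQ b q) (yVar b q i) * coeffB (sqrtQ b q) (yVar b q i)⁻¹ +
      coeffB (sqrtQ b q) (yVar b q i) * coeffA (sqrtQ b q) (yVar b q i)⁻¹)) * e3 +
    f * e1 + (-1) ^ l i * signHom hsl i f * e2 +
    f * (coeffB (sqrtQ b q) (yVar b q i) * coeffB (sqrtQ b q) (yVar b q i)⁻¹) * hn

lemma slashSimple_comm (hsl : b.cartanMatrix.IsSimplyLaced) (hq : 1 < q)
    (l : b.support → ℕ) {i j : b.support} (h : b.cartanMatrix i j = 0) (f : RatFun b) :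
    slashSimple b q l (slashSimple b q l f i) j = slashSimple b q l (slashSimple b q l f j) i := by
  have h' : b.cartanMatrix j i = 0 := by rwa [cartanMatrix_symm hsl]
  have a1 : reflHom hsl hq i (yVar b q j) = yVar b q j := by rw [reflHom_yVar, h']; simp
  have a2 : reflHom hsl hq j (yVar b q i) = yVar b q i := by rw [reflHom_yVar, h]; simp
  have a3 : signHom hsl i (yVar b q j) = yVar b q j := by rw [signHom_yVar hsl hq, h']; simp
  have a4 : signHom hsl j (yVar b q i) = yVar b q i := by rw [signHom_yVar hsl hq, h]; simp
  have a5 : Even (b.cartanMatrix i j) := by rw [h]; exact Even.zero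
  have a6 : Even (b.cartanMatrix j i) := by rw [h']; exact Even.zero
  simp only [slashSimple_eq hsl hq l, map_add, map_mul, map_pow, map_neg, map_one, map_zpow₀,
    algHom_coeffA, algHom_coeffB, a1, a2, a3, a4, signHom_reflHom_of_even hsl hq a5,
    signHom_reflHom_of_even hsl hq a6, reflHom_comm hsl hq h, signHom_comm hsl i j]
  ring

/-- The composite of three operators along `i, j, i`, for adjacent `i` and `j`. -/
lemma slashSimple_three (hsl : b.cartanMatrix.IsSimplyLaced) (hq : 1 < q)
    (l : b.support → ℕ) {i j : b.support} (h : b.cartanMatrix i j = -1) (f : RatFun b) :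
    slashSimple b q l (slashSimple b q l (slashSimple b q l f i) j) i =
      (yVar b q i * yVar b q j) ^ ((l i : ℤ) - 1) * (yVar b q i * yVar b q j) ^ ((l j : ℤ) - 1) *
      ((coeffA (sqrtQ b q) (yVar b q i) * coeffA (sqrtQ b q) (yVar b q j) *
            coeffA (sqrtQ b q) (yVar b q i * yVar b q j) -
          coeffB (sqrtQ b q) (yVar b q i) * coeffB (sqrtQ b q) (yVar b q j) *
            coeffB (sqrtQ b q) (-(yVar b q i * yVar b q j))) *
          reflHom hsl hq i (reflHom hsl hq j (reflHom hsl hq i f)) +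
        (-1) ^ l i * (coeffA (sqrtQ b q) (yVar b q i) * coeffB (sqrtQ b q) (yVar b q j) *
            coeffA (sqrtQ b q) (yVar b q i * yVar b q j) -
          coeffB (sqrtQ b q) (yVar b q i) * coeffA (sqrtQ b q) (yVar b q j) *
            coeffB (sqrtQ b q) (-(yVar b q i * yVar b q j))) *
          reflHom hsl hq i (reflHom hsl hq j (reflHom hsl hq i (signHom hsl i f))) +
        (-1) ^ l j * (coeffB (sqrtQ b q) (yVar b q i) * coeffA (sqrtQ b q) (-yVar b q j) *
            coeffA (sqrtQ b q) (-(yVar b q i * yVar b q j)) -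
          coeffA (sqrtQ b q) (yVar b q i) * coeffB (sqrtQ b q) (-yVar b q j) *
            coeffB (sqrtQ b q) (yVar b q i * yVar b q j)) *
          reflHom hsl hq i (reflHom hsl hq j (reflHom hsl hq i (signHom hsl j f))) +
        (-1) ^ l i * (-1) ^ l j *
          (coeffB (sqrtQ b q) (yVar b q i) * coeffB (sqrtQ b q) (-yVar b q j) *
            coeffA (sqrtQ b q) (-(yVar b q i * yVar b q j)) -
          coeffA (sqrtQ b q) (yVar b q i) * coeffA (sqrtQ b q) (-yVar b q j) *
            coeffB (sqrtQ b q) (yVar b q i * yVar b q j)) *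
          reflHom hsl hq i (reflHom hsl hq j (reflHom hsl hq i
            (signHom hsl i (signHom hsl j f))))) := by
  have h' : b.cartanMatrix j i = -1 := by rwa [cartanMatrix_symm hsl]
  have hy := yVar_ne_zero b hq i
  have hz := yVar_ne_zero b hq j
  have a1 : reflHom hsl hq i (yVar b q j) = yVar b q i * yVar b q j := by
    rw [reflHom_yVar, h', neg_neg, zpow_one, mul_comm]
  have a2 : reflHom hsl hq j (yVar b q i) = yVar b q i * yVar b q j := by
    rw [reflHom_yVar, h, neg_neg, zpow_one]
  have a3 : signHom hsl i (yVar b q j) = -yVar b q j := by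
    rw [signHom_yVar hsl hq, h']; norm_num
  have a4 : signHom hsl j (yVar b q i) = -yVar b q i := by
    rw [signHom_yVar hsl hq, h]; norm_num
  have a5 : (yVar b q i)⁻¹ * (yVar b q i * yVar b q j) = yVar b q j := by
    rw [inv_mul_cancel_left₀ hy]
  have a6 := signHom_yVar_self hsl hq i
  have neg_zpow : ∀ (u : RatFun b) (n : ℕ),
      (-u) ^ ((n : ℤ) - 1) = -((-1) ^ n * u ^ ((n : ℤ) - 1)) := by
    intro u n
    rw [← neg_one_mul, mul_zpow, zpow_sub_one₀ (by norm_num), zpow_natCast]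
    simp
  have hEe : Even (b.cartanMatrix i i) := by
    rw [b.cartanMatrix_apply_same]
    exact even_two
  simp only [slashSimple_eq hsl hq l, map_add, map_mul, map_pow, map_neg, map_one, map_zpow₀,
    algHom_coeffA, algHom_coeffB, reflHom_yVar_self, a1, a2, a3, a4, a5, a6, neg_zpow,
    signHom_reflHom_of_eq_neg_one hsl hq h, signHom_reflHom_of_eq_neg_one hsl hq h',
    signHom_reflHom_of_even hsl hq hEe, signHom_comm hsl j i, signHom_signHom, mul_neg, neg_mul, neg_neg]
  rw [mul_zpow (yVar b q i) (yVar b q j) ((l i : ℤ) - 1)]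
  generalize reflHom hsl hq i (reflHom hsl hq j (reflHom hsl hq i f)) = F0
  generalize reflHom hsl hq i (reflHom hsl hq j (reflHom hsl hq i (signHom hsl i f))) = F1
  generalize reflHom hsl hq i (reflHom hsl hq j (reflHom hsl hq i (signHom hsl j f))) = F2
  generalize reflHom hsl hq i (reflHom hsl hq j (reflHom hsl hq i
            (signHom hsl i (signHom hsl j f)))) = F3
  rcases neg_one_pow_eq_or (RatFun b) (l i) with hi | hi <;>
  rcases neg_one_pow_eq_or (RatFun b) (l j) with hj | hj <;>
  · rw [hi, hj]
    ring

section Identities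

variable {F : Type*} [Field F] [CharZero F] {s y z : F}

/-- The equality of the coefficients of `f(ε_i σ_i σ_j σ_i x)` on the two sides of the braid relation, with
`y` and `z` standing for `y_i` and `y_j`. -/
lemma coeff_identity_left (h1 : s - y ≠ 0) (h2 : s - z ≠ 0) (h3 : s + y ≠ 0) (h5 : s - y * z ≠ 0)
    (h6 : s + y * z ≠ 0) : coeffA s y * coeffB s z * coeffA s (y * z) -
      coeffB s y * coeffA s z * coeffB s (-(y * z)) =
      coeffB s z * coeffA s (-y) * coeffA s (-(y * z)) -
      coeffA s z * coeffB s (-y) * coeffB s (y * z) := by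
  simp only [coeffA, coeffB, sub_neg_eq_add]
  field_simp
  ring

/-- The equality of the coefficients of `f(ε_i ε_j σ_i σ_j σ_i x)` on the two sides of the braid
relation. -/
lemma coeff_identity_both (h1 : s - y ≠ 0) (h2 : s - z ≠ 0) (h3 : s + y ≠ 0) (h4 : s + z ≠ 0)
    (h5 : s - y * z ≠ 0) (h6 : s + y * z ≠ 0) : coeffB s y * coeffB s (-z) * coeffA s (-(y * z)) -
      coeffA s y * coeffA s (-z) * coeffB s (y * z) =
      coeffB s z * coeffB s (-y) * coeffA s (-(y * z)) -
      coeffA s z * coeffA s (-y) * coeffB s (y * z) := by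
  simp only [coeffA, coeffB, sub_neg_eq_add]
  field_simp
  ring

end Identities

lemma slashSimple_braid (hsl : b.cartanMatrix.IsSimplyLaced) (hq : 1 < q)
    (l : b.support → ℕ) {i j : b.support} (h : b.cartanMatrix i j = -1) (f : RatFun b) :
    slashSimple b q l (slashSimple b q l (slashSimple b q l f i) j) i =
      slashSimple b q l (slashSimple b q l (slashSimple b q l f j) i) j := by
  have h' : b.cartanMatrix j i = -1 := by rwa [cartanMatrix_symm hsl]
  rw [slashSimple_three hsl hq l h, slashSimple_three hsl hq l h']
  simp only [← reflHom_braid hsl hq h, signHom_comm hsl j i]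
  have h1 := sqrtQ_sub_ne_zero (b := b) hq (single_one_ne_zero i)
  have h2 := sqrtQ_sub_ne_zero (b := b) hq (single_one_ne_zero j)
  have h3 := sqrtQ_add_ne_zero (b := b) hq (single_one_ne_zero i)
  have h4 := sqrtQ_add_ne_zero (b := b) hq (single_one_ne_zero j)
  have h0 : (Pi.single i 1 + Pi.single j 1 : b.support → ℤ) ≠ 0 := by
    intro h0
    have hij : i ≠ j := by
      rintro rfl
      rw [b.cartanMatrix_apply_same] at h
      omega
    have := congrFun h0 i
    simp [hij] at this
  have h5 := sqrtQ_sub_ne_zero (b := b) hq h0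
  have h6 := sqrtQ_add_ne_zero (b := b) hq h0
  rw [mono_add hq] at h5 h6
  simp only [mono_single, zpow_one] at h1 h2 h3 h4 h5 h6
  rw [mul_comm (yVar b q j) (yVar b q i)]
  generalize yVar b q i = y at *
  generalize yVar b q j = z at *
  generalize sqrtQ b q = s at *
  have c1 := coeff_identity_left h1 h2 h3 h5 h6
  have c2 := coeff_identity_left h2 h1 h4 (by rwa [mul_comm]) (by rwa [mul_comm])
  rw [mul_comm z y] at c2
  have c3 := coeff_identity_both h1 h2 h3 h4 h5 h6
  rw [c1, c2, c3]
  ring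

end Braid


/-! ### The average over the Weyl group -/

section Average

open RootPairing MvPolynomial
open scoped Classical

variable {ι M N : Type*} [Fintype ι] [AddCommGroup M] [Module ℝ M] [AddCommGroup N] [Module ℝ N]
variable {P : RootPairing ι ℝ M N} [P.IsRootSystem] [P.IsCrystallographic] [P.IsReduced]
variable {b : P.Base} {q : ℕ}

lemma wordProd_word (b : P.Base) (w : P.weylGroup) : wordProd b (word b w) = w :=
  (exists_wordProd_eq b w).choose_spec

/-- The `ℓ`-twisted action does not depend on the word chosen to define it. -/
lemma slash_wordProd (hsl : b.cartanMatrix.IsSimplyLaced) (hq : 1 < q) (l : b.support → ℕ)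
    (f : RatFun b) (L : List b.support) :
    slash b q l f (wordProd b L) = L.foldl (slashSimple b q l) f :=
  foldl_eq_of_wordProd_eq b hsl _ (fun i x => slashSimple_slashSimple hsl hq l i x)
    (fun _ _ h x => slashSimple_comm hsl hq l h x) (fun _ _ h x => slashSimple_braid hsl hq l h x)
    f _ _ (wordProd_word b _)

lemma slash_one (hsl : b.cartanMatrix.IsSimplyLaced) (hq : 1 < q) (l : b.support → ℕ)
    (f : RatFun b) : slash b q l f 1 = f := by
  have := slash_wordProd hsl hq l f []
  simpa [wordProd] using this

lemma slash_mul_simpleRefl (hsl : b.cartanMatrix.IsSimplyLaced) (hq : 1 < q) (l : b.support → ℕ)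
    (f : RatFun b) (w : P.weylGroup) (i : b.support) :
    slash b q l f (w * simpleRefl b i) = slashSimple b q l (slash b q l f w) i := by
  have := slash_wordProd hsl hq l f (word b w ++ [i])
  rw [wordProd_concat, wordProd_word, List.foldl_append] at this
  exact this

/-- A rational function is even if it is fixed by all sign changes `ε_i`. -/
def IsEven (hsl : b.cartanMatrix.IsSimplyLaced) (g : RatFun b) : Prop :=
  ∀ i, signHom hsl i g = g

lemma IsEven.reflHom {hsl : b.cartanMatrix.IsSimplyLaced} {g : RatFun b} (hg : IsEven hsl g)
    (hq : 1 < q) (j : b.support) : IsEven hsl (reflHom hsl hq j g) := by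
  intro i
  rcases eq_or_ne j i with rfl | hij
  · have hEe : Even (b.cartanMatrix j j) := by
      rw [b.cartanMatrix_apply_same]
      exact even_two
    rw [signHom_reflHom_of_even hsl hq hEe, hg]
  · rcases hsl hij with h | h
    · rw [signHom_reflHom_of_even hsl hq (by rw [h]; exact Even.zero), hg]
    · rw [signHom_reflHom_of_eq_neg_one hsl hq h, hg, hg]

lemma slashSimple_mul_of_isEven {hsl : b.cartanMatrix.IsSimplyLaced} {g : RatFun b}
    (hg : IsEven hsl g) (hq : 1 < q) (l : b.support → ℕ) (f : RatFun b) (i : b.support) :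
    slashSimple b q l (g * f) i = reflHom hsl hq i g * slashSimple b q l f i := by
  rw [slashSimple_eq hsl hq, slashSimple_eq hsl hq, map_mul, map_mul, map_mul, hg]
  ring

lemma foldl_slashSimple_mul_of_isEven {hsl : b.cartanMatrix.IsSimplyLaced} (hq : 1 < q)
    (l : b.support → ℕ) (L : List b.support) : ∀ {g : RatFun b} (_ : IsEven hsl g) (f : RatFun b),
    L.foldl (slashSimple b q l) (g * f) =
      L.foldl (fun g i => subst b (sigmaX b q i) g) g * L.foldl (slashSimple b q l) f := by
  induction L with
  | nil => intro g hg f; rfl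
  | cons i L ih =>
    intro g hg f
    simp only [List.foldl_cons]
    rw [slashSimple_mul_of_isEven hg hq, ih (hg.reflHom hq i), subst_sigmaX hsl hq]

/-- The factor `1 - c y^{2α}` attached to a root. -/
def rootFactor (b : P.Base) (q : ℕ) (c : ℂ) (k : ι) : RatFun b :=
  1 - algebraMap ℂ (RatFun b) c * mono b q (2 • rootCoords b k)

lemma reflHom_rootFactor (hsl : b.cartanMatrix.IsSimplyLaced) (hq : 1 < q) (i : b.support) (c : ℂ)
    (k : ι) : reflHom hsl hq i (rootFactor b q c k) = rootFactor b q c (simpleRefl b i • k) := by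
  rw [rootFactor, map_sub, map_mul, map_one, AlgHom.commutes, reflHom_mono, map_nsmul,
    rootFactor, rootCoords_simpleRefl_smul]

lemma isEven_rootFactor (hsl : b.cartanMatrix.IsSimplyLaced) (hq : 1 < q) (c : ℂ) (k : ι) :
    IsEven hsl (rootFactor b q c k) := by
  intro i
  have h : Even (simplePairing b i (2 • rootCoords b k)) := by
    rw [map_nsmul]
    exact ⟨_, two_nsmul _⟩
  rw [rootFactor, map_sub, map_mul, map_one, AlgHom.commutes, signHom_mono hsl hq, h.neg_one_zpow,
    one_mul]

lemma rootFactor_ne_zero (hq : 1 < q) (c : ℂ) (k : ι) : rootFactor b q c k ≠ 0 := by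
  intro h
  rw [rootFactor, sub_eq_zero] at h
  refine mono_ne_algebraMap (b := b) hq (v := 2 • rootCoords b k)
    (smul_ne_zero two_ne_zero (rootCoords_ne_zero b k)) c⁻¹ ?_
  rw [map_inv₀]
  exact eq_inv_of_mul_eq_one_right h.symm

lemma rootFactor_simple (c : ℂ) (i : b.support) :
    rootFactor b q c i = 1 - algebraMap ℂ (RatFun b) c * yVar b q i ^ 2 := by
  rw [rootFactor, rootCoords_simple, ← Pi.single_smul, mono_single, nsmul_eq_mul]
  norm_num

lemma sum_rootExponent {k : ι} (hk : b.IsPos k) :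
    (∑ j, rootExponent b k j : ℕ) = (b.height k).toNat := by
  rw [height_eq_sum_rootCoords, ← Int.toNat_natCast (∑ j, rootExponent b k j)]
  congr 1
  push_cast
  exact Finset.sum_congr rfl fun j _ => rootExponent_eq hk j

lemma sqrt_sq (q : ℕ) : (((√(q : ℝ) : ℝ) : ℂ)) ^ 2 = q := by
  rw [← Complex.ofReal_pow, Real.sq_sqrt (Nat.cast_nonneg q)]
  simp

lemma rootFactor_eq_algebraMap {k : ι} (hk : b.IsPos k) (c : ℂ) :
    rootFactor b q c k = algebraMap (Poly b) (RatFun b)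
      (1 - monomial (2 • rootExponent b k) (c * (q : ℂ) ^ (b.height k).toNat)) := by
  have h : 2 • rootCoords b k = fun j => (((2 • rootExponent b k) j : ℕ) : ℤ) := by
    funext j
    rw [Pi.smul_apply, Finsupp.smul_apply, ← rootExponent_eq hk]
    simp
  rw [rootFactor, h, mono_natCast, map_sub, map_one]
  congr 1
  rw [← smul_eq_mul c, ← smul_monomial, Algebra.smul_def, map_mul]
  congr 3
  simp only [Finsupp.smul_apply, smul_eq_mul]
  rw [← Finset.mul_sum, sum_rootExponent hk, pow_mul, sqrt_sq]

/-- The product `∏ (1 - c y^{2α})` over the positive roots. -/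
def posProd (b : P.Base) (q : ℕ) (c : ℂ) : RatFun b :=
  ∏ k : ι with b.IsPos k, rootFactor b q c k

lemma algebraMap_Delta : algebraMap (Poly b) (RatFun b) (Delta b q) = posProd b q 1 := by
  rw [Delta, map_prod, posProd]
  refine Finset.prod_congr (by congr) fun k hk => ?_
  rw [rootFactor_eq_algebraMap (by simpa using hk), one_mul]

lemma algebraMap_Denom (hq : 1 < q) :
    algebraMap (Poly b) (RatFun b) (Denom b q) = posProd b q (q : ℂ)⁻¹ := by
  rw [Denom, map_prod, posProd]
  refine Finset.prod_congr (by congr) fun k hk => ?_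
  have hk' : b.IsPos k := by simpa using hk
  rw [rootFactor_eq_algebraMap hk']
  congr 3
  have h0 : 0 < (b.height k).toNat := by
    have := (b.isPos_iff).1 hk'
    omega
  have hq0 : (q : ℂ) ≠ 0 := by
    exact_mod_cast (by omega : q ≠ 0)
  obtain ⟨n, hn⟩ := Nat.exists_eq_succ_of_ne_zero h0.ne'
  rw [hn, Nat.succ_sub_one, pow_succ]
  field_simp

lemma isEven_prod {hsl : b.cartanMatrix.IsSimplyLaced} {α : Type*} (s : Finset α)
    (f : α → RatFun b) (h : ∀ a ∈ s, IsEven hsl (f a)) : IsEven hsl (∏ a ∈ s, f a) := by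
  intro i
  rw [map_prod]
  exact Finset.prod_congr rfl fun a ha => h a ha i

lemma isEven_posProd (hsl : b.cartanMatrix.IsSimplyLaced) (hq : 1 < q) (c : ℂ) :
    IsEven hsl (posProd b q c) :=
  isEven_prod _ _ fun k _ => isEven_rootFactor hsl hq c k

lemma posProd_ne_zero (hq : 1 < q) (c : ℂ) : posProd b q c ≠ 0 :=
  Finset.prod_ne_zero_iff.2 fun k _ => rootFactor_ne_zero hq c k

/-- The effect of a simple reflection on a product over positive roots: only the factor of the simple
root changes. -/
lemma reflHom_posProd (hsl : b.cartanMatrix.IsSimplyLaced) (hq : 1 < q) (c : ℂ) (i : b.support) :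
    reflHom hsl hq i (posProd b q c) * rootFactor b q c i =
      (1 - algebraMap ℂ (RatFun b) c * (yVar b q i ^ 2)⁻¹) * posProd b q c := by
  have hmem : (i : ι) ∈ Finset.univ.filter fun k => b.IsPos k := by simp [simple_isPos]
  have h1 : posProd b q c = rootFactor b q c i *
      ∏ k ∈ (Finset.univ.filter fun k => b.IsPos k).erase i, rootFactor b q c k :=
    (Finset.mul_prod_erase _ _ hmem).symm
  have h2 : reflHom hsl hq i
      (∏ k ∈ (Finset.univ.filter fun k => b.IsPos k).erase i, rootFactor b q c k) =
      ∏ k ∈ (Finset.univ.filter fun k => b.IsPos k).erase i, rootFactor b q c k := by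
    rw [map_prod]
    have hinv : ∀ k : ι, simpleRefl b i • simpleRefl b i • k = k := fun k => by
      rw [← mul_smul, simpleRefl_mul_self, one_smul]
    have hmaps : ∀ k ∈ (Finset.univ.filter fun k => b.IsPos k).erase (i : ι),
        simpleRefl b i • k ∈ (Finset.univ.filter fun k => b.IsPos k).erase (i : ι) := by
      intro k hk
      simp only [Finset.mem_erase, Finset.mem_filter, Finset.mem_univ, true_and] at hk ⊢
      refine ⟨fun h => ?_, isPos_simpleRefl_smul hk.2 hk.1⟩
      refine not_isPos_of_root_eq_neg (k := (i : ι)) (k' := k) ?_ (simple_isPos b i) hk.2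
      rw [← hinv k, h, root_smul]
      simp
    refine Finset.prod_bij' (fun k _ => simpleRefl b i • k) (fun k _ => simpleRefl b i • k)
      hmaps hmaps (fun k _ => hinv k) (fun k _ => hinv k) (fun k _ => ?_)
    rw [reflHom_rootFactor]
  have h3 : reflHom hsl hq i (rootFactor b q c i) =
      1 - algebraMap ℂ (RatFun b) c * (yVar b q i ^ 2)⁻¹ := by
    rw [rootFactor_simple, map_sub, map_mul, map_pow, map_one, AlgHom.commutes,
      reflHom_yVar_self, inv_pow]
  rw [h1, map_mul, h2, h3]
  ring

lemma reflHom_posProd_one (hsl : b.cartanMatrix.IsSimplyLaced) (hq : 1 < q) (i : b.support) :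
    reflHom hsl hq i (posProd b q 1) * yVar b q i ^ 2 = -posProd b q 1 := by
  have h := reflHom_posProd hsl hq 1 i
  have h0 := rootFactor_ne_zero (b := b) hq 1 (i : ι)
  have hy := yVar_ne_zero b hq i
  rw [rootFactor_simple, map_one, one_mul, one_mul] at *
  apply mul_right_cancel₀ h0
  rw [mul_right_comm, h]
  field_simp
  ring

/-- The `p`-part is the average of `Δ⁻¹` under the twisted action. -/
lemma pPart_eq_finsum (hsl : b.cartanMatrix.IsSimplyLaced) (hq : 1 < q) (l : b.support → ℕ) :
    pPart b q l = ∑ᶠ w : P.weylGroup, slash b q l (posProd b q 1)⁻¹ w := by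
  haveI := Fintype.ofFinite P.weylGroup
  rw [pPart, finsum_eq_sum_of_fintype, finsum_eq_sum_of_fintype, Finset.mul_sum]
  refine Finset.sum_congr rfl fun w _ => ?_
  have hΔ := posProd_ne_zero (b := b) hq 1
  have hev : IsEven hsl (posProd b q 1)⁻¹ := fun i => by
    rw [map_inv₀, isEven_posProd hsl hq]
  have h1 := foldl_slashSimple_mul_of_isEven hq l (word b w) hev 1
  rw [mul_one] at h1
  have h2 : ∀ (L : List b.support) (g : RatFun b),
      L.foldl (fun g i => subst b (sigmaX b q i) g) g⁻¹ =
        (L.foldl (fun g i => subst b (sigmaX b q i) g) g)⁻¹ := by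
    intro L
    induction L with
    | nil => intro g; rfl
    | cons i L ih =>
      intro g
      simp only [List.foldl_cons]
      rw [subst_sigmaX hsl hq, map_inv₀, ih, subst_sigmaX hsl hq]
  have h3 : slash b q l (posProd b q 1)⁻¹ w = _ := h1
  rw [h3, jFactor, compW, algebraMap_Delta, h2, slash, ← mul_assoc, div_eq_mul_inv,
    inv_mul_cancel_left₀ hΔ]

/-- The `p`-part is invariant under the twisted action. -/
theorem slashSimple_pPart (hsl : b.cartanMatrix.IsSimplyLaced) (hq : 1 < q) (l : b.support → ℕ)
    (i : b.support) : slashSimple b q l (pPart b q l) i = pPart b q l := by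
  haveI := Fintype.ofFinite P.weylGroup
  rw [pPart_eq_finsum hsl hq, finsum_eq_sum_of_fintype, slashSimple_sum hsl hq]
  rw [← Equiv.sum_comp (Equiv.mulRight (simpleRefl b i))]
  refine Finset.sum_congr rfl fun w _ => ?_
  rw [Equiv.coe_mulRight, slash_mul_simpleRefl hsl hq, slashSimple_slashSimple hsl hq]

/-- The algebra of polynomials in the monomials of the roots inverted by `w`. -/
def inversionAlg (b : P.Base) (q : ℕ) (w : P.weylGroup) : Subalgebra ℂ (RatFun b) :=
  Algebra.adjoin ℂ ((fun k => mono b q (rootCoords b k)) '' (inversionSet b w : Set ι))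

lemma mono_mem_inversionAlg {w : P.weylGroup} {k : ι} (h : k ∈ inversionSet b w) :
    mono b q (rootCoords b k) ∈ inversionAlg b q w :=
  Algebra.subset_adjoin ⟨k, h, rfl⟩

lemma reflHom_mem_inversionAlg (hsl : b.cartanMatrix.IsSimplyLaced) (hq : 1 < q) {w : P.weylGroup}
    {i : b.support} (h : b.IsPos (w • (i : ι))) {n : RatFun b} (hn : n ∈ inversionAlg b q w) :
    reflHom hsl hq i n ∈ inversionAlg b q (w * simpleRefl b i) := by
  have hle : inversionAlg b q w ≤
      (inversionAlg b q (w * simpleRefl b i)).comap (reflHom hsl hq i) := by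
    rw [inversionAlg, Algebra.adjoin_le_iff]
    rintro _ ⟨k, hk, rfl⟩
    simp only [Subalgebra.coe_comap, Set.mem_preimage, SetLike.mem_coe]
    rw [reflHom_mono, ← rootCoords_simpleRefl_smul]
    apply mono_mem_inversionAlg
    rw [inversionSet_mul_simpleRefl h]
    exact Finset.mem_insert_of_mem (Finset.mem_image_of_mem _ hk)
  exact hle hn

lemma neg_one_zpow_mem (A : Subalgebra ℂ (RatFun b)) (n : ℤ) : (-1 : RatFun b) ^ n ∈ A := by
  rcases Int.even_or_odd n with h | h
  · rw [h.neg_one_zpow]; exact A.one_mem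
  · rw [h.neg_one_zpow]; exact A.neg_mem A.one_mem

lemma signHom_mem_inversionAlg (hsl : b.cartanMatrix.IsSimplyLaced) (hq : 1 < q) {w : P.weylGroup}
    {i : b.support} {n : RatFun b} (hn : n ∈ inversionAlg b q w) :
    signHom hsl i n ∈ inversionAlg b q w := by
  have hle : inversionAlg b q w ≤ (inversionAlg b q w).comap (signHom hsl i) := by
    rw [inversionAlg, Algebra.adjoin_le_iff]
    rintro _ ⟨k, hk, rfl⟩
    simp only [Subalgebra.coe_comap, Set.mem_preimage, SetLike.mem_coe]
    rw [signHom_mono hsl hq]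
    exact Subalgebra.mul_mem _ (neg_one_zpow_mem _ _) (mono_mem_inversionAlg hk)
  exact hle hn

lemma sqrtQ_mem (A : Subalgebra ℂ (RatFun b)) : sqrtQ b q ∈ A := A.algebraMap_mem _

lemma rootFactor_inv_q (hq : 1 < q) (i : b.support) :
    rootFactor b q (q : ℂ)⁻¹ i =
      (sqrtQ b q - yVar b q i) * (sqrtQ b q + yVar b q i) * ((sqrtQ b q)⁻¹) ^ 2 := by
  have hs := sqrtQ_ne_zero b hq
  have hss := sqrtQ_mul_self b q
  have h : algebraMap ℂ (RatFun b) (q : ℂ)⁻¹ = (sqrtQ b q * sqrtQ b q)⁻¹ := by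
    rw [map_inv₀, map_natCast, hss]
  rw [rootFactor_simple, h]
  field_simp
  ring

/-- The term of `w` in the average of `Δ⁻¹`: its denominator is `Δ` times the product of the
`1 - q⁻¹ y^{2α}` over the roots inverted by `w`, and its numerator is divisible by the monomial of the
vertex `θ - w⁻¹ θ`. -/
lemma exists_slash_inv_eq (hsl : b.cartanMatrix.IsSimplyLaced) (hq : 1 < q) (l : b.support → ℕ)
    (w : P.weylGroup) : ∃ n ∈ inversionAlg b q w,
      posProd b q 1 * slash b q l (posProd b q 1)⁻¹ w *
        ∏ k ∈ inversionSet b w, rootFactor b q (q : ℂ)⁻¹ k = mono b q (vertex b l w) * n := by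
  have hΔ := posProd_ne_zero (b := b) hq 1
  refine weylGroup_induction_of_isPos b (p := fun w => ∃ n ∈ inversionAlg b q w,
      posProd b q 1 * slash b q l (posProd b q 1)⁻¹ w *
        ∏ k ∈ inversionSet b w, rootFactor b q (q : ℂ)⁻¹ k = mono b q (vertex b l w) * n) ?_ ?_ w
  · refine ⟨1, Subalgebra.one_mem _, ?_⟩
    rw [slash_one hsl hq, inversionSet_one, vertex_one, mono_zero, mul_inv_cancel₀ hΔ]
    simp
  · rintro w i hpos ⟨n, hn, h⟩
    set g := slash b q l (posProd b q 1)⁻¹ w with hg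
    set Dw := ∏ k ∈ inversionSet b w, rootFactor b q (q : ℂ)⁻¹ k with hDw
    set v := vertex b l w with hv
    have hy := yVar_ne_zero b hq i
    have hs := sqrtQ_ne_zero b hq
    have hsy : sqrtQ b q - yVar b q i ≠ 0 := by
      have := sqrtQ_sub_ne_zero (b := b) hq (single_one_ne_zero i)
      rwa [mono_single, zpow_one] at this
    have hevD : IsEven hsl Dw := isEven_prod _ _ fun k _ => isEven_rootFactor hsl hq _ k
    -- applying the substitutions to the relation for `w`
    have h1 := congrArg (reflHom hsl hq i) h
    have h2 := congrArg (fun f => reflHom hsl hq i (signHom hsl i f)) h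
    simp only [map_mul, hevD i, isEven_posProd hsl hq 1 i, signHom_mono hsl hq, reflHom_mono,
      map_zpow₀, map_neg, map_one] at h1 h2
    have hΔi := reflHom_posProd_one hsl hq i
    have hD : ∏ k ∈ inversionSet b (w * simpleRefl b i), rootFactor b q (q : ℂ)⁻¹ k =
        rootFactor b q (q : ℂ)⁻¹ i * reflHom hsl hq i Dw := by
      rw [inversionSet_mul_simpleRefl hpos, Finset.prod_insert, Finset.prod_image, hDw, map_prod]
      · simp only [reflHom_rootFactor]
      · intro a _ c _ hac
        exact MulAction.injective (simpleRefl b i) hac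
      · rw [Finset.mem_image]
        rintro ⟨k, hk, hki⟩
        exact simple_notMem_image_inversionSet k hk hki
    have hvert : mono b q (vertex b l (w * simpleRefl b i)) =
        mono b q (coordRefl b i v) * (yVar b q i ^ ((l i : ℤ) - 1) * yVar b q i ^ 2) := by
      rw [vertex_mul_simpleRefl, dotRefl, mono_add hq, mono_single]
      congr 1
      rw [← zpow_natCast (yVar b q i) 2, ← zpow_add₀ hy]
      congr 1
      push_cast
      ring
    set y := yVar b q i with hyd
    set s := sqrtQ b q with hsd
    set ε : RatFun b := (-1) ^ simplePairing b i v with hε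
    refine ⟨-((s⁻¹) ^ 2 * (s + y) * (2 : RatFun b)⁻¹ *
      ((s - 1) * (1 + y) * reflHom hsl hq i n +
        (-1) ^ l i * ε * ((s + 1) * (y - 1) * reflHom hsl hq i (signHom hsl i n)))), ?_, ?_⟩
    · set A := inversionAlg b q (w * simpleRefl b i) with hA
      have my : y ∈ A := by
        have := mono_mem_inversionAlg (q := q) (k := (i : ι)) (w := w * simpleRefl b i) (b := b) (by
          rw [inversionSet_mul_simpleRefl hpos]
          exact Finset.mem_insert_self _ _)
        rwa [rootCoords_simple, mono_single, zpow_one] at this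
      have ms : s ∈ A := sqrtQ_mem A
      have msi : s⁻¹ ∈ A := by
        have := A.algebraMap_mem ((((√(q : ℝ) : ℝ) : ℂ))⁻¹)
        rwa [map_inv₀] at this
      have m2 : (2 : RatFun b)⁻¹ ∈ A := by
        have := A.algebraMap_mem ((2 : ℂ)⁻¹)
        rwa [map_inv₀, map_ofNat] at this
      have m1 : (-1 : RatFun b) ^ l i ∈ A := by
        have := neg_one_zpow_mem A (l i)
        rwa [zpow_natCast] at this
      have mε : ε ∈ A := neg_one_zpow_mem A _
      have mn := reflHom_mem_inversionAlg hsl hq hpos hn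
      have mn' := reflHom_mem_inversionAlg hsl hq hpos
        (signHom_mem_inversionAlg (i := i) hsl hq hn)
      have m11 := A.one_mem
      refine A.neg_mem (A.mul_mem (A.mul_mem (A.mul_mem (A.pow_mem msi 2) (A.add_mem ms my)) m2)
        (A.add_mem (A.mul_mem (A.mul_mem (A.sub_mem ms m11) (A.add_mem m11 my)) mn)
          (A.mul_mem (A.mul_mem m1 mε)
            (A.mul_mem (A.mul_mem (A.add_mem ms m11) (A.sub_mem my m11)) mn'))))
    · rw [slash_mul_simpleRefl hsl hq, slashSimple_eq hsl hq, hD, rootFactor_inv_q hq, hvert,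
        coeffA, coeffB]
      rw [← hyd, ← hsd, ← hg]
      have e1 : posProd b q 1 * reflHom hsl hq i g * reflHom hsl hq i Dw =
          -(y ^ 2 * (mono b q (coordRefl b i v) * reflHom hsl hq i n)) := by
        linear_combination (reflHom hsl hq i g * reflHom hsl hq i Dw) * hΔi - y ^ 2 * h1
      have e2 : posProd b q 1 * reflHom hsl hq i (signHom hsl i g) * reflHom hsl hq i Dw =
          -(y ^ 2 * (ε * mono b q (coordRefl b i v) * reflHom hsl hq i (signHom hsl i n))) := by
        linear_combination
          (reflHom hsl hq i (signHom hsl i g) * reflHom hsl hq i Dw) * hΔi - y ^ 2 * h2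
      generalize posProd b q 1 = Δ at *
      generalize reflHom hsl hq i Dw = D' at *
      generalize reflHom hsl hq i g = g1 at *
      generalize reflHom hsl hq i (signHom hsl i g) = g2 at *
      generalize reflHom hsl hq i n = n1 at *
      generalize reflHom hsl hq i (signHom hsl i n) = n2 at *
      generalize mono b q (coordRefl b i v) = m at *
      generalize y ^ ((l i : ℤ) - 1) = t at *
      generalize (-1 : RatFun b) ^ l i = ν at *
      have e3 : (s - y) * (s - y)⁻¹ = 1 := mul_inv_cancel₀ hsy
      field_simp
      linear_combination (t * (s + y) * (s - 1) * (1 + y)) * e1 +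
        (t * (s + y) * ν * (s + 1) * (y - 1)) * e2

end Average


/-! ### Coprimality of binomials -/

section Coprime

open MvPolynomial
open scoped Classical

variable {σ : Type*} [Finite σ]

lemma not_dvd_one_sub_of_dvd {R : Type*} [CommRing R] {p u : R} (hp : ¬ IsUnit p) (h : p ∣ 1 - u) :
    ¬ p ∣ u := fun hu => hp (isUnit_of_dvd_one (by simpa using dvd_add h hu))

/-- Two binomials `1 - a x^α` and `1 - c x^β` with non-proportional exponents have no common factor: a
common prime factor would divide a nonzero binomial without the variable `x_i`, hence would not involve
`x_i`, and setting `x_i = 0` shows that it divides `1`. -/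
lemma isRelPrime_binomial {α β : σ →₀ ℕ} {a c : ℂ} (ha : a ≠ 0) (hc : c ≠ 0) {i : σ}
    (hi : α i ≠ 0) (hαβ : β i • α ≠ α i • β) :
    IsRelPrime (1 - monomial α a) (1 - monomial β c : MvPolynomial σ ℂ) := by
  intro d hd hd'
  by_contra hdu
  have hd0 : d ≠ 0 := by
    rintro rfl
    rw [zero_dvd_iff] at hd
    have := congrArg constantCoeff hd
    have hα : α ≠ 0 := fun h => hi (by rw [h]; rfl)
    simp [constantCoeff_monomial, hα] at this
  obtain ⟨p, hp, hpd⟩ := WfDvdMonoid.exists_irreducible_factor hdu hd0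
  have hpp := hp.prime
  have h1 := hpd.trans hd
  have h2 := hpd.trans hd'
  have hu : p ∣ 1 - monomial α a ^ β i :=
    h1.trans (by simpa using sub_dvd_pow_sub_pow 1 (monomial α a : MvPolynomial σ ℂ) (β i))
  have hv : p ∣ 1 - monomial β c ^ α i :=
    h2.trans (by simpa using sub_dvd_pow_sub_pow 1 (monomial β c : MvPolynomial σ ℂ) (α i))
  have huv : p ∣ monomial α a ^ β i - monomial β c ^ α i := by
    have := dvd_sub hv hu
    rwa [sub_sub_sub_cancel_left] at this
  have hX : ¬ p ∣ X i := by
    intro h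
    refine not_dvd_one_sub_of_dvd hp.not_isUnit h1 (h.trans ?_)
    rw [X_dvd_monomial]
    exact Or.inr hi
  -- both powers contain the same power of `x_i`, which can be cancelled
  set γ := (β i • α).erase i with hγ
  set δ := (α i • β).erase i with hδ
  have e1 : (monomial α a : MvPolynomial σ ℂ) ^ β i =
      X i ^ (β i * α i) * monomial γ (a ^ β i) := by
    rw [monomial_pow, X_pow_eq_monomial, monomial_mul, one_mul]
    congr 2
    have := Finsupp.single_add_erase i (β i • α)
    simpa using this.symm
  have e2 : (monomial β c : MvPolynomial σ ℂ) ^ α i =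
      X i ^ (β i * α i) * monomial δ (c ^ α i) := by
    rw [monomial_pow, X_pow_eq_monomial, monomial_mul, one_mul]
    congr 2
    have := Finsupp.single_add_erase i (α i • β)
    rw [mul_comm]
    simpa using this.symm
  rw [e1, e2, ← mul_sub] at huv
  have h3 : p ∣ monomial γ (a ^ β i) - monomial δ (c ^ α i) :=
    (hpp.dvd_or_dvd huv).resolve_left fun h => hX (hpp.dvd_of_dvd_pow h)
  have hγδ : γ ≠ δ := by
    intro h
    apply hαβ
    rw [← Finsupp.single_add_erase i (β i • α), ← Finsupp.single_add_erase i (α i • β), ← hγ, ← hδ,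
      h]
    simp [mul_comm]
  have hr0 : monomial γ (a ^ β i) - monomial δ (c ^ α i) ≠ 0 := by
    intro h
    have := congrArg (coeff γ) h
    rw [coeff_sub, coeff_monomial, coeff_monomial, if_pos rfl, if_neg hγδ.symm, sub_zero,
      coeff_zero] at this
    exact pow_ne_zero _ ha this
  have hdeg : degreeOf i p = 0 := by
    obtain ⟨r, hr⟩ := h3
    have hr1 : r ≠ 0 := by
      rintro rfl
      exact hr0 (by rw [hr, mul_zero])
    have h4 : degreeOf i (monomial γ (a ^ β i) - monomial δ (c ^ α i)) = 0 := by
      refine Nat.le_zero.1 ((degreeOf_sub_le i _ _).trans ?_)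
      rw [degreeOf_monomial_eq _ _ (pow_ne_zero _ ha), degreeOf_monomial_eq _ _ (pow_ne_zero _ hc)]
      simp [hγ, hδ]
    rw [hr, degreeOf_mul_eq hp.ne_zero hr1] at h4
    omega
  -- setting `x_i = 0` fixes `p` and sends the first binomial to `1`
  set φ : MvPolynomial σ ℂ →ₐ[ℂ] MvPolynomial σ ℂ := aeval fun j => if j = i then 0 else X j with hφ
  have hφp : φ p = p := by
    have hvars : i ∉ p.vars := fun h => by
      rw [vars_def, Multiset.mem_toFinset, ← Multiset.count_pos, ← degreeOf_def, hdeg] at h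
      exact lt_irrefl _ h
    conv_rhs => rw [← aeval_X_left_apply p]
    rw [hφ]
    refine eval₂Hom_congr' rfl (fun j hj _ => ?_) rfl
    rw [if_neg]
    rintro rfl
    exact hvars hj
  have h5 := map_dvd φ h1
  have h6 : (α.prod fun j k => (if j = i then 0 else X j : MvPolynomial σ ℂ) ^ k) = 0 :=
    Finset.prod_eq_zero (Finsupp.mem_support_iff.2 hi) (by simp [zero_pow hi])
  rw [hφp, map_sub, map_one, hφ, aeval_monomial, h6, mul_zero, sub_zero] at h5
  exact hp.not_isUnit (isUnit_of_dvd_one h5)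

lemma isRelPrime_binomial_self {α : σ →₀ ℕ} {a c : ℂ} (hac : a ≠ c) :
    IsRelPrime (1 - monomial α a) (1 - monomial α c : MvPolynomial σ ℂ) := by
  intro d hd hd'
  have h : d ∣ C (c - a) := by
    have := dvd_sub (hd.mul_left (C c)) (hd'.mul_left (C a))
    rw [mul_sub, mul_sub, C_mul_monomial, C_mul_monomial, mul_comm a c, mul_one, mul_one,
      sub_sub_sub_cancel_right, ← C_sub] at this
    exact this
  exact isUnit_of_dvd_unit h ((sub_ne_zero.2 hac.symm).isUnit.map C)

lemma isRelPrime_monomial {γ : σ →₀ ℕ} {c : ℂ} (hc : c ≠ 0) {u : MvPolynomial σ ℂ}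
    (hu : constantCoeff u = 1) : IsRelPrime (monomial γ c) u := by
  have : Fintype σ := Fintype.ofFinite σ
  rw [monomial_eq, Finsupp.prod_fintype _ _ (by simp)]
  refine IsRelPrime.mul_left ?_ (IsRelPrime.prod_left fun j _ => IsRelPrime.pow_left ?_)
  · exact (hc.isUnit.map C).isRelPrime_left
  · rw [(MvPolynomial.X_prime (R := ℂ)).irreducible.isRelPrime_iff_not_dvd]
    rintro ⟨r, hr⟩
    rw [hr] at hu
    simp at hu

end Coprime

/-! ### The average has a polynomial numerator -/

section Polynomiality

open RootPairing MvPolynomial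
open scoped Classical

variable {ι M N : Type*} [Fintype ι] [AddCommGroup M] [Module ℝ M] [AddCommGroup N] [Module ℝ N]
variable {P : RootPairing ι ℝ M N} [P.IsRootSystem] [P.IsCrystallographic] [P.IsReduced]
variable {b : P.Base} {q : ℕ}

/-- The binomial `1 - c q^{d(α)} x^{2α} = 1 - c y^{2α}` of a positive root as a polynomial. -/
def rootPoly (b : P.Base) (q : ℕ) (c : ℂ) (k : ι) : Poly b :=
  1 - monomial (2 • rootExponent b k) (c * (q : ℂ) ^ (b.height k).toNat)

lemma rootExponent_ne_zero {k : ι} (hk : b.IsPos k) : rootExponent b k ≠ 0 := by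
  intro h
  apply rootCoords_ne_zero b k
  funext j
  rw [← rootExponent_eq hk, h]
  rfl

lemma constantCoeff_rootPoly {k : ι} (hk : b.IsPos k) (c : ℂ) :
    constantCoeff (rootPoly b q c k) = 1 := by
  rw [rootPoly, map_sub, map_one, constantCoeff_monomial, if_neg, sub_zero]
  exact smul_ne_zero two_ne_zero (rootExponent_ne_zero hk)

/-- The factors of `Δ` and `D`, and those of `Δ` at distinct positive roots, are coprime: distinct positive
roots of a reduced root system are not proportional. -/
lemma isRelPrime_rootPoly (hq : 1 < q) {k k' : ι} (hk : b.IsPos k) (hk' : b.IsPos k') {c : ℂ}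
    (hc : c ≠ 0) (h : k' = k → c ≠ 1) : IsRelPrime (rootPoly b q c k') (rootPoly b q 1 k) := by
  have hq0 : (q : ℂ) ≠ 0 := by exact_mod_cast (by omega : q ≠ 0)
  by_cases hkk : k' = k
  · subst hkk
    refine isRelPrime_binomial_self fun h' => h rfl ?_
    exact mul_right_cancel₀ (pow_ne_zero _ hq0) h'
  · obtain ⟨i, hi⟩ : ∃ i, rootExponent b k' i ≠ 0 := by
      by_contra! hcon
      exact rootExponent_ne_zero hk' (Finsupp.ext hcon)
    refine isRelPrime_binomial (mul_ne_zero hc (pow_ne_zero _ hq0))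
      (mul_ne_zero one_ne_zero (pow_ne_zero _ hq0)) (i := i) (by simpa using hi) ?_
    intro heq
    refine hkk (eq_of_smul_rootCoords_eq (m := rootCoords b k' i) (n := rootCoords b k i)
      hk hk' ?_ ?_).symm
    · rw [← rootExponent_eq hk']
      exact_mod_cast hi
    · funext j
      have h := DFunLike.congr_fun heq j
      simp only [Finsupp.smul_apply, smul_eq_mul] at h
      simp only [Pi.smul_apply, smul_eq_mul, ← rootExponent_eq hk, ← rootExponent_eq hk']
      norm_cast
      nlinarith

lemma mono_mem_range {v : b.support → ℤ} (hv : 0 ≤ v) :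
    ∃ p : Poly b, algebraMap (Poly b) (RatFun b) p = mono b q v := by
  obtain ⟨k, rfl⟩ := exists_nat_of_nonneg hv
  exact ⟨_, (mono_natCast k).symm⟩

lemma inversionAlg_le_range (w : P.weylGroup) {n : RatFun b} (hn : n ∈ inversionAlg b q w) :
    ∃ p : Poly b, algebraMap (Poly b) (RatFun b) p = n := by
  have hle : inversionAlg b q w ≤ (IsScalarTower.toAlgHom ℂ (Poly b) (RatFun b)).range := by
    rw [inversionAlg, Algebra.adjoin_le_iff]
    rintro _ ⟨k, hk, rfl⟩
    exact mono_mem_range (rootCoords_nonneg (mem_inversionSet.1 hk).1)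
  exact hle hn

lemma constantCoeff_prod_rootPoly (s : Finset ι) (hs : ∀ k ∈ s, b.IsPos k) (c : ℂ) :
    constantCoeff (∏ k ∈ s, rootPoly b q c k) = 1 := by
  rw [map_prod]
  exact Finset.prod_eq_one fun k hk => constantCoeff_rootPoly (hs k hk) c

lemma algebraMap_prod_rootPoly (s : Finset ι) (hs : ∀ k ∈ s, b.IsPos k) (c : ℂ) :
    algebraMap (Poly b) (RatFun b) (∏ k ∈ s, rootPoly b q c k) = ∏ k ∈ s, rootFactor b q c k := by
  rw [map_prod]
  exact Finset.prod_congr rfl fun k hk => (rootFactor_eq_algebraMap (hs k hk) c).symm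

lemma exists_term_eq_algebraMap (hsl : b.cartanMatrix.IsSimplyLaced) (hq : 1 < q)
    (l : b.support → ℕ) (w : P.weylGroup) : ∃ H : Poly b,
      posProd b q 1 * slash b q l (posProd b q 1)⁻¹ w * posProd b q (q : ℂ)⁻¹ =
        algebraMap (Poly b) (RatFun b) H ∧ constantCoeff H = if w = 1 then 1 else 0 := by
  have hsub : inversionSet b w ⊆ Finset.univ.filter fun k => b.IsPos k := by
    intro k hk
    simpa using (mem_inversionSet.1 hk).1
  have hsplit : posProd b q (q : ℂ)⁻¹ = (∏ k ∈ inversionSet b w, rootFactor b q (q : ℂ)⁻¹ k) *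
      ∏ k ∈ (Finset.univ.filter fun k => b.IsPos k) \ inversionSet b w,
        rootFactor b q (q : ℂ)⁻¹ k := by
    rw [mul_comm, Finset.prod_sdiff hsub]
    rfl
  have hpos : ∀ k ∈ (Finset.univ.filter fun k => b.IsPos k) \ inversionSet b w, b.IsPos k := by
    intro k hk
    simpa using (Finset.mem_sdiff.1 hk).1
  by_cases hw : w = 1
  · subst hw
    refine ⟨∏ k ∈ (Finset.univ.filter fun k => b.IsPos k) \ inversionSet b (1 : P.weylGroup),
      rootPoly b q (q : ℂ)⁻¹ k, ?_, ?_⟩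
    · rw [slash_one hsl hq, mul_inv_cancel₀ (posProd_ne_zero hq 1), one_mul, hsplit,
        algebraMap_prod_rootPoly _ hpos, inversionSet_one]
      simp
    · rw [constantCoeff_prod_rootPoly _ hpos, if_pos rfl]
  · obtain ⟨n, hn, h⟩ := exists_slash_inv_eq hsl hq l w
    obtain ⟨p, hp⟩ := inversionAlg_le_range w hn
    obtain ⟨k, hk⟩ := exists_nat_of_nonneg (vertex_nonneg l hsl w)
    refine ⟨monomial k (((√(q : ℝ) : ℝ) : ℂ) ^ ∑ j, k j) * p *
      ∏ k ∈ (Finset.univ.filter fun k => b.IsPos k) \ inversionSet b w,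
        rootPoly b q (q : ℂ)⁻¹ k, ?_, ?_⟩
    · rw [hsplit, ← mul_assoc, h, map_mul, map_mul, algebraMap_prod_rootPoly _ hpos, hp,
        ← mono_natCast, hk]
    · rw [if_neg hw, map_mul, map_mul, constantCoeff_monomial, if_neg, zero_mul, zero_mul]
      rintro rfl
      exact vertex_ne_zero l hsl hw (by rw [hk]; rfl)

/-- After multiplication by `Δ D` the average is a polynomial with constant term `1`. -/
lemma exists_pPart_mul_eq (hsl : b.cartanMatrix.IsSimplyLaced) (hq : 1 < q) (l : b.support → ℕ) :
    ∃ H : Poly b, posProd b q 1 * pPart b q l * posProd b q (q : ℂ)⁻¹ =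
      algebraMap (Poly b) (RatFun b) H ∧ constantCoeff H = 1 := by
  haveI := Fintype.ofFinite P.weylGroup
  choose H hH hc using exists_term_eq_algebraMap hsl hq l
  refine ⟨∑ w, H w, ?_, ?_⟩
  · rw [pPart_eq_finsum hsl hq, finsum_eq_sum_of_fintype, Finset.mul_sum, Finset.sum_mul, map_sum]
    exact Finset.sum_congr rfl fun w _ => hH w
  · rw [map_sum]
    simp [hc]

/-- The algebra of rational functions whose only poles are along coordinate hyperplanes, along the
divisors `y^{2β} = q` and along the divisors `y^{2β} = 1` for roots `β ≠ ±α`, where `α` is the root of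
index `k`; its elements are regular along `y^{2α} = 1`. -/
def localAlg (b : P.Base) (q : ℕ) (k : ι) : Subalgebra ℂ (RatFun b) :=
  Algebra.adjoin ℂ (Set.range (mono b q) ∪
    (Set.range (fun k' => (rootFactor b q (q : ℂ)⁻¹ k')⁻¹) ∪
      (fun k' => (rootFactor b q 1 k')⁻¹) ''
        {k' | rootCoords b k' ≠ rootCoords b k ∧ rootCoords b k' ≠ -rootCoords b k}))

lemma mono_mem_localAlg (k : ι) (v : b.support → ℤ) : mono b q v ∈ localAlg b q k :=
  Algebra.subset_adjoin (Or.inl ⟨v, rfl⟩)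

lemma rootFactor_inv_mem_localAlg (k k' : ι) :
    (rootFactor b q (q : ℂ)⁻¹ k')⁻¹ ∈ localAlg b q k :=
  Algebra.subset_adjoin (Or.inr (Or.inl ⟨k', rfl⟩))

lemma rootFactor_one_inv_mem_localAlg {k k' : ι} (h : rootCoords b k' ≠ rootCoords b k)
    (h' : rootCoords b k' ≠ -rootCoords b k) : (rootFactor b q 1 k')⁻¹ ∈ localAlg b q k :=
  Algebra.subset_adjoin (Or.inr (Or.inr ⟨k', ⟨h, h'⟩, rfl⟩))

lemma localAlg_eq_of_root_eq_neg {k k' : ι} (h : P.root k' = -P.root k) :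
    localAlg b q k' = localAlg b q k := by
  rw [localAlg, localAlg, rootCoords_of_root_eq_neg h, neg_neg]
  simp only [and_comm]

lemma localAlg_induction {k : ι} {p : RatFun b → Prop} (hmono : ∀ v, p (mono b q v))
    (hD : ∀ k', p (rootFactor b q (q : ℂ)⁻¹ k')⁻¹)
    (hΔ : ∀ k', rootCoords b k' ≠ rootCoords b k → rootCoords b k' ≠ -rootCoords b k →
      p (rootFactor b q 1 k')⁻¹)
    (halg : ∀ c, p (algebraMap ℂ (RatFun b) c))
    (hadd : ∀ f g, f ∈ localAlg b q k → g ∈ localAlg b q k → p f → p g → p (f + g))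
    (hmul : ∀ f g, f ∈ localAlg b q k → g ∈ localAlg b q k → p f → p g → p (f * g))
    {f : RatFun b} (hf : f ∈ localAlg b q k) : p f := by
  refine Algebra.adjoin_induction (p := fun f _ => p f) ?_ halg (fun f g hf hg => hadd f g hf hg)
    (fun f g hf hg => hmul f g hf hg) hf
  rintro _ (⟨v, rfl⟩ | ⟨k', rfl⟩ | ⟨k', ⟨h, h'⟩, rfl⟩)
  · exact hmono v
  · exact hD k'
  · exact hΔ k' h h'

lemma reflHom_mem_localAlg (hsl : b.cartanMatrix.IsSimplyLaced) (hq : 1 < q) (i : b.support)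
    {k : ι} {f : RatFun b} (hf : f ∈ localAlg b q k) :
    reflHom hsl hq i f ∈ localAlg b q (simpleRefl b i • k) := by
  refine localAlg_induction (p := fun f => reflHom hsl hq i f ∈ localAlg b q (simpleRefl b i • k))
    ?_ ?_ ?_ ?_ ?_ ?_ hf
  · intro v
    rw [reflHom_mono]
    exact mono_mem_localAlg _ _
  · intro k'
    rw [map_inv₀, reflHom_rootFactor]
    exact rootFactor_inv_mem_localAlg _ _
  · intro k' h h'
    have hinj : Function.Injective (coordRefl b i) :=
      Function.LeftInverse.injective (g := coordRefl b i) (coordRefl_coordRefl b i)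
    rw [map_inv₀, reflHom_rootFactor]
    apply rootFactor_one_inv_mem_localAlg
    · rw [rootCoords_simpleRefl_smul, rootCoords_simpleRefl_smul]
      exact hinj.ne h
    · rw [rootCoords_simpleRefl_smul, rootCoords_simpleRefl_smul, ← map_neg]
      exact hinj.ne h'
  · intro c
    rw [AlgHom.commutes]
    exact Subalgebra.algebraMap_mem _ _
  · intro f g _ _ hf hg
    rw [map_add]
    exact Subalgebra.add_mem _ hf hg
  · intro f g _ _ hf hg
    rw [map_mul]
    exact Subalgebra.mul_mem _ hf hg

lemma signHom_mem_localAlg (hsl : b.cartanMatrix.IsSimplyLaced) (hq : 1 < q) (i : b.support)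
    {k : ι} {f : RatFun b} (hf : f ∈ localAlg b q k) : signHom hsl i f ∈ localAlg b q k := by
  refine localAlg_induction (p := fun f => signHom hsl i f ∈ localAlg b q k) ?_ ?_ ?_ ?_ ?_ ?_ hf
  · intro v
    rw [signHom_mono hsl hq]
    exact Subalgebra.mul_mem _ (neg_one_zpow_mem _ _) (mono_mem_localAlg _ _)
  · intro k'
    rw [map_inv₀, isEven_rootFactor hsl hq]
    exact rootFactor_inv_mem_localAlg _ _
  · intro k' h h'
    rw [map_inv₀, isEven_rootFactor hsl hq]
    exact rootFactor_one_inv_mem_localAlg h h'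
  · intro c
    rw [AlgHom.commutes]
    exact Subalgebra.algebraMap_mem _ _
  · intro f g _ _ hf hg
    rw [map_add]
    exact Subalgebra.add_mem _ hf hg
  · intro f g _ _ hf hg
    rw [map_mul]
    exact Subalgebra.mul_mem _ hf hg

lemma yVar_mem_localAlg (k : ι) (i : b.support) (n : ℤ) : yVar b q i ^ n ∈ localAlg b q k := by
  rw [← mono_single]
  exact mono_mem_localAlg _ _

lemma inv_two_mem (A : Subalgebra ℂ (RatFun b)) : (2 : RatFun b)⁻¹ ∈ A := by
  have := A.algebraMap_mem ((2 : ℂ)⁻¹)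
  rwa [map_inv₀, map_ofNat] at this

/-- The common denominator of `coeffA` and `coeffB` is invertible in the local algebras. -/
lemma inv_sub_mem_localAlg (hq : 1 < q) (k : ι) (i : b.support) :
    (2 * (sqrtQ b q - yVar b q i))⁻¹ ∈ localAlg b q k := by
  have hs := sqrtQ_ne_zero b hq
  have h0 := rootFactor_ne_zero (b := b) hq (q : ℂ)⁻¹ (i : ι)
  have h1 := rootFactor_inv_q (b := b) hq i
  have hA : sqrtQ b q + yVar b q i ≠ 0 := by
    have := sqrtQ_add_ne_zero (b := b) hq (single_one_ne_zero i)
    rwa [mono_single, zpow_one] at this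
  have hS : sqrtQ b q - yVar b q i ≠ 0 := by
    have := sqrtQ_sub_ne_zero (b := b) hq (single_one_ne_zero i)
    rwa [mono_single, zpow_one] at this
  have h2 : (2 * (sqrtQ b q - yVar b q i))⁻¹ = (2 : RatFun b)⁻¹ *
      ((sqrtQ b q + yVar b q i) * ((sqrtQ b q)⁻¹) ^ 2 * (rootFactor b q (q : ℂ)⁻¹ i)⁻¹) := by
    rw [h1]
    field_simp
  rw [h2]
  have ms : (sqrtQ b q)⁻¹ ∈ localAlg b q k := by
    have := (localAlg b q k).algebraMap_mem ((((√(q : ℝ) : ℝ) : ℂ))⁻¹)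
    rwa [map_inv₀] at this
  have my := yVar_mem_localAlg (q := q) k i 1
  rw [zpow_one] at my
  exact Subalgebra.mul_mem _ (inv_two_mem _) (Subalgebra.mul_mem _ (Subalgebra.mul_mem _
    (Subalgebra.add_mem _ (sqrtQ_mem _) my) (Subalgebra.pow_mem _ ms 2))
    (rootFactor_inv_mem_localAlg _ _))

lemma coeffA_mem_localAlg (hq : 1 < q) (k : ι) (i : b.support) :
    coeffA (sqrtQ b q) (yVar b q i) ∈ localAlg b q k := by
  have my := yVar_mem_localAlg (q := q) k i 1
  rw [zpow_one] at my
  rw [coeffA, div_eq_mul_inv]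
  exact Subalgebra.mul_mem _ (Subalgebra.mul_mem _
    (Subalgebra.sub_mem _ (sqrtQ_mem _) (Subalgebra.one_mem _))
    (Subalgebra.add_mem _ (Subalgebra.one_mem _) my)) (inv_sub_mem_localAlg hq k i)

lemma coeffB_mem_localAlg (hq : 1 < q) (k : ι) (i : b.support) :
    coeffB (sqrtQ b q) (yVar b q i) ∈ localAlg b q k := by
  have my := yVar_mem_localAlg (q := q) k i 1
  rw [zpow_one] at my
  rw [coeffB, div_eq_mul_inv]
  exact Subalgebra.mul_mem _ (Subalgebra.mul_mem _
    (Subalgebra.add_mem _ (sqrtQ_mem _) (Subalgebra.one_mem _))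
    (Subalgebra.sub_mem _ my (Subalgebra.one_mem _))) (inv_sub_mem_localAlg hq k i)

lemma neg_one_pow_mem (A : Subalgebra ℂ (RatFun b)) (n : ℕ) : (-1 : RatFun b) ^ n ∈ A :=
  A.pow_mem (A.neg_mem A.one_mem) n

lemma slashSimple_mem_localAlg (hsl : b.cartanMatrix.IsSimplyLaced) (hq : 1 < q)
    (l : b.support → ℕ) (i : b.support) {k : ι} {f : RatFun b} (hf : f ∈ localAlg b q k) :
    slashSimple b q l f i ∈ localAlg b q (simpleRefl b i • k) := by
  rw [slashSimple_eq hsl hq]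
  exact Subalgebra.mul_mem _ (yVar_mem_localAlg _ _ _) (Subalgebra.add_mem _
    (Subalgebra.mul_mem _ (coeffA_mem_localAlg hq _ i) (reflHom_mem_localAlg hsl hq i hf))
    (Subalgebra.mul_mem _ (neg_one_pow_mem _ _) (Subalgebra.mul_mem _ (coeffB_mem_localAlg hq _ i)
      (reflHom_mem_localAlg hsl hq i (signHom_mem_localAlg hsl hq i hf)))))

/-- `y^n ≡ η^n` modulo `y - η` in a ring where `y` is invertible, for `η = ±1`. -/
lemma exists_zpow_sub_zpow_eq (A : Subalgebra ℂ (RatFun b)) {y η : RatFun b} (hy : y ≠ 0)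
    (hyA : ∀ n : ℤ, y ^ n ∈ A) (hη : η = 1 ∨ η = -1) (n : ℤ) :
    ∃ g ∈ A, y ^ n - η ^ n = (y - η) * g := by
  have hη0 : η ≠ 0 := by rcases hη with rfl | rfl <;> simp
  have hηη : η⁻¹ = η := by rcases hη with rfl | rfl <;> norm_num
  have hηA : ∀ n : ℤ, η ^ n ∈ A := by
    intro n
    rcases hη with rfl | rfl
    · rw [one_zpow]; exact A.one_mem
    · exact neg_one_zpow_mem A n
  have hyi : y⁻¹ ∈ A := by simpa using hyA (-1)
  have hy1 : y ∈ A := by simpa using hyA 1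
  have hη1 : η ∈ A := by simpa using hηA 1
  induction n using Int.induction_on with
  | zero => exact ⟨0, A.zero_mem, by simp⟩
  | succ n ih =>
    obtain ⟨g, hg, h⟩ := ih
    refine ⟨y * g + η ^ (n : ℤ), A.add_mem (A.mul_mem hy1 hg) (hηA _), ?_⟩
    rw [zpow_add_one₀ hy, zpow_add_one₀ hη0]
    linear_combination y * h
  | pred n ih =>
    obtain ⟨g, hg, h⟩ := ih
    refine ⟨y⁻¹ * g - η ^ (-(n : ℤ)) * y⁻¹ * η,
      A.sub_mem (A.mul_mem hyi hg) (A.mul_mem (A.mul_mem (hηA _) hyi) hη1), ?_⟩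
    rw [zpow_sub_one₀ hy, zpow_sub_one₀ hη0, hηη]
    have h2 : y * y⁻¹ = 1 := mul_inv_cancel₀ hy
    have h3 : η * η = 1 := by rcases hη with rfl | rfl <;> norm_num
    linear_combination y⁻¹ * h + η ^ (-(n : ℤ)) * η * h2 - η ^ (-(n : ℤ)) * y⁻¹ * h3

/-- On the divisor `y_i = 1` the substitution `σ_i` is the identity, and on `y_i = -1` it is `ε_i`. -/
lemma exists_reflHom_sub_eq (hsl : b.cartanMatrix.IsSimplyLaced) (hq : 1 < q) (i : b.support)
    {η : RatFun b} (hη : η = 1 ∨ η = -1) (ψ : RatFun b →ₐ[ℂ] RatFun b)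
    (hψ : ∀ v, ψ (mono b q v) = η ^ simplePairing b i v * mono b q v)
    (hψA : ∀ f ∈ localAlg b q (i : ι), ψ f ∈ localAlg b q (i : ι))
    (hψr : ∀ c k, ψ (rootFactor b q c k) = rootFactor b q c k)
    {f : RatFun b} (hf : f ∈ localAlg b q (i : ι)) :
    ∃ g ∈ localAlg b q (i : ι), reflHom hsl hq i f - ψ f = (yVar b q i - η) * g := by
  set A := localAlg b q (i : ι) with hA
  have hy := yVar_ne_zero b hq i
  have hηη : η⁻¹ = η := by rcases hη with rfl | rfl <;> norm_num
  have hkey := exists_zpow_sub_zpow_eq A hy (yVar_mem_localAlg (i : ι) i) hη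
  have hinv : ∀ {g : RatFun b}, g ∈ A → reflHom hsl hq i g ∈ A := by
    intro g hg
    have h := reflHom_mem_localAlg hsl hq i hg
    rwa [localAlg_eq_of_root_eq_neg (k := (i : ι)) (by rw [root_smul]; simp)] at h
  have hmono : ∀ v, ∃ g ∈ A, reflHom hsl hq i (mono b q v) - ψ (mono b q v) =
      (yVar b q i - η) * g := by
    intro v
    obtain ⟨g, hg, h⟩ := hkey (-simplePairing b i v)
    refine ⟨mono b q v * g, A.mul_mem (mono_mem_localAlg _ _) hg, ?_⟩
    rw [reflHom_mono, hψ, coordRefl_apply, mono_sub hq, mono_single, ← zpow_neg]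
    have h4 : η ^ simplePairing b i v = η ^ (-simplePairing b i v) := by
      rw [zpow_neg, ← inv_zpow, hηη]
    rw [h4]
    linear_combination mono b q v * h
  have hfac : ∀ (c : ℂ) (k : ι), (rootFactor b q c k)⁻¹ ∈ A →
      ∃ g ∈ A, reflHom hsl hq i (rootFactor b q c k)⁻¹ - ψ (rootFactor b q c k)⁻¹ =
        (yVar b q i - η) * g := by
    intro c k hk
    obtain ⟨g, hg, h⟩ := hmono (2 • rootCoords b k)
    have hk' := hinv hk
    refine ⟨algebraMap ℂ (RatFun b) c * g * reflHom hsl hq i (rootFactor b q c k)⁻¹ *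
      (rootFactor b q c k)⁻¹, A.mul_mem (A.mul_mem (A.mul_mem (A.algebraMap_mem c) hg) hk') hk, ?_⟩
    have h0 := rootFactor_ne_zero (b := b) hq c k
    have h1 : reflHom hsl hq i (rootFactor b q c k) ≠ 0 := by
      rw [reflHom_rootFactor]
      exact rootFactor_ne_zero hq _ _
    have h2 : reflHom hsl hq i (rootFactor b q c k) - ψ (rootFactor b q c k) =
        -(algebraMap ℂ (RatFun b) c * ((yVar b q i - η) * g)) := by
      rw [← h, rootFactor]
      simp only [map_sub, map_mul, map_one, AlgHom.commutes]
      ring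
    rw [hψr] at h2
    rw [map_inv₀, map_inv₀, hψr]
    field_simp
    linear_combination -h2
  refine localAlg_induction (p := fun f => ∃ g ∈ A, reflHom hsl hq i f - ψ f =
    (yVar b q i - η) * g) hmono ?_ ?_ ?_ ?_ ?_ hf
  · exact fun k => hfac _ k (rootFactor_inv_mem_localAlg _ _)
  · exact fun k h h' => hfac _ k (rootFactor_one_inv_mem_localAlg h h')
  · exact fun c => ⟨0, A.zero_mem, by rw [AlgHom.commutes, AlgHom.commutes]; simp⟩
  · rintro f g - - ⟨f', hf', h⟩ ⟨g', hg', h'⟩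
    refine ⟨f' + g', A.add_mem hf' hg', ?_⟩
    rw [map_add, map_add]
    linear_combination h + h'
  · rintro f g hf hg ⟨f', hf', h⟩ ⟨g', hg', h'⟩
    refine ⟨reflHom hsl hq i f * g' + f' * ψ g,
      A.add_mem (A.mul_mem (hinv hf) hg') (A.mul_mem hf' (hψA g hg)), ?_⟩
    rw [map_mul, map_mul]
    linear_combination reflHom hsl hq i f * h' + ψ g * h

/-- An element divisible by both `y - 1` and `y + 1` is divisible by `1 - y²`. -/
lemma mem_of_mul_one_sub_sq_eq {A : Subalgebra ℂ (RatFun b)} {f y g₁ g₂ : RatFun b}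
    (hy : 1 - y ^ 2 ≠ 0) (hg₁ : g₁ ∈ A) (hg₂ : g₂ ∈ A) (h₁ : 2 * (f * (1 - y ^ 2)) = (y - 1) * g₁)
    (h₂ : 2 * (f * (1 - y ^ 2)) = (y + 1) * g₂) : f ∈ A := by
  have h : f = 2⁻¹ * (2⁻¹ * (g₂ - g₁)) := by
    have e1 : (1 - y) * (1 + y) = 1 - y ^ 2 := by ring
    have h3 : y - 1 ≠ 0 := fun h => hy (by rw [← e1]; linear_combination -(1 + y) * h)
    have h4 : y + 1 ≠ 0 := fun h => hy (by rw [← e1]; linear_combination (1 - y) * h)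
    have h5 : g₁ = 2 * (f * -(y + 1)) := mul_left_cancel₀ h3 (by rw [← h₁]; ring)
    have h6 : g₂ = 2 * (f * -(y - 1)) := mul_left_cancel₀ h4 (by rw [← h₂]; ring)
    rw [h5, h6]
    ring
  rw [h]
  exact A.mul_mem (inv_two_mem A) (A.mul_mem (inv_two_mem A) (A.sub_mem hg₂ hg₁))

lemma algebraMap_mem_localAlg (hq : 1 < q) (k : ι) (H : Poly b) :
    algebraMap (Poly b) (RatFun b) H ∈ localAlg b q k := by
  induction H using MvPolynomial.induction_on with
  | C a => exact Subalgebra.algebraMap_mem _ a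
  | add p r hp hr => rw [map_add]; exact Subalgebra.add_mem _ hp hr
  | mul_X p j hp =>
    rw [map_mul]
    refine Subalgebra.mul_mem _ hp ?_
    have h : algebraMap (Poly b) (RatFun b) (X j) = var b j := rfl
    rw [h, var_eq hq]
    exact Subalgebra.smul_mem _ (mono_mem_localAlg _ _) _

/-- A rational function that is invariant under `|_ℓ σ_i` and has at most a simple pole along
`y_i² = 1` has no pole there: modulo `y_i - 1` and modulo `y_i + 1` the functional equation of
`R = (1 - y_i²) f` reads `R ≡ -R`. -/
lemma mem_localAlg_of_slashSimple_eq (hsl : b.cartanMatrix.IsSimplyLaced) (hq : 1 < q)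
    (l : b.support → ℕ) {f : RatFun b} {i : b.support} (hf : slashSimple b q l f i = f)
    (hmem : f * rootFactor b q 1 i ∈ localAlg b q (i : ι)) : f ∈ localAlg b q (i : ι) := by
  set A := localAlg b q (i : ι) with hA
  set y := yVar b q i with hyd
  set s := sqrtQ b q
  have hy : y ≠ 0 := yVar_ne_zero b hq i
  have hr : rootFactor b q 1 (i : ι) = 1 - y ^ 2 := by rw [rootFactor_simple, map_one, one_mul]
  have hr0 : 1 - y ^ 2 ≠ 0 := by rw [← hr]; exact rootFactor_ne_zero hq _ _
  set S := reflHom hsl hq i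
  set E := signHom hsl i
  have hSy : S y = y⁻¹ := reflHom_yVar_self hsl hq i
  have hEy : E y = y := signHom_yVar_self hsl hq i
  rw [hr] at hmem
  set R := f * (1 - y ^ 2) with hR
  set n : RatFun b := (-1) ^ l i with hn
  have hnn : n * n = 1 := neg_one_pow_mul_self _
  set a := coeffA s y with ha
  set B := coeffB s y with hB
  have hsy : 2 * (s - y) ≠ 0 := by
    have := sqrtQ_sub_ne_zero (b := b) hq (single_one_ne_zero i)
    rw [mono_single, zpow_one] at this
    exact mul_ne_zero two_ne_zero this
  have hκ : (2 * (s - y))⁻¹ ∈ A := inv_sub_mem_localAlg hq _ i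
  have hyA : ∀ n : ℤ, y ^ n ∈ A := yVar_mem_localAlg (i : ι) i
  have hy1 : y ∈ A := by simpa using hyA 1
  have hs : s ∈ A := sqrtQ_mem _
  have hnA : n ∈ A := neg_one_pow_mem _ _
  have haA : a ∈ A := coeffA_mem_localAlg hq _ i
  have hBA : B ∈ A := coeffB_mem_localAlg hq _ i
  have hER : E R ∈ A := signHom_mem_localAlg hsl hq i hmem
  have hSA : ∀ {g : RatFun b}, g ∈ A → S g ∈ A := by
    intro g hg
    have h := reflHom_mem_localAlg hsl hq i hg
    rwa [localAlg_eq_of_root_eq_neg (k := (i : ι)) (by rw [root_smul]; simp)] at h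
  have haB : a = 1 + B := by
    rw [ha, hB, coeffA, coeffB, div_eq_iff hsy, add_mul, div_mul_cancel₀ _ hsy]
    ring
  have ha' : a = (y + 1) * ((s - 1) * (2 * (s - y))⁻¹) := by
    rw [ha, coeffA]
    ring
  have hB' : B = (y - 1) * ((s + 1) * (2 * (s - y))⁻¹) := by
    rw [hB, coeffB]
    ring
  -- the functional equation for `(1 - y²) f`
  have hfe : R = -(y ^ ((l i : ℤ) + 1) * (a * S R + n * (B * S (E R)))) := by
    have h1 : S R = S f * (1 - (y⁻¹) ^ 2) := by
      rw [hR, map_mul, map_sub, map_one, map_pow, hSy]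
    have h2 : S (E R) = S (E f) * (1 - (y⁻¹) ^ 2) := by
      rw [hR, map_mul, map_sub, map_one, map_pow, hEy, map_mul, map_sub, map_one, map_pow, hSy]
    rw [slashSimple_eq hsl hq] at hf
    have h3 : y ^ ((l i : ℤ) + 1) = y ^ ((l i : ℤ) - 1) * y ^ 2 := by
      rw [← zpow_natCast, ← zpow_add₀ hy]
      congr 1
      push_cast
      ring
    have h4 : y ^ 2 * (1 - (y⁻¹) ^ 2) = -(1 - y ^ 2) := by
      field_simp
      ring
    rw [h1, h2, h3, hR]
    linear_combination (-(1 - y ^ 2)) * hf +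
      (y ^ ((l i : ℤ) - 1) * (a * S f + n * (B * S (E f)))) * h4
  obtain ⟨g, hg, h⟩ := exists_reflHom_sub_eq hsl hq i (η := 1) (Or.inl rfl) (AlgHom.id ℂ _)
    (by simp) (fun _ h => h) (fun _ _ => rfl) hmem
  obtain ⟨g', hg', h'⟩ := exists_reflHom_sub_eq hsl hq i (η := -1) (Or.inr rfl) E
    (signHom_mono hsl hq i) (fun _ h => signHom_mem_localAlg hsl hq i h)
    (fun c k => isEven_rootFactor hsl hq c k i) hER
  rw [signHom_signHom] at h'
  rw [AlgHom.id_apply] at h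
  obtain ⟨t, ht, hty⟩ := exists_zpow_sub_zpow_eq A hy hyA (η := 1) (Or.inl rfl) ((l i : ℤ) + 1)
  obtain ⟨t', ht', hty'⟩ := exists_zpow_sub_zpow_eq A hy hyA (η := -1) (Or.inr rfl)
    ((l i : ℤ) + 1)
  have hn' : (-1 : RatFun b) ^ ((l i : ℤ) + 1) = -n := by
    rw [zpow_add_one₀ (by norm_num), zpow_natCast, hn]
    ring
  rw [one_zpow] at hty
  rw [hn'] at hty'
  set Y := y ^ ((l i : ℤ) + 1) with hY
  have hYA : Y ∈ A := hyA _
  have hsum : S R + n * S (E R) ∈ A := A.add_mem (hSA hmem) (A.mul_mem hnA (hSA hER))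
  refine mem_of_mul_one_sub_sq_eq (A := A) (f := f) hr0
    (g₁ := -g - t * S R - Y * ((s + 1) * (2 * (s - y))⁻¹) * (S R + n * S (E R)))
    (g₂ := n * Y * g' + n * t' * R - Y * ((s - 1) * (2 * (s - y))⁻¹) * (S R + n * S (E R)))
    ?_ ?_ ?_ ?_
  · exact A.sub_mem (A.sub_mem (A.neg_mem hg) (A.mul_mem ht (hSA hmem)))
      (A.mul_mem (A.mul_mem hYA (A.mul_mem (A.add_mem hs A.one_mem) hκ)) hsum)
  · exact A.sub_mem (A.add_mem (A.mul_mem (A.mul_mem hnA hYA) hg')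
      (A.mul_mem (A.mul_mem hnA ht') hmem))
      (A.mul_mem (A.mul_mem hYA (A.mul_mem (A.sub_mem hs A.one_mem) hκ)) hsum)
  · rw [← hR]
    rw [haB] at hfe
    linear_combination hfe - h - S R * hty - Y * (S R + n * S (E R)) * hB'
  · rw [← hR]
    have hB2 : B = a - 1 := by rw [haB]; ring
    rw [hB2] at hfe
    linear_combination hfe + n * Y * h' + n * R * hty' - Y * (S R + n * S (E R)) * ha' - R * hnn

lemma pPart_mem_localAlg_simple (hsl : b.cartanMatrix.IsSimplyLaced) (hq : 1 < q)
    (l : b.support → ℕ) (i : b.support) : pPart b q l ∈ localAlg b q (i : ι) := by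
  refine mem_localAlg_of_slashSimple_eq hsl hq l (slashSimple_pPart hsl hq l i) ?_
  obtain ⟨H, hH, -⟩ := exists_pPart_mul_eq hsl hq l
  have hi : (i : ι) ∈ Finset.univ.filter fun k => b.IsPos k := by simpa using simple_isPos b i
  have h1 : posProd b q 1 = rootFactor b q 1 i *
      ∏ k ∈ (Finset.univ.filter fun k => b.IsPos k).erase i, rootFactor b q 1 k :=
    (Finset.mul_prod_erase _ _ hi).symm
  set T := ∏ k ∈ (Finset.univ.filter fun k => b.IsPos k).erase (i : ι), rootFactor b q 1 k
  have hT : T ≠ 0 := Finset.prod_ne_zero_iff.2 fun k _ => rootFactor_ne_zero hq 1 k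
  have hD := posProd_ne_zero (b := b) hq (q : ℂ)⁻¹
  have h2 : pPart b q l * rootFactor b q 1 i =
      algebraMap (Poly b) (RatFun b) H * T⁻¹ * (posProd b q (q : ℂ)⁻¹)⁻¹ := by
    rw [← hH, h1, eq_mul_inv_iff_mul_eq₀ hD, eq_mul_inv_iff_mul_eq₀ hT]
    ring
  rw [h2]
  refine Subalgebra.mul_mem _ (Subalgebra.mul_mem _ (algebraMap_mem_localAlg hq _ H) ?_) ?_
  · rw [← Finset.prod_inv_distrib]
    refine Subalgebra.prod_mem _ fun k hk => ?_
    have hk' := Finset.mem_erase.1 hk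
    have hkpos : b.IsPos k := by simpa using hk'.2
    refine rootFactor_one_inv_mem_localAlg (fun h => hk'.1 ?_) (fun h => ?_)
    · exact eq_of_smul_rootCoords_eq (m := 1) (n := 1) hkpos (simple_isPos b i) one_ne_zero (by
        rw [h])
    · have h3 := rootCoords_nonneg hkpos
      have h4 := rootCoords_nonneg (simple_isPos b i)
      refine rootCoords_ne_zero b k (le_antisymm ?_ h3)
      rw [h]
      exact neg_nonpos.2 h4
  · rw [posProd, ← Finset.prod_inv_distrib]
    exact Subalgebra.prod_mem _ fun k _ => rootFactor_inv_mem_localAlg _ k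

/-- The average has no pole along `y^{2α} = 1` for any root `α`: every root is obtained from a simple one by
reflections, and these leave the average invariant. -/
lemma pPart_mem_localAlg (hsl : b.cartanMatrix.IsSimplyLaced) (hq : 1 < q) (l : b.support → ℕ)
    (k : ι) : pPart b q l ∈ localAlg b q k := by
  refine RootPairing.Base.induction_reflect (b := b) (p := fun k => pPart b q l ∈ localAlg b q k)
    k ?_ ?_ ?_
  · intro k hk
    rwa [localAlg_eq_of_root_eq_neg (k := k) (by simp)]
  · exact fun i hi => pPart_mem_localAlg_simple hsl hq l ⟨i, hi⟩
  · intro k i hk hi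
    have h := slashSimple_mem_localAlg hsl hq l ⟨i, hi⟩ hk
    have h1 : simpleRefl b ⟨i, hi⟩ • k = P.reflectionPerm i k := by
      apply P.root.injective
      rw [root_smul, root_reflectionPerm]
      rfl
    rwa [slashSimple_pPart hsl hq, h1] at h

/-- Elements of the local algebra have a denominator coprime to `1 - y^{2α}`. -/
lemma exists_denominator (hq : 1 < q) {k : ι} (hk : b.IsPos k) {f : RatFun b}
    (hf : f ∈ localAlg b q k) : ∃ n H : Poly b, IsRelPrime n (rootPoly b q 1 k) ∧
      algebraMap (Poly b) (RatFun b) n * f = algebraMap (Poly b) (RatFun b) H := by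
  have hmono : ∀ v, ∃ n H : Poly b, IsRelPrime n (rootPoly b q 1 k) ∧
      algebraMap (Poly b) (RatFun b) n * mono b q v = algebraMap (Poly b) (RatFun b) H := by
    intro v
    obtain ⟨m, hm⟩ := exists_nat_of_nonneg (v := v⁻) (negPart_nonneg v)
    obtain ⟨H, hH⟩ := mono_mem_range (q := q) (posPart_nonneg v)
    refine ⟨monomial m (((√(q : ℝ) : ℝ) : ℂ) ^ ∑ j, m j), H, isRelPrime_monomial
      (pow_ne_zero _ (sqrt_ne_zero hq)) (constantCoeff_rootPoly hk 1), ?_⟩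
    rw [hH, ← mono_natCast, ← hm, ← mono_add hq]
    congr 1
    rw [add_comm]
    exact eq_add_of_sub_eq (posPart_sub_negPart v) |>.symm ▸ rfl
  have hmul : ∀ f g : RatFun b, (∃ n H : Poly b, IsRelPrime n (rootPoly b q 1 k) ∧
      algebraMap (Poly b) (RatFun b) n * f = algebraMap (Poly b) (RatFun b) H) →
      (∃ n H : Poly b, IsRelPrime n (rootPoly b q 1 k) ∧
      algebraMap (Poly b) (RatFun b) n * g = algebraMap (Poly b) (RatFun b) H) →
      ∃ n H : Poly b, IsRelPrime n (rootPoly b q 1 k) ∧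
      algebraMap (Poly b) (RatFun b) n * (f * g) = algebraMap (Poly b) (RatFun b) H := by
    rintro f g ⟨n, H, hn, h⟩ ⟨n', H', hn', h'⟩
    refine ⟨n * n', H * H', hn.mul_left hn', ?_⟩
    rw [map_mul, map_mul, ← h, ← h']
    ring
  have halg : ∀ c : ℂ, ∃ n H : Poly b, IsRelPrime n (rootPoly b q 1 k) ∧
      algebraMap (Poly b) (RatFun b) n * algebraMap ℂ (RatFun b) c =
        algebraMap (Poly b) (RatFun b) H := fun c =>
    ⟨1, C c, isRelPrime_one_left, by rw [map_one, one_mul]; rfl⟩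
  have hfac : ∀ (c : ℂ) (k' : ι), c ≠ 0 →
      ((rootCoords b k' = rootCoords b k ∨ rootCoords b k' = -rootCoords b k) → c ≠ 1 ∧ c⁻¹ ≠ 1) →
      ∃ n H : Poly b, IsRelPrime n (rootPoly b q 1 k) ∧
      algebraMap (Poly b) (RatFun b) n * (rootFactor b q c k')⁻¹ =
        algebraMap (Poly b) (RatFun b) H := by
    intro c k' hc h
    by_cases hk' : b.IsPos k'
    · refine ⟨rootPoly b q c k', 1, isRelPrime_rootPoly hq hk hk' hc
        fun hkk => (h (Or.inl (by rw [hkk]))).1, ?_⟩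
      rw [map_one, rootPoly, ← rootFactor_eq_algebraMap hk', mul_inv_cancel₀
        (rootFactor_ne_zero hq c k')]
    · have hneg : P.root (P.reflectionPerm k' k') = -P.root k' := by simp
      have hpos := isPos_of_root_eq_neg hneg hk'
      set k'' := P.reflectionPerm k' k'
      have hrc := rootCoords_of_root_eq_neg (b := b) hneg
      have h1 : rootFactor b q c k' = algebraMap ℂ (RatFun b) (-c) *
          (mono b q (2 • rootCoords b k') * rootFactor b q c⁻¹ k'') := by
        rw [rootFactor, rootFactor, hrc, smul_neg, mono_neg hq, map_inv₀, map_neg]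
        have h2 := mono_ne_zero (b := b) hq (2 • rootCoords b k')
        have h3 : algebraMap ℂ (RatFun b) c ≠ 0 := by simpa using hc
        field_simp
        ring
      have h2 : (rootFactor b q c k')⁻¹ = algebraMap ℂ (RatFun b) (-c)⁻¹ *
          (mono b q (-(2 • rootCoords b k')) * (rootFactor b q c⁻¹ k'')⁻¹) := by
        rw [h1, mono_neg hq, map_inv₀, mul_inv, mul_inv]
      rw [h2]
      refine hmul _ _ (halg _) (hmul _ _ (hmono _) ?_)
      refine ⟨rootPoly b q c⁻¹ k'', 1, isRelPrime_rootPoly hq hk hpos (inv_ne_zero hc)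
        fun hkk => (h (Or.inr ?_)).2, ?_⟩
      · rw [← hkk, hrc, neg_neg]
      · rw [map_one, rootPoly, ← rootFactor_eq_algebraMap hpos, mul_inv_cancel₀
          (rootFactor_ne_zero hq c⁻¹ k'')]
  have hq0 : (q : ℂ) ≠ 0 := by exact_mod_cast (by omega : q ≠ 0)
  have hq1 : (q : ℂ) ≠ 1 := by exact_mod_cast (by omega : q ≠ 1)
  refine localAlg_induction (p := fun f => ∃ n H : Poly b, IsRelPrime n (rootPoly b q 1 k) ∧
      algebraMap (Poly b) (RatFun b) n * f = algebraMap (Poly b) (RatFun b) H)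
    hmono ?_ ?_ halg ?_ (fun f g _ _ => hmul f g) hf
  · exact fun k' => hfac _ k' (inv_ne_zero hq0)
      fun _ => ⟨fun h => hq1 (inv_eq_one.1 h), by rwa [inv_inv]⟩
  · exact fun k' h h' => hfac 1 k' one_ne_zero fun hcon => absurd hcon (not_or.2 ⟨h, h'⟩)
  · rintro f g - - ⟨n, H, hn, h⟩ ⟨n', H', hn', h'⟩
    refine ⟨n * n', H * n' + n * H', hn.mul_left hn', ?_⟩
    rw [map_mul, map_add, map_mul, map_mul, ← h, ← h']
    ring

/-- The numerator `N(x; ℓ)` is a polynomial with constant term `1`. -/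
lemma exists_numerator_eq (hsl : b.cartanMatrix.IsSimplyLaced) (hq : 1 < q) (l : b.support → ℕ) :
    ∃ Q : Poly b, algebraMap (Poly b) (RatFun b) Q = numerator b q l ∧ Q.coeff 0 = 1 := by
  obtain ⟨H, hH, hH1⟩ := exists_pPart_mul_eq hsl hq l
  have hinj := IsFractionRing.injective (Poly b) (RatFun b)
  have hD := algebraMap_Denom (b := b) hq
  have hΔ : Delta b q = ∏ k : ι with b.IsPos k, rootPoly b q 1 k := by
    apply hinj
    rw [algebraMap_Delta, algebraMap_prod_rootPoly _ (by simp)]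
    rfl
  have hdvd : Delta b q ∣ H := by
    rw [hΔ]
    refine Finset.prod_dvd_of_isRelPrime ?_ ?_
    · intro k hk k' hk' hne
      exact isRelPrime_rootPoly hq (by simpa using hk') (by simpa using hk) one_ne_zero
        fun h => absurd h hne
    · intro k hk
      have hkpos : b.IsPos k := by simpa using hk
      obtain ⟨n, G, hn, h⟩ := exists_denominator hq hkpos (pPart_mem_localAlg hsl hq l k)
      have h1 : n * H = Delta b q * (G * Denom b q) := by
        apply hinj
        rw [map_mul, map_mul, map_mul, ← hH, ← h, hD, algebraMap_Delta]
        ring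
      refine hn.symm.dvd_of_dvd_mul_left (h1 ▸ Dvd.dvd.mul_right ?_ _)
      rw [hΔ]
      exact Finset.dvd_prod_of_mem _ hk
  obtain ⟨Q, rfl⟩ := hdvd
  refine ⟨Q, ?_, ?_⟩
  · rw [map_mul, algebraMap_Delta, mul_assoc] at hH
    rw [← mul_left_cancel₀ (posProd_ne_zero hq 1) hH, numerator, hD]
  · rw [map_mul, hΔ, constantCoeff_prod_rootPoly _ (by simp), one_mul] at hH1
    rwa [← constantCoeff_eq]

end Polynomiality


/-! ### Strings of coefficients -/

section Strings

/-- Two sequences related by the functional equation on a string of even length: if one vanishes in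
negative degrees then so does the other, and the coefficients of degree `0` are proportional. -/
lemma string_even {a a' : ℤ → ℂ} {q : ℂ} (ha : ∀ k < 0, a k = 0) {n : ℤ} (ha' : ∀ k < n, a' k = 0)
    (h : ∀ k, a (k - 2) - a k / q = a' k - a' (k - 2) / q) :
    (∀ k < 0, a' k = 0) ∧ a' 0 = -1 / q * a 0 := by
  have key : ∀ m : ℕ, ∀ k < n + m, k < 0 → a' k = 0 := by
    intro m
    induction m with
    | zero => exact fun k hk _ => ha' k (by simpa using hk)
    | succ m ih =>
      intro k hk hk0
      have h1 := h k
      rw [ha k hk0, ha (k - 2) (by omega), ih (k - 2) (by push_cast at hk; omega) (by omega)] at h1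
      simpa using h1.symm
  have key' : ∀ k < 0, a' k = 0 := fun k hk => key (k + 1 - n).toNat k (by omega) hk
  refine ⟨key', ?_⟩
  have h1 := h 0
  rw [ha (0 - 2) (by norm_num), key' (0 - 2) (by norm_num)] at h1
  linear_combination -h1

/-- The analogue of `string_even` for strings of odd length. -/
lemma string_odd {a a' : ℤ → ℂ} {s : ℂ} (hs : s ≠ 0) (ha : ∀ k < 0, a k = 0) {n : ℤ}
    (ha' : ∀ k < n, a' k = 0)
    (h : ∀ k, a (k - 2) - a k / s ^ 2 =
      (s * a' (k - 2) + (s ^ 2 - 1) * a' (k - 1) - s * a' k) / s ^ 2) :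
    (∀ k < 0, a' k = 0) ∧ a' 0 = 1 / s * a 0 := by
  have key : ∀ m : ℕ, ∀ k < n + m, k < 0 → a' k = 0 := by
    intro m
    induction m with
    | zero => exact fun k hk _ => ha' k (by simpa using hk)
    | succ m ih =>
      intro k hk hk0
      have h1 := h k
      rw [ha k hk0, ha (k - 2) (by omega), ih (k - 2) (by push_cast at hk; omega) (by omega),
        ih (k - 1) (by push_cast at hk; omega) (by omega)] at h1
      simpa [hs] using h1.symm
  have key' : ∀ k < 0, a' k = 0 := fun k hk => key (k + 1 - n).toNat k (by omega) hk
  refine ⟨key', ?_⟩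
  have h1 := h 0
  rw [ha (0 - 2) (by norm_num), key' (0 - 2) (by norm_num), key' (0 - 1) (by norm_num)] at h1
  field_simp at h1 ⊢
  linear_combination h1

end Strings

/-! ### The functional equation on coefficients -/

section Coefficients

open RootPairing MvPolynomial
open scoped Classical

variable {ι M N : Type*} [Fintype ι] [AddCommGroup M] [Module ℝ M] [AddCommGroup N] [Module ℝ N]
variable {P : RootPairing ι ℝ M N} [P.IsRootSystem] [P.IsCrystallographic] [P.IsReduced]
variable {b : P.Base} {q : ℕ}

/-- The Laurent polynomial `∑ c_λ y^λ`. -/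
abbrev laurent (b : P.Base) (q : ℕ) : ((b.support → ℤ) →₀ ℂ) →ₗ[ℂ] RatFun b :=
  Finsupp.linearCombination ℂ (mono b q)

/-- A polynomial in `x` as a Laurent polynomial in `y`. -/
lemma exists_laurent_eq (hq : 1 < q) (Q : Poly b) : ∃ c : (b.support → ℤ) →₀ ℂ,
    laurent b q c = algebraMap (Poly b) (RatFun b) Q ∧ (∀ v, ¬ 0 ≤ v → c v = 0) ∧
      ∀ k : b.support →₀ ℕ, c (fun j => (k j : ℤ)) * ((√(q : ℝ) : ℝ) : ℂ) ^ ∑ j, k j = Q.coeff k := by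
  have hs := sqrt_ne_zero hq
  induction Q using MvPolynomial.induction_on' with
  | monomial k a =>
    refine ⟨Finsupp.single (fun j => (k j : ℤ)) (a * ((((√(q : ℝ) : ℝ) : ℂ)) ^ ∑ j, k j)⁻¹),
      ?_, ?_, ?_⟩
    · rw [laurent, Finsupp.linearCombination_single, mono_natCast, Algebra.smul_def,
        IsScalarTower.algebraMap_apply ℂ (Poly b) (RatFun b), ← map_mul, algebraMap_eq,
        C_mul_monomial, mul_assoc, inv_mul_cancel₀ (pow_ne_zero _ hs), mul_one]
    · intro v hv
      rw [Finsupp.single_apply, if_neg]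
      rintro rfl
      exact hv fun j => by simp
    · intro k'
      rw [coeff_monomial, Finsupp.single_apply]
      by_cases h : k = k'
      · subst h
        rw [if_pos rfl, if_pos rfl, mul_assoc, inv_mul_cancel₀ (pow_ne_zero _ hs), mul_one]
      · rw [if_neg h, if_neg, zero_mul]
        intro h'
        apply h
        ext j
        exact_mod_cast congrFun h' j
  | add p r hp hr =>
    obtain ⟨c, h1, h2, h3⟩ := hp
    obtain ⟨c', h1', h2', h3'⟩ := hr
    refine ⟨c + c', by rw [map_add, map_add, h1, h1'], ?_, ?_⟩
    · intro v hv
      rw [Finsupp.add_apply, h2 v hv, h2' v hv, add_zero]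
    · intro k
      rw [Finsupp.add_apply, add_mul, h3, h3', coeff_add]

variable (l : b.support → ℕ)

/-- The shifted reflection followed by the translation by `t α_i`, as a permutation of the root
lattice. -/
def dotShift (b : P.Base) (l : b.support → ℕ) (i : b.support) (t : ℤ) :
    (b.support → ℤ) ≃ (b.support → ℤ) where
  toFun v := dotRefl b l i v + Pi.single i t
  invFun v := dotRefl b l i (v - Pi.single i t)
  left_inv v := by beta_reduce; rw [add_sub_cancel_right, dotRefl_dotRefl]
  right_inv v := by beta_reduce; rw [dotRefl_dotRefl, sub_add_cancel]

/-- The map on coefficients induced by `dotShift`. -/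
def moveCoeff (b : P.Base) (l : b.support → ℕ) (i : b.support) (t : ℤ) :
    ((b.support → ℤ) →₀ ℂ) →ₗ[ℂ] ((b.support → ℤ) →₀ ℂ) :=
  (Finsupp.domLCongr (dotShift b l i t)).toLinearMap

lemma moveCoeff_single (i : b.support) (t : ℤ) (v : b.support → ℤ) (a : ℂ) :
    moveCoeff b l i t (Finsupp.single v a) =
      Finsupp.single (dotRefl b l i v + Pi.single i t) a :=
  Finsupp.domLCongr_single _ _ _

lemma moveCoeff_apply (i : b.support) (t : ℤ) (c : (b.support → ℤ) →₀ ℂ) (v : b.support → ℤ) :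
    moveCoeff b l i t c v = c (dotRefl b l i (v - Pi.single i t)) := rfl

/-- The coefficients of `(1 - y_i² / q) y_i² (f |_ℓ σ_i)` in terms of those of `f`: the shifted
reflection of the exponent, followed by multiplication with a polynomial in `y_i` that depends on the
parity of the string length. -/
def reflCoeff (b : P.Base) (q : ℕ) (l : b.support → ℕ) (i : b.support)
    (c : (b.support → ℤ) →₀ ℂ) : (b.support → ℤ) →₀ ℂ :=
  (moveCoeff b l i 0 (c.filter fun v => Even (stringLength b l i v)) -
      (((√(q : ℝ) : ℝ) : ℂ) ^ 2)⁻¹ •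
        moveCoeff b l i 2 (c.filter fun v => Even (stringLength b l i v))) +
    ((((√(q : ℝ) : ℝ) : ℂ) / ((√(q : ℝ) : ℝ) : ℂ) ^ 2) •
        moveCoeff b l i 2 (c.filter fun v => ¬ Even (stringLength b l i v)) +
      ((((√(q : ℝ) : ℝ) : ℂ) ^ 2 - 1) / ((√(q : ℝ) : ℝ) : ℂ) ^ 2) •
        moveCoeff b l i 1 (c.filter fun v => ¬ Even (stringLength b l i v)) -
      (((√(q : ℝ) : ℝ) : ℂ) / ((√(q : ℝ) : ℝ) : ℂ) ^ 2) •
        moveCoeff b l i 0 (c.filter fun v => ¬ Even (stringLength b l i v)))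

lemma mono_dotRefl_add_single (hq : 1 < q) (i : b.support) (v : b.support → ℤ) (t : ℤ) :
    mono b q (dotRefl b l i v + Pi.single i t) =
      yVar b q i ^ t * (yVar b q i ^ ((l i : ℤ) + 1) * mono b q (coordRefl b i v)) := by
  rw [dotRefl, mono_add hq, mono_add hq, mono_single, mono_single]
  ring

lemma laurent_reflCoeff (hsl : b.cartanMatrix.IsSimplyLaced) (hq : 1 < q) (i : b.support)
    (c : (b.support → ℤ) →₀ ℂ) :
    laurent b q (reflCoeff b q l i c) = (sqrtQ b q + yVar b q i) / (2 * sqrtQ b q ^ 2) *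
      ((sqrtQ b q - 1) * (1 + yVar b q i) *
        (yVar b q i ^ ((l i : ℤ) + 1) * reflHom hsl hq i (laurent b q c)) +
      (-1) ^ l i * ((sqrtQ b q + 1) * (yVar b q i - 1) *
        (yVar b q i ^ ((l i : ℤ) + 1) * reflHom hsl hq i (signHom hsl i (laurent b q c))))) := by
  have hs := sqrtQ_ne_zero b hq
  induction c using Finsupp.induction_linear with
  | zero => simp [reflCoeff, Finsupp.filter_zero]
  | add c c' h h' =>
    have hadd : reflCoeff b q l i (c + c') = reflCoeff b q l i c + reflCoeff b q l i c' := by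
      simp only [reflCoeff, Finsupp.filter_add, map_add, smul_add]
      abel
    rw [hadd, map_add, h, h']
    simp only [map_add]
    ring
  | single v a =>
    have hsgn : (-1 : RatFun b) ^ l i * (-1) ^ simplePairing b i v =
        -(-1) ^ stringLength b l i v := by
      have h1 : (-1 : RatFun b) ^ simplePairing b i v = ((-1 : RatFun b) ^ simplePairing b i v)⁻¹ := by
        rw [← inv_zpow]
        norm_num
      rw [h1, ← zpow_natCast, ← zpow_neg, ← zpow_add₀ (by norm_num), stringLength,
        show (l i : ℤ) + 1 - simplePairing b i v = l i + -simplePairing b i v + 1 by ring,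
        zpow_add_one₀ (by norm_num)]
      ring
    have hD : ∀ t : ℤ, laurent b q (moveCoeff b l i t (Finsupp.single v a)) =
        algebraMap ℂ (RatFun b) a * (yVar b q i ^ t *
          (yVar b q i ^ ((l i : ℤ) + 1) * mono b q (coordRefl b i v))) := by
      intro t
      rw [moveCoeff_single, laurent, Finsupp.linearCombination_single, Algebra.smul_def,
        ← mono_dotRefl_add_single l hq]
    have hsq : algebraMap ℂ (RatFun b) ((√(q : ℝ) : ℝ) : ℂ) = sqrtQ b q := rfl
    have hR : reflHom hsl hq i (laurent b q (Finsupp.single v a)) =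
        algebraMap ℂ (RatFun b) a * mono b q (coordRefl b i v) := by
      rw [laurent, Finsupp.linearCombination_single, Algebra.smul_def, map_mul, AlgHom.commutes,
        reflHom_mono]
    have hE : reflHom hsl hq i (signHom hsl i (laurent b q (Finsupp.single v a))) =
        algebraMap ℂ (RatFun b) a * ((-1) ^ simplePairing b i v * mono b q (coordRefl b i v)) := by
      rw [laurent, Finsupp.linearCombination_single, Algebra.smul_def, map_mul, AlgHom.commutes,
        signHom_mono hsl hq, map_mul, map_mul, AlgHom.commutes, reflHom_mono, map_zpow₀, map_neg,
        map_one]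
    rw [hR, hE]
    set Y := yVar b q i ^ ((l i : ℤ) + 1) * mono b q (coordRefl b i v) with hY
    have hRHS : (-1) ^ l i * ((sqrtQ b q + 1) * (yVar b q i - 1) *
        (yVar b q i ^ ((l i : ℤ) + 1) * (algebraMap ℂ (RatFun b) a *
          ((-1) ^ simplePairing b i v * mono b q (coordRefl b i v))))) =
        -(-1) ^ stringLength b l i v * ((sqrtQ b q + 1) * (yVar b q i - 1) *
          (algebraMap ℂ (RatFun b) a * Y)) := by
      rw [← hsgn, hY]
      ring
    rw [hRHS]
    by_cases he : Even (stringLength b l i v)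
    · rw [reflCoeff, Finsupp.filter_single_of_pos (fun v => Even (stringLength b l i v)) he,
        Finsupp.filter_single_of_neg (fun v => ¬ Even (stringLength b l i v)) (not_not.2 he)]
      simp only [map_zero, smul_zero, map_add, map_sub, map_smul, hD, Algebra.smul_def, map_inv₀,
        map_pow, hsq, he.neg_one_zpow, zpow_ofNat]
      field_simp
      ring
    · rw [reflCoeff, Finsupp.filter_single_of_neg (fun v => Even (stringLength b l i v)) he,
        Finsupp.filter_single_of_pos (fun v => ¬ Even (stringLength b l i v)) he]
      simp only [map_zero, smul_zero, map_add, map_sub, map_smul, hD, Algebra.smul_def,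
        map_div₀, map_sub, map_one, map_pow, hsq, (Int.not_even_iff_odd.1 he).neg_one_zpow,
        zpow_ofNat]
      field_simp
      ring

/-- The functional equation of `∑ c_λ y^λ / D` under `σ_i`, as a recursion for the `c_λ`. -/
lemma coeff_functional_equation (hsl : b.cartanMatrix.IsSimplyLaced) (hq : 1 < q) {i : b.support}
    {c : (b.support → ℤ) →₀ ℂ}
    (h : slashSimple b q l (laurent b q c / posProd b q (q : ℂ)⁻¹) i =
      laurent b q c / posProd b q (q : ℂ)⁻¹) (v : b.support → ℤ) :
    c (v - Pi.single i 2) - c v / (((√(q : ℝ) : ℝ) : ℂ)) ^ 2 = reflCoeff b q l i c v := by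
  have hs := sqrtQ_ne_zero b hq
  have hy := yVar_ne_zero b hq i
  have hss := sqrtQ_mul_self b q
  have hsq : algebraMap ℂ (RatFun b) ((√(q : ℝ) : ℝ) : ℂ) = sqrtQ b q := rfl
  have hD := posProd_ne_zero (b := b) hq (q : ℂ)⁻¹
  set D := posProd b q (q : ℂ)⁻¹ with hDdef
  have hEven : IsEven hsl D⁻¹ := fun j => by rw [map_inv₀, isEven_posProd hsl hq _ j]
  have hqa : algebraMap ℂ (RatFun b) (q : ℂ)⁻¹ = (sqrtQ b q ^ 2)⁻¹ := by
    rw [map_inv₀, map_natCast, ← hss, sq]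
  have hrefl := reflHom_posProd hsl hq (q : ℂ)⁻¹ i
  rw [← hDdef, rootFactor_simple, hqa] at hrefl
  have hrf : sqrtQ b q - yVar b q i ≠ 0 := by
    have := sqrtQ_sub_ne_zero (b := b) hq (single_one_ne_zero i)
    rwa [mono_single, zpow_one] at this
  have hSD : reflHom hsl hq i D ≠ 0 := (map_ne_zero _).2 hD
  rw [div_eq_inv_mul, slashSimple_mul_of_isEven hEven hq, map_inv₀, slashSimple_eq hsl hq] at h
  -- multiplication by `y_i²` translates the coefficients
  have hshift : ∀ c : (b.support → ℤ) →₀ ℂ,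
      laurent b q (Finsupp.domLCongr (R := ℂ) (M := ℂ) (Equiv.addRight (Pi.single i 2)) c) =
        yVar b q i ^ 2 * laurent b q c := by
    intro c
    induction c using Finsupp.induction_linear with
    | zero => simp
    | add c c' h h' => rw [map_add, map_add, map_add, h, h', mul_add]
    | single v a =>
      rw [Finsupp.domLCongr_single, laurent, Finsupp.linearCombination_single,
        Finsupp.linearCombination_single, Equiv.coe_addRight, mono_add hq, mono_single,
        Algebra.smul_def, Algebra.smul_def, zpow_ofNat]
      ring
  have hlin : laurent b q (Finsupp.domLCongr (R := ℂ) (M := ℂ) (Equiv.addRight (Pi.single i 2)) c -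
      (((((√(q : ℝ) : ℝ) : ℂ)) ^ 2)⁻¹) • c) = laurent b q (reflCoeff b q l i c) := by
    rw [map_sub, map_smul, hshift, laurent_reflCoeff l hsl hq, Algebra.smul_def, map_inv₀, map_pow,
      hsq]
    have hYy : yVar b q i ^ ((l i : ℤ) + 1) = yVar b q i ^ ((l i : ℤ) - 1) * yVar b q i ^ 2 := by
      rw [← zpow_natCast, ← zpow_add₀ hy]
      congr 1
      push_cast
      ring
    rw [hYy]
    have hA : (1 - (sqrtQ b q ^ 2)⁻¹ * yVar b q i ^ 2) * coeffA (sqrtQ b q) (yVar b q i) =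
        (sqrtQ b q + yVar b q i) / (2 * sqrtQ b q ^ 2) * ((sqrtQ b q - 1) * (1 + yVar b q i)) := by
      rw [coeffA]
      field_simp
      ring
    have hB : (1 - (sqrtQ b q ^ 2)⁻¹ * yVar b q i ^ 2) * coeffB (sqrtQ b q) (yVar b q i) =
        (sqrtQ b q + yVar b q i) / (2 * sqrtQ b q ^ 2) * ((sqrtQ b q + 1) * (yVar b q i - 1)) := by
      rw [coeffB]
      field_simp
      ring
    set y := yVar b q i
    set s := sqrtQ b q
    set T := laurent b q c
    set S := reflHom hsl hq i
    set n : RatFun b := (-1) ^ l i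
    set Y := y ^ ((l i : ℤ) - 1)
    have hyy : y ^ 2 * (y ^ 2)⁻¹ = 1 := mul_inv_cancel₀ (pow_ne_zero 2 hy)
    have h2 : (1 - (s ^ 2)⁻¹ * y ^ 2) *
        (Y * (coeffA s y * S T + n * (coeffB s y * S (signHom hsl i T)))) =
        (1 - (s ^ 2)⁻¹ * (y ^ 2)⁻¹) * T := by
      rw [inv_mul_eq_iff_eq_mul₀ hSD] at h
      rw [h, ← mul_assoc, mul_comm _ (S D), hrefl]
      field_simp
    linear_combination (-(y ^ 2)) * h2 + (s ^ 2)⁻¹ * T * hyy + Y * y ^ 2 * S T * hA +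
      Y * y ^ 2 * n * S (signHom hsl i T) * hB
  have := DFunLike.congr_fun ((mono_linearIndependent (b := b) hq) hlin) v
  rw [← this, div_eq_inv_mul, sub_eq_add_neg v]
  rfl

lemma even_stringLength_dotRefl (i : b.support) (v : b.support → ℤ) (t : ℤ) :
    Even (stringLength b l i (dotRefl b l i (v - Pi.single i t))) ↔ Even (stringLength b l i v) := by
  rw [dotRefl_eq, stringLength_add_single, sub_eq_add_neg v, ← Pi.single_neg,
    stringLength_add_single]
  simp [Int.even_sub, Int.even_add]

lemma reflCoeff_apply_of_even {i : b.support} {v : b.support → ℤ}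
    (h : Even (stringLength b l i v)) (c : (b.support → ℤ) →₀ ℂ) :
    reflCoeff b q l i c v = c (dotRefl b l i v) -
      c (dotRefl b l i (v - Pi.single i 2)) / ((√(q : ℝ) : ℝ) : ℂ) ^ 2 := by
  have h' : ∀ t, Even (stringLength b l i (dotRefl b l i (v - Pi.single i t))) :=
    fun t => (even_stringLength_dotRefl l i v t).2 h
  simp only [reflCoeff, Finsupp.add_apply, Finsupp.sub_apply, Finsupp.smul_apply, moveCoeff_apply,
    Finsupp.filter_apply, h', not_true_eq_false, if_true, if_false, smul_eq_mul]
  rw [Pi.single_zero, sub_zero]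
  ring

lemma reflCoeff_apply_of_odd {i : b.support} {v : b.support → ℤ}
    (h : ¬ Even (stringLength b l i v)) (c : (b.support → ℤ) →₀ ℂ) :
    reflCoeff b q l i c v =
      (((√(q : ℝ) : ℝ) : ℂ) * c (dotRefl b l i (v - Pi.single i 2)) +
        (((√(q : ℝ) : ℝ) : ℂ) ^ 2 - 1) * c (dotRefl b l i (v - Pi.single i 1)) -
        ((√(q : ℝ) : ℝ) : ℂ) * c (dotRefl b l i v)) / ((√(q : ℝ) : ℝ) : ℂ) ^ 2 := by
  have h' : ∀ t, ¬ Even (stringLength b l i (dotRefl b l i (v - Pi.single i t))) :=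
    fun t => (even_stringLength_dotRefl l i v t).not.2 h
  simp only [reflCoeff, Finsupp.add_apply, Finsupp.sub_apply, Finsupp.smul_apply, moveCoeff_apply,
    Finsupp.filter_apply, h', not_false_eq_true, if_true, if_false, smul_eq_mul]
  rw [Pi.single_zero, sub_zero]
  ring

/-- The ratio of the coefficients at the two ends of a string of length `m`. -/
def stringFactor (q : ℕ) (m : ℤ) : ℂ :=
  if Even m then -1 / ((√(q : ℝ) : ℝ) : ℂ) ^ 2 else 1 / ((√(q : ℝ) : ℝ) : ℂ)

lemma stringFactor_ne_zero (hq : 1 < q) (m : ℤ) : stringFactor q m ≠ 0 := by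
  have hs := sqrt_ne_zero hq
  rw [stringFactor]
  split_ifs
  · exact div_ne_zero (neg_ne_zero.2 one_ne_zero) (pow_ne_zero 2 hs)
  · exact one_div_ne_zero hs

lemma exists_string_bound (c : (b.support → ℤ) →₀ ℂ) (i : b.support) :
    ∃ n : ℤ, ∀ v : b.support → ℤ, n < v i → c v = 0 := by
  obtain ⟨n, hn⟩ := Finset.exists_le (c.support.image fun v => v i)
  refine ⟨n, fun v hv => ?_⟩
  by_contra h
  exact (hn (v i) (Finset.mem_image_of_mem _ (Finsupp.mem_support_iff.2 h))).not_gt hv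

lemma dotRefl_add_single (i : b.support) (v : b.support → ℤ) (k : ℤ) :
    dotRefl b l i (v + Pi.single i k) = v + Pi.single i (stringLength b l i v - k) := by
  rw [dotRefl_eq, stringLength_add_single, add_assoc, ← Pi.single_add]
  congr 2
  ring

/-- If the coefficients below `v` in its `i`-string vanish, then so do those above the shifted
reflection of `v`, and the coefficients at these two exponents are proportional. -/
lemma string_ends (hq : 1 < q) {i : b.support} {c : (b.support → ℤ) →₀ ℂ}
    (hc : ∀ v, c (v - Pi.single i 2) - c v / (((√(q : ℝ) : ℝ) : ℂ)) ^ 2 = reflCoeff b q l i c v)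
    {v : b.support → ℤ} (hv : ∀ k < 0, c (v + Pi.single i k) = 0) :
    (∀ k, stringLength b l i v < k → c (v + Pi.single i k) = 0) ∧
      c (dotRefl b l i v) = stringFactor q (stringLength b l i v) * c v := by
  obtain ⟨n, hn⟩ := exists_string_bound c i
  set m := stringLength b l i v with hm
  set a : ℤ → ℂ := fun k => c (v + Pi.single i k) with ha
  set a' : ℤ → ℂ := fun k => c (v + Pi.single i (m - k)) with ha'
  have hbound : ∀ k < v i + m - n, a' k = 0 := by
    intro k hk
    refine hn _ ?_
    rw [Pi.add_apply, Pi.single_eq_same]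
    omega
  have hL : ∀ k : ℤ, c (v + Pi.single i k - Pi.single i 2) = a (k - 2) := by
    intro k
    rw [ha, add_sub_assoc, ← Pi.single_sub]
  have hR : ∀ k t : ℤ, c (dotRefl b l i (v + Pi.single i k - Pi.single i t)) = a' (k - t) := by
    intro k t
    rw [add_sub_assoc, ← Pi.single_sub, dotRefl_add_single]
  have hR0 : ∀ k : ℤ, c (dotRefl b l i (v + Pi.single i k)) = a' k := by
    intro k
    rw [dotRefl_add_single]
  have key : (∀ k < 0, a' k = 0) ∧ a' 0 = stringFactor q m * a 0 := by
    by_cases he : Even m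
    · rw [stringFactor, if_pos he]
      refine string_even hv hbound fun k => ?_
      have h := hc (v + Pi.single i k)
      rwa [reflCoeff_apply_of_even l (by rw [stringLength_add_single]; simpa [Int.even_sub] using he),
        hL, hR, hR0] at h
    · rw [stringFactor, if_neg he]
      refine string_odd (sqrt_ne_zero hq) hv hbound fun k => ?_
      have h := hc (v + Pi.single i k)
      rwa [reflCoeff_apply_of_odd l (by rw [stringLength_add_single]; simpa [Int.even_sub] using he),
        hL, hR, hR, hR0] at h
  refine ⟨fun k hk => ?_, ?_⟩
  · have h := key.1 (m - k) (by omega)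
    simpa only [ha', sub_sub_cancel] using h
  · have h := key.2
    simpa only [ha, ha', Pi.single_zero, add_zero, sub_zero, hm, ← dotRefl_eq] using h

/-- The support of an invariant numerator stays in the cone spanned by the simple roots under all
shifted Weyl group elements: on each string it is contained in the segment between an exponent of the
support and its shifted reflection. -/
lemma repr_nonneg_of_coeff_ne_zero (hq : 1 < q) {c : (b.support → ℤ) →₀ ℂ}
    (hc : ∀ i v, c (v - Pi.single i 2) - c v / (((√(q : ℝ) : ℝ) : ℂ)) ^ 2 = reflCoeff b q l i c v)
    (hpos : ∀ v, ¬ 0 ≤ v → c v = 0) (w : P.weylGroup) (j : b.support) {v : b.support → ℤ}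
    (hv : c v ≠ 0) :
    0 ≤ b.toWeightBasis.repr (theta b l - w • (theta b l - ofCoords b v)) j := by
  revert v
  refine weylGroup_induction_of_isPos b (p := fun w => ∀ {v : b.support → ℤ}, c v ≠ 0 →
    0 ≤ b.toWeightBasis.repr (theta b l - w • (theta b l - ofCoords b v)) j) ?_ ?_ w
  · intro v hv
    rw [one_smul, sub_sub_cancel, repr_ofCoords]
    exact_mod_cast (not_not.1 fun h => hv (hpos v h) : 0 ≤ v) j
  · intro w i _ ih v hv
    -- the lowest exponent of the support in the string through `v`
    obtain ⟨u, hu, hmin⟩ := Finset.exists_min_image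
      (c.support.filter fun u => ∃ k : ℤ, u = v + Pi.single i k) (fun u => u i)
      ⟨v, Finset.mem_filter.2 ⟨Finsupp.mem_support_iff.2 hv, 0, by simp⟩⟩
    obtain ⟨hu0, k, hk⟩ := Finset.mem_filter.1 hu
    rw [Finsupp.mem_support_iff] at hu0
    have hlow : ∀ t < 0, c (u + Pi.single i t) = 0 := by
      intro t ht
      by_contra hne
      have := hmin (u + Pi.single i t) (by
        simp only [Finset.mem_filter, Finsupp.mem_support_iff]
        exact ⟨hne, k + t, by rw [hk, Pi.single_add, add_assoc]⟩)
      rw [Pi.add_apply, Pi.single_eq_same] at this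
      omega
    obtain ⟨hhigh, htop⟩ := string_ends l hq (hc i) hlow
    set m := stringLength b l i u with hm
    have hvu : v = u + Pi.single i (-k) := by rw [hk, Pi.single_neg, add_neg_cancel_right]
    have hk0 : 0 ≤ -k := by
      by_contra hcon
      exact hv (by rw [hvu]; exact hlow _ (by omega))
    have hkm : -k ≤ m := by
      by_contra hcon
      exact hv (by rw [hvu]; exact hhigh _ (by omega))
    have htop0 : c (dotRefl b l i u) ≠ 0 := by
      rw [htop]
      exact mul_ne_zero (stringFactor_ne_zero hq m) hu0
    have haff : ∀ t : ℤ, b.toWeightBasis.repr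
        (theta b l - w • (theta b l - ofCoords b (u + Pi.single i t))) j =
        b.toWeightBasis.repr (theta b l - w • (theta b l - ofCoords b u)) j +
          t * b.toWeightBasis.repr (w • P.root (i : ι)) j := by
      intro t
      rw [map_add, ofCoords_single, ← Int.cast_smul_eq_zsmul ℝ, ← sub_sub, smul_sub,
        weylGroup_smul_smul, sub_sub_eq_add_sub, add_sub_right_comm, map_add, map_smul]
      simp
    have h1 := ih hu0
    have h2 := ih htop0
    rw [mul_smul, ← ofCoords_dotRefl, hvu, dotRefl_add_single, haff]
    rw [dotRefl_eq, haff] at h2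
    set x := b.toWeightBasis.repr (w • P.root (i : ι)) j
    have hk0' : (0 : ℝ) ≤ -k := by exact_mod_cast hk0
    have hkm' : (-k : ℝ) ≤ m := by exact_mod_cast hkm
    push_cast
    -- an affine function on the string that is nonnegative at both ends
    rcases le_total 0 x with hx | hx <;> nlinarith

/-- The coefficients below a vertex in its string vanish. -/
lemma coeff_below_vertex (hq : 1 < q) {c : (b.support → ℤ) →₀ ℂ}
    (hc : ∀ i v, c (v - Pi.single i 2) - c v / (((√(q : ℝ) : ℝ) : ℂ)) ^ 2 = reflCoeff b q l i c v)
    (hpos : ∀ v, ¬ 0 ≤ v → c v = 0) {w : P.weylGroup} {i : b.support}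
    (hw : b.IsPos (w • (i : ι))) {k : ℤ} (hk : k < 0) :
    c (vertex b l w + Pi.single i k) = 0 := by
  by_contra hne
  refine rootCoords_ne_zero b (w • (i : ι)) (le_antisymm (fun j => ?_) (rootCoords_nonneg hw))
  have h := repr_nonneg_of_coeff_ne_zero l hq hc hpos w j hne
  rw [map_add, ofCoords_vertex, ofCoords_single, ← Int.cast_smul_eq_zsmul ℝ, ← sub_sub,
    sub_sub_cancel, smul_sub, smul_inv_smul, sub_sub_cancel, weylGroup_smul_smul, ← root_smul,
    ← ofCoords_rootCoords b (w • (i : ι)), map_smul, Finsupp.smul_apply, repr_ofCoords,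
    smul_eq_mul] at h
  have hk' : (k : ℝ) < 0 := by exact_mod_cast hk
  have h2 : ((rootCoords b (w • (i : ι)) j : ℤ) : ℝ) ≤ 0 := by
    by_contra hcon
    nlinarith
  exact_mod_cast h2

/-- The coefficients of an invariant numerator at the vertices. If `w α_i > 0`, passing from `w` to `w s_i`
leads from the lower to the upper end of a string of length `d_θ(w α_i)`. The powers of `√q` convert
coefficients with respect to `y` into coefficients with respect to `x`. -/
lemma coeff_vertex (hsl : b.cartanMatrix.IsSimplyLaced) (hq : 1 < q) {c : (b.support → ℤ) →₀ ℂ}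
    (hc : ∀ i v, c (v - Pi.single i 2) - c v / (((√(q : ℝ) : ℝ) : ℂ)) ^ 2 = reflCoeff b q l i c v)
    (hpos : ∀ v, ¬ 0 ≤ v → c v = 0) (h0 : c 0 = 1) (w : P.weylGroup) :
    c (vertex b l w) * ((√(q : ℝ) : ℝ) : ℂ) ^ (∑ j, vertex b l w j) =
      ∏ k ∈ inversionSet b w⁻¹,
        stringFactor q (dTheta b l k) * ((√(q : ℝ) : ℝ) : ℂ) ^ dTheta b l k := by
  refine weylGroup_induction_of_isPos b (p := fun w =>
    c (vertex b l w) * ((√(q : ℝ) : ℝ) : ℂ) ^ (∑ j, vertex b l w j) =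
      ∏ k ∈ inversionSet b w⁻¹,
        stringFactor q (dTheta b l k) * ((√(q : ℝ) : ℝ) : ℂ) ^ dTheta b l k) ?_ ?_ w
  · simp [vertex_one, h0, inversionSet_one]
  · intro w i hw ih
    have hs := sqrt_ne_zero hq
    rw [inversionSet_inv_mul_simpleRefl hw,
      Finset.prod_insert (smul_notMem_inversionSet_inv (b := b)), ← ih, vertex_mul_simpleRefl,
      (string_ends l hq (hc i) fun k hk => coeff_below_vertex l hq hc hpos hw hk).2, dotRefl_eq,
      stringLength_vertex l hsl hw]
    have hsum : ∑ j, (vertex b l w + Pi.single i ((dTheta b l (w • (i : ι)) : ℕ) : ℤ) : b.support → ℤ) j =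
        dTheta b l (w • (i : ι)) + ∑ j, vertex b l w j := by
      simp only [Pi.add_apply, Finset.sum_add_distrib, Finset.sum_pi_single', Finset.mem_univ,
        if_true]
      rw [add_comm]
    rw [hsum, zpow_add₀ hs, zpow_natCast]
    ring

/-- The coefficients of a polynomial `Q` with constant term `1` at the vertices, if `Q / D` is
invariant. -/
lemma exists_coeff_vertex_eq (hsl : b.cartanMatrix.IsSimplyLaced) (hq : 1 < q) {Q : Poly b}
    (hQ : ∀ i, slashSimple b q l (algebraMap (Poly b) (RatFun b) Q /
      algebraMap (Poly b) (RatFun b) (Denom b q)) i =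
        algebraMap (Poly b) (RatFun b) Q / algebraMap (Poly b) (RatFun b) (Denom b q))
    (h0 : Q.coeff 0 = 1) (w : P.weylGroup) : ∃ k : b.support →₀ ℕ,
      theta b l - w⁻¹ • theta b l = ∑ i, k i • P.root i ∧
      Q.coeff k = ∏ j ∈ inversionSet b w⁻¹,
        stringFactor q (dTheta b l j) * ((√(q : ℝ) : ℝ) : ℂ) ^ dTheta b l j := by
  obtain ⟨c, hc, hpos, hcoeff⟩ := exists_laurent_eq hq Q
  obtain ⟨k, hk⟩ := exists_nat_of_nonneg (vertex_nonneg l hsl w)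
  have h0' : c 0 = 1 := by
    have h := hcoeff 0
    have h1 : (fun j => (((0 : b.support →₀ ℕ) j : ℕ) : ℤ)) = 0 := rfl
    rw [h0, h1] at h
    simpa using h
  refine ⟨k, ?_, ?_⟩
  · rw [← ofCoords_vertex, hk, ofCoords_apply]
    simp
  · have h := coeff_vertex l hsl hq (fun i v => coeff_functional_equation l hsl hq
      (by rw [hc, ← algebraMap_Denom hq]; exact hQ i) v) hpos h0' w
    rw [← h, ← hcoeff, hk, ← zpow_natCast]
    congr 2
    push_cast
    rfl

end Coefficients


/-! ### Quadratic Gauss sums modulo prime powers -/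

section GaussSums

open scoped Classical

variable {O K : Type*} [CommRing O]

/-- `|O / p^n| = q^n`: multiplication by `p` identifies `O / p^n` with `pO / p^{n+1}`. -/
lemma card_quotient_span_pow [IsDomain O] {p : O} (hp : p ≠ 0) (n : ℕ) :
    Nat.card (O ⧸ Ideal.span {p ^ n}) = normOf p ^ n := by
  induction n with
  | zero =>
    rw [pow_zero, pow_zero, Ideal.span_singleton_one]
    have : Subsingleton (O ⧸ (⊤ : Ideal O)) := Ideal.Quotient.subsingleton_iff.2 rfl
    exact Nat.card_unique
  | succ n ih =>
    have hmap : ∀ a : O, (Ideal.span {a}).toAddSubgroup.map (AddMonoidHom.mulLeft p) =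
        (Ideal.span {p * a}).toAddSubgroup := by
      intro a
      ext x
      simp only [AddSubgroup.mem_map, Submodule.mem_toAddSubgroup, Ideal.mem_span_singleton,
        AddMonoidHom.coe_mulLeft]
      constructor
      · rintro ⟨y, hy, rfl⟩
        exact mul_dvd_mul_left p hy
      · rintro ⟨y, rfl⟩
        exact ⟨a * y, dvd_mul_right _ _, by ring⟩
    have hinj : Function.Injective (AddMonoidHom.mulLeft p) := mul_right_injective₀ hp
    have h1 := AddSubgroup.relIndex_map_map_of_injective (Ideal.span {p ^ n}).toAddSubgroup
      (Ideal.span {(1 : O)}).toAddSubgroup hinj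
    rw [hmap, hmap, mul_one, ← pow_succ', Ideal.span_singleton_one] at h1
    have hle : (Ideal.span {p ^ (n + 1)}).toAddSubgroup ≤ (Ideal.span {p}).toAddSubgroup := by
      intro x hx
      exact Ideal.span_singleton_le_span_singleton.2 (dvd_pow_self p n.succ_ne_zero) hx
    have h2 := AddSubgroup.relIndex_mul_index hle
    rw [h1] at h2
    have h3 : (Ideal.span {p ^ n}).toAddSubgroup.relIndex (⊤ : Ideal O).toAddSubgroup =
        Nat.card (O ⧸ Ideal.span {p ^ n}) := AddSubgroup.relIndex_top_right _
    have h4 : (Ideal.span {p}).toAddSubgroup.index = normOf p := rfl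
    have h5 : (Ideal.span {p ^ (n + 1)}).toAddSubgroup.index =
        Nat.card (O ⧸ Ideal.span {p ^ (n + 1)}) := rfl
    rw [h3, h4, h5, ih] at h2
    rw [pow_succ (normOf p), ← h2]

/-- Summing a function of the residue modulo `p` over the residues modulo `p^n`. -/
lemma finsum_quotient_pow [IsDomain O] {p : O} (hp : p ≠ 0) (hq : normOf p ≠ 0) (n : ℕ)
    [Fintype (O ⧸ Ideal.span {p})] (F : O ⧸ Ideal.span {p} → ℂ) :
    ∑ᶠ c : O ⧸ Ideal.span {p ^ (n + 1)},
      F (Ideal.Quotient.mk _ (Function.surjInv Ideal.Quotient.mk_surjective c)) =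
        (normOf p : ℂ) ^ n * ∑ x, F x := by
  have hfin : Finite (O ⧸ Ideal.span {p ^ (n + 1)}) :=
    Nat.finite_of_card_ne_zero (by rw [card_quotient_span_pow hp]; exact pow_ne_zero _ hq)
  haveI := Fintype.ofFinite (O ⧸ Ideal.span {p ^ (n + 1)})
  have hle : Ideal.span {p ^ (n + 1)} ≤ Ideal.span {p} :=
    Ideal.span_singleton_le_span_singleton.2 (dvd_pow_self p n.succ_ne_zero)
  set π := Ideal.Quotient.factor hle with hπ
  have hmk : ∀ c : O ⧸ Ideal.span {p ^ (n + 1)},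
      Ideal.Quotient.mk (Ideal.span {p}) (Function.surjInv Ideal.Quotient.mk_surjective c) = π c := by
    intro c
    conv_rhs => rw [← Function.surjInv_eq Ideal.Quotient.mk_surjective c]
    rw [hπ, Ideal.Quotient.factor_mk]
  have hsurj : Function.Surjective π := Ideal.Quotient.factor_surjective hle
  have hcard : ∀ x, (Finset.univ.filter fun c => π c = x).card =
      (Finset.univ.filter fun c => π c = 0).card := fun x =>
    AddMonoidHom.card_fiber_eq_of_mem_range π (hsurj x) (hsurj 0)
  have htot : (Finset.univ.filter fun c => π c = 0).card * normOf p = normOf p ^ (n + 1) := by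
    have h1 := Finset.card_eq_sum_card_fiberwise (f := π) (s := Finset.univ) (t := Finset.univ)
      (by simp [Set.MapsTo])
    rw [Finset.sum_congr rfl fun x _ => hcard x, Finset.sum_const, Finset.card_univ,
      Finset.card_univ, ← Nat.card_eq_fintype_card, ← Nat.card_eq_fintype_card,
      card_quotient_span_pow hp, smul_eq_mul] at h1
    rw [h1, mul_comm]
    rfl
  rw [pow_succ (normOf p)] at htot
  have hN := Nat.eq_of_mul_eq_mul_right (Nat.pos_of_ne_zero hq) htot
  rw [finsum_eq_sum_of_fintype, Finset.sum_congr rfl fun c _ => by rw [hmk],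
    ← Finset.sum_fiberwise (g := π), Finset.mul_sum]
  refine Finset.sum_congr rfl fun x _ => ?_
  rw [Finset.sum_congr rfl fun c hc => by rw [(Finset.mem_filter.1 hc).2], Finset.sum_const,
    hcard, hN, nsmul_eq_mul, Nat.cast_pow]

variable [Field K] [Algebra O K]

lemma addChar_div_eq {p : O} (hp : algebraMap O K p ≠ 0) {ψ : AddChar K ℂ}
    (hψ : ∀ a : O, ψ (algebraMap O K a) = 1) {d d' : O}
    (h : Ideal.Quotient.mk (Ideal.span {p}) d = Ideal.Quotient.mk (Ideal.span {p}) d') :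
    ψ (algebraMap O K d / algebraMap O K p) = ψ (algebraMap O K d' / algebraMap O K p) := by
  obtain ⟨e, he⟩ := Ideal.mem_span_singleton.1 (Ideal.Quotient.eq.1 h)
  have h1 : algebraMap O K d / algebraMap O K p =
      algebraMap O K d' / algebraMap O K p + algebraMap O K e := by
    rw [eq_add_of_sub_eq' he, map_add, map_mul]
    field_simp
  rw [h1, AddChar.map_add_eq_mul, hψ, mul_one]

/-- The additive character `d ↦ ψ(d / p)` of `O / p`. -/
def residueChar {p : O} (hp : algebraMap O K p ≠ 0) {ψ : AddChar K ℂ}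
    (hψ : ∀ a : O, ψ (algebraMap O K a) = 1) : AddChar (O ⧸ Ideal.span {p}) ℂ where
  toFun x := ψ (algebraMap O K (Function.surjInv Ideal.Quotient.mk_surjective x) / algebraMap O K p)
  map_zero_eq_one' := by
    rw [addChar_div_eq hp hψ (d' := 0) (by rw [Function.surjInv_eq Ideal.Quotient.mk_surjective, map_zero])]
    simp
  map_add_eq_mul' x y := by
    rw [← AddChar.map_add_eq_mul, ← add_div, ← map_add]
    refine addChar_div_eq hp hψ ?_
    rw [map_add]
    simp only [Function.surjInv_eq]

lemma residueChar_mk {p : O} (hp : algebraMap O K p ≠ 0) {ψ : AddChar K ℂ}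
    (hψ : ∀ a : O, ψ (algebraMap O K a) = 1) (d : O) :
    residueChar hp hψ (Ideal.Quotient.mk _ d) = ψ (algebraMap O K d / algebraMap O K p) :=
  addChar_div_eq hp hψ (Function.surjInv_eq _ _)

lemma residueSymbol_eq (p d : O) [DecidableEq (O ⧸ Ideal.span {p})]
    [DecidablePred (IsSquare : O ⧸ Ideal.span {p} → Prop)] : residueSymbol p d =
    quadraticCharFun (O ⧸ Ideal.span {p}) (Ideal.Quotient.mk _ d) := by
  have h1 : Ideal.Quotient.mk (Ideal.span {p}) d = 0 ↔ p ∣ d := by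
    rw [Ideal.Quotient.eq_zero_iff_mem, Ideal.mem_span_singleton]
  have h2 : IsSquare (Ideal.Quotient.mk (Ideal.span {p}) d) ↔ ∃ y : O, p ∣ d - y ^ 2 := by
    rw [isSquare_iff_exists_sq, Ideal.Quotient.mk_surjective.exists]
    refine exists_congr fun y => ?_
    rw [← map_pow, Ideal.Quotient.eq, Ideal.mem_span_singleton]
  rw [residueSymbol, quadraticCharFun]
  by_cases hd : p ∣ d
  · rw [if_pos hd, if_pos (h1.2 hd)]
  · rw [if_neg hd, if_neg (h1.not.2 hd)]
    by_cases hd' : ∃ y : O, p ∣ d - y ^ 2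
    · rw [if_pos hd', if_pos (h2.2 hd')]
    · rw [if_neg hd', if_neg (h2.not.2 hd')]

lemma rawGaussSum_eq_sum [IsDomain O] {p : O} (hp : algebraMap O K p ≠ 0) (hq : normOf p ≠ 0)
    {ψ : AddChar K ℂ} (hψ : ∀ a : O, ψ (algebraMap O K a) = 1) (n : ℕ)
    [Fintype (O ⧸ Ideal.span {p})] :
    rawGaussSum p ψ n (n + 1) = (normOf p : ℂ) ^ n *
      ∑ x, ((quadraticCharFun (O ⧸ Ideal.span {p}) x : ℤ) : ℂ) ^ (n + 1) * residueChar hp hψ x := by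
  rw [← finsum_quotient_pow (p := p) (by rintro rfl; simp at hp) hq, rawGaussSum]
  refine finsum_congr fun c => ?_
  dsimp only
  rw [← residueSymbol_eq, residueChar_mk]
  congr 2
  rw [map_mul, map_pow, map_pow, pow_succ (algebraMap O K p), mul_div_mul_left _ _ (pow_ne_zero n hp)]

lemma sum_quadraticCharFun_pow_of_even {F : Type*} [Field F] [Fintype F] {Ψ : AddChar F ℂ}
    (hΨ : Ψ ≠ 1) {n : ℕ} (hn : Even n) (hn0 : n ≠ 0) :
    ∑ x, ((quadraticCharFun F x : ℤ) : ℂ) ^ n * Ψ x = -1 := by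
  have h1 : ∀ x, ((quadraticCharFun F x : ℤ) : ℂ) ^ n * Ψ x = Ψ x - if x = 0 then 1 else 0 := by
    intro x
    rw [quadraticCharFun]
    split_ifs with h h'
    · simp [h, hn0]
    · simp
    · simp [hn.neg_one_pow]
  rw [Finset.sum_congr rfl fun x _ => h1 x, Finset.sum_sub_distrib,
    AddChar.sum_eq_zero_of_ne_one hΨ]
  simp

lemma sum_quadraticCharFun_pow_of_odd {F : Type*} [Field F] [Fintype F] (Ψ : AddChar F ℂ) {n : ℕ}
    (hn : Odd n) : ∑ x, ((quadraticCharFun F x : ℤ) : ℂ) ^ n * Ψ x =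
      gaussSum ((quadraticChar F).ringHomComp (Int.castRingHom ℂ)) Ψ := by
  rw [gaussSum]
  refine Finset.sum_congr rfl fun x _ => ?_
  congr 1
  rw [MulChar.ringHomComp_apply, quadraticChar_apply, quadraticCharFun]
  split_ifs
  · simp [hn.pos.ne']
  · simp
  · simp [hn.neg_one_pow]

lemma norm_gaussSum_quadraticChar {F : Type*} [Field F] [Fintype F] (hF : Odd (Fintype.card F))
    {Ψ : AddChar F ℂ} (hΨ : Ψ ≠ 1) :
    ‖gaussSum ((quadraticChar F).ringHomComp (Int.castRingHom ℂ)) Ψ‖ = √(Fintype.card F : ℝ) := by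
  have hchar : ringChar F ≠ 2 := by
    rw [Ne, FiniteField.even_card_iff_char_two, ← Nat.even_iff]
    exact Nat.not_even_iff_odd.2 hF
  have h := gaussSum_sq ((MulChar.ringHomComp_ne_one_iff (f := Int.castRingHom ℂ)
    (RingHom.injective_int _)).2 (quadraticChar_ne_one hchar))
    ((quadraticChar_isQuadratic F).comp (Int.castRingHom ℂ)) (AddChar.IsPrimitive.of_ne_one hΨ)
  have h1 : ‖((quadraticChar F).ringHomComp (Int.castRingHom ℂ)) (-1)‖ = 1 := by
    rw [MulChar.ringHomComp_apply]
    rcases quadraticChar_dichotomy (F := F) (a := -1) (by simp) with h | h <;> simp [h]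
  have h2 := congrArg norm h
  rw [norm_pow, norm_mul, h1, one_mul, Complex.norm_natCast] at h2
  rw [← h2, Real.sqrt_sq (norm_nonneg _)]

/-- The normalised Gauss sums that occur in the stable coefficients: the quadratic character drops out
for even exponents, and for odd exponents the sum is a multiple of the quadratic Gauss sum of the
residue field, whose absolute value is `√q`. -/
lemma gaussSum₁_eq [IsDomain O] {p : O} (hp : Prime p) (hpK : algebraMap O K p ≠ 0)
    (hodd : Odd (normOf p)) {ψ : AddChar K ℂ} (hψ : ∀ a : O, ψ (algebraMap O K a) = 1)
    (hψp : ∃ a : O, ψ (algebraMap O K a / algebraMap O K p) ≠ 1) (n : ℕ) :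
    gaussSum₁ p ψ n (n + 1) =
      stringFactor (normOf p) ((n + 1 : ℕ) : ℤ) * (normOf p : ℂ) ^ (n + 1) := by
  have hq : normOf p ≠ 0 := hodd.pos.ne'
  have hfin : Finite (O ⧸ Ideal.span {p}) := Nat.finite_of_card_ne_zero hq
  haveI := Fintype.ofFinite (O ⧸ Ideal.span {p})
  haveI : (Ideal.span {p}).IsPrime := (Ideal.span_singleton_prime hp.ne_zero).2 hp
  letI : Field (O ⧸ Ideal.span {p}) := Fintype.fieldOfDomain _
  have hcard : Fintype.card (O ⧸ Ideal.span {p}) = normOf p := Nat.card_eq_fintype_card.symm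
  have hΨ : residueChar hpK hψ ≠ 1 := by
    obtain ⟨a, ha⟩ := hψp
    intro h
    rw [← residueChar_mk hpK hψ, h] at ha
    exact ha rfl
  have hqC : (normOf p : ℂ) ≠ 0 := Nat.cast_ne_zero.2 hq
  have hs : ((√(normOf p : ℝ) : ℝ) : ℂ) ^ 2 = normOf p := sqrt_sq _
  have hs0 : ((√(normOf p : ℝ) : ℝ) : ℂ) ≠ 0 := fun h => hqC (by rw [← hs, h]; simp)
  rw [gaussSum₁, rawGaussSum_eq_sum hpK hq hψ n, stringFactor]
  by_cases he : Even (n + 1)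
  · rw [if_neg (Nat.not_odd_iff_even.2 he), if_pos (Int.even_coe_nat _ |>.2 he), one_mul, hs,
      sum_quadraticCharFun_pow_of_even hΨ he n.succ_ne_zero, pow_succ]
    field_simp
  · have ho := Nat.not_even_iff_odd.1 he
    have h1 := rawGaussSum_eq_sum hpK hq hψ 0
    rw [zero_add] at h1
    rw [if_pos ho, if_neg (mt (Int.even_coe_nat _).1 he), h1, sum_quadraticCharFun_pow_of_odd _ ho,
      sum_quadraticCharFun_pow_of_odd _ odd_one, pow_zero, one_mul,
      norm_gaussSum_quadraticChar (by rwa [hcard]) hΨ, hcard]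
    set g := gaussSum ((quadraticChar (O ⧸ Ideal.span {p})).ringHomComp (Int.castRingHom ℂ))
      (residueChar hpK hψ) with hg
    have hg0 : g ≠ 0 := by
      intro h
      have h2 := norm_gaussSum_quadraticChar (by rwa [hcard]) hΨ
      rw [← hg, h, norm_zero, hcard] at h2
      exact hs0 (by rw [← h2]; simp)
    field_simp
    rw [hs, pow_succ, mul_comm]

/-- The stable coefficient as a product of string factors. -/
lemma stableCoeff_eq {ι M N : Type*} [Fintype ι] [AddCommGroup M] [Module ℝ M] [AddCommGroup N]
    [Module ℝ N] {P : RootPairing ι ℝ M N} [P.IsRootSystem] [P.IsCrystallographic] [P.IsReduced]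
    {b : P.Base} (hsl : b.cartanMatrix.IsSimplyLaced) (l : b.support → ℕ) [IsDomain O] {p : O}
    (hp : Prime p) (hpK : algebraMap O K p ≠ 0) (hodd : Odd (normOf p)) {ψ : AddChar K ℂ}
    (hψ : ∀ a : O, ψ (algebraMap O K a) = 1)
    (hψp : ∃ a : O, ψ (algebraMap O K a / algebraMap O K p) ≠ 1) (w : P.weylGroup) :
    stableCoeff b l p ψ w = ∏ k ∈ inversionSet b w⁻¹,
      stringFactor (normOf p) (dTheta b l k) *
        ((√(normOf p : ℝ) : ℝ) : ℂ) ^ dTheta b l k := by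
  have hqC : (normOf p : ℂ) ≠ 0 := Nat.cast_ne_zero.2 hodd.pos.ne'
  have hs : ((√(normOf p : ℝ) : ℝ) : ℂ) ^ 2 = normOf p := sqrt_sq _
  have hs0 : ((√(normOf p : ℝ) : ℝ) : ℂ) ≠ 0 := fun h => hqC (by rw [← hs, h]; simp)
  refine Finset.prod_congr rfl fun k hk => ?_
  have hpos := dTheta_pos l hsl (mem_inversionSet.1 hk).1
  obtain ⟨n, hn⟩ := Nat.exists_eq_succ_of_ne_zero hpos.ne'
  rw [hn, Nat.succ_eq_add_one, Nat.add_sub_cancel, gaussSum₁_eq hp hpK hodd hψ hψp, ← hs,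
    div_eq_iff (pow_ne_zero _ hs0)]
  ring

end GaussSums

end TwistedWMDS

end

theorem theorem4p2 {ι M N : Type*} [Fintype ι] [AddCommGroup M] [Module ℝ M] [AddCommGroup N]
    [Module ℝ N] (P : RootPairing ι ℝ M N) [P.IsRootSystem] [P.IsCrystallographic] [P.IsReduced]
    (b : P.Base) (hsl : b.cartanMatrix.IsSimplyLaced) (l : b.support → ℕ)
    {O K : Type*} [CommRing O] [IsDomain O] [Field K] [Algebra O K] [IsFractionRing O K]
    (p : O) (hp : Prime p) (hodd : Odd (TwistedWMDS.normOf p))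
    (ψ : AddChar K ℂ) (hψ : ∀ a : O, ψ (algebraMap O K a) = 1)
    (hψp : ∃ a : O, ψ (algebraMap O K a / algebraMap O K p) ≠ 1) :
    (∃ Q : MvPolynomial b.support ℂ,
      algebraMap _ (TwistedWMDS.RatFun b) Q = TwistedWMDS.numerator b (TwistedWMDS.normOf p) l ∧
      Q.coeff 0 = 1 ∧
      ∀ w : P.weylGroup, ∃ k : b.support →₀ ℕ,
        TwistedWMDS.theta b l - w⁻¹ • TwistedWMDS.theta b l = ∑ i, k i • P.root i ∧
        Q.coeff k = TwistedWMDS.stableCoeff b l p ψ w) ∧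
    (∀ Q : MvPolynomial b.support ℂ,
      (∀ i : b.support,
        TwistedWMDS.slashSimple b (TwistedWMDS.normOf p) l
            (algebraMap _ (TwistedWMDS.RatFun b) Q /
              algebraMap _ (TwistedWMDS.RatFun b) (TwistedWMDS.Denom b (TwistedWMDS.normOf p))) i =
          algebraMap _ (TwistedWMDS.RatFun b) Q /
            algebraMap _ (TwistedWMDS.RatFun b) (TwistedWMDS.Denom b (TwistedWMDS.normOf p))) →
      Q.coeff 0 = 1 →
      ∀ w : P.weylGroup, ∃ k : b.support →₀ ℕ,
        TwistedWMDS.theta b l - w⁻¹ • TwistedWMDS.theta b l = ∑ i, k i • P.root i ∧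
        Q.coeff k = TwistedWMDS.stableCoeff b l p ψ w) := by
  have hpK : algebraMap O K p ≠ 0 :=
    (map_ne_zero_iff _ (IsFractionRing.injective O K)).2 hp.ne_zero
  have hq : 1 < TwistedWMDS.normOf p := by
    have : (Ideal.span {p}).IsPrime := (Ideal.span_singleton_prime hp.ne_zero).2 hp
    have : Finite (O ⧸ Ideal.span {p}) := Nat.finite_of_card_ne_zero hodd.pos.ne'
    exact Finite.one_lt_card
  have key : ∀ Q : MvPolynomial b.support ℂ,
      (∀ i : b.support,
        TwistedWMDS.slashSimple b (TwistedWMDS.normOf p) l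
            (algebraMap _ (TwistedWMDS.RatFun b) Q /
              algebraMap _ (TwistedWMDS.RatFun b) (TwistedWMDS.Denom b (TwistedWMDS.normOf p))) i =
          algebraMap _ (TwistedWMDS.RatFun b) Q /
            algebraMap _ (TwistedWMDS.RatFun b) (TwistedWMDS.Denom b (TwistedWMDS.normOf p))) →
      Q.coeff 0 = 1 →
      ∀ w : P.weylGroup, ∃ k : b.support →₀ ℕ,
        TwistedWMDS.theta b l - w⁻¹ • TwistedWMDS.theta b l = ∑ i, k i • P.root i ∧
        Q.coeff k = TwistedWMDS.stableCoeff b l p ψ w := by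
    intro Q hQ h0 w
    obtain ⟨k, hk, hcoeff⟩ := TwistedWMDS.exists_coeff_vertex_eq l hsl hq hQ h0 w
    exact ⟨k, hk, hcoeff.trans
      (TwistedWMDS.stableCoeff_eq hsl l hp hpK hodd hψ hψp w).symm⟩
  refine ⟨?_, key⟩
  obtain ⟨Q, hQ, h0⟩ := TwistedWMDS.exists_numerator_eq hsl hq l
  refine ⟨Q, hQ, h0, key Q (fun i => ?_) h0⟩
  have hD : algebraMap _ (TwistedWMDS.RatFun b) (TwistedWMDS.Denom b (TwistedWMDS.normOf p)) ≠ 0 := by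
    rw [TwistedWMDS.algebraMap_Denom hq]
    exact TwistedWMDS.posProd_ne_zero hq _
  rw [hQ, TwistedWMDS.numerator, mul_div_cancel_right₀ _ hD, TwistedWMDS.slashSimple_pPart hsl hq]
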